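/- Let $N\ge 2$ and $k\ge 1$ be integers and write $\mathbb Z_N=\mathbb Z/N\mathbb Z$. **Fourier notation.** Let $\Lambda$ be a finite set. For $f:\mathbb Z_N^\Lambda\to\mathbb C$ and $b\in\mathbb Z_N^\Lambda$ put $\chi_b(x)=\exp\big(\frac{2\pi \mathrm i}{N}\sum_{v\in\Lambda}b_vx_v\big)$, $\widehat f(b)=\mathbb E_{x}[f(x)\overline{\chi_b(x)}]$ with $x$ uniform in $\mathbb Z_N^\Lambda$, $\|f\|_{\mathsf W}=\sum_b|\widehat f(b)|$, and $f^{=d}=\sum_{|\mathrm{supp}(b)|=d}\widehat f(b)\chi_b$. For an integer $d\ge 1$ let $$F_C(n,d,s)=\left(\frac{C\sqrt{n\max\{s,d\}}}{d}\right)^{d/2}.$$ For $n,C,s\ge 1$ and $\delta\ge 0$, a function $f:\mathbb Z_N^\Lambda\to[0,\infty)$ is $(n,C,s,\delta)$-*bounded* if (1) $1-\delta\le\mathbb E[f]\le 1+\delta$; (2) $\|f^{=d}\|_{\mathsf W}\le F_C(n,d,s)$ for every integer $d$ with $1\le d\le C^{-2}n$; (3) $\|f\|_\infty\le 2^{s}$.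 **Matchings.** A $k$-universe embedded in $\Lambda$ is a tuple $\mathcal U=(U_1,\dots,U_k)$ of pairwise disjoint subsets of $\Lambda$ of a common cardinality, denoted $|\mathcal U|$. Let $\mathcal M_{\mathcal U,m}$ be the collection of all sets of $m$ pairwise vertex-disjoint edges from $U_1\times\dots\times U_k$. A probability distribution $\mathcal D$ on $\mathcal M_{\mathcal U,m}$ is *pseudo-uniform* if for every integer $0\le d\le m$ and every $S\in\mathcal M_{\mathcal U,d}$, $$\Pr_{M\sim\mathcal D}[S\subseteq M]\le 2^d\cdot\Pr_{M\in\mathcal M_{\mathcal U,m}}[S\subseteq M],$$ where on the right $M$ is uniformly random in $\mathcal M_{\mathcal U,m}$. **The operator.** A probability distribution $\mu$ on $\mathbb Z_N^k$ is *one-wise independent* if each of its $k$ coordinate marginals is uniform on $\mathbb Z_N$; its probability mass function is also written $\mu$. For $M\in\mathcal M_{\mathcal U,m}$ let $\mathrm{Map}(M,\mathbb Z_N^k)$ be the set of all maps $\boldsymbol\xi:M\to\mathbb Z_N^k$. For $g:\mathrm{Map}(M,\mathbb Z_N^k)\to\mathbb C$ and $x\in\mathbb Z_N^\Lambda$ let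 $$\boldsymbol R^{\Lambda,M}_\mu[g](x)=\sum_{\boldsymbol\xi\in\mathrm{Map}(M,\mathbb Z_N^k)}g(\boldsymbol\xi)\prod_{e\in M}\mu\big(x_{|e}-\boldsymbol\xi(e)\big),$$ where $x_{|e}=(x_{v_1},\dots,x_{v_k})$ for $e=(v_1,\dots,v_k)$. For a nonempty $A\subseteq\mathrm{Map}(M,\mathbb Z_N^k)$ let $\phi_A=\frac{N^{km}}{|A|}\mathbf 1_A$. **Lemma.** Let $\mathcal U$ be a $k$-universe embedded in a finite set $\Lambda$. Let $C\in[1,\infty)$, $\delta_0\in[0,\frac12]$, $\delta\in(0,\frac12]$, $m\in\mathbb Z$ and $s^*\in\mathbb R$ satisfy $$0<m\le\frac{|\mathcal U|^3}{2^{18}N^{10k}|\Lambda|^2}\qquad\text{and}\qquad\log_2(4/\delta)\le s^*\le(10C)^{-2}\delta^4m.$$ Suppose that $f:\mathbb Z_N^\Lambda\to[0,\infty)$ is $(|\mathcal U|,C,s^*,\delta_0)$-bounded and that $\mathcal D$ is a pseudo-uniform distribution on $\mathcal M_{\mathcal U,m}$. Then for every $\eta\in(0,\frac12)$, with probability at least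 $1-3\eta$ over $M\sim\mathcal D$ the following holds: for every $A\subseteq\mathrm{Map}(M,\mathbb Z_N^k)$ with $|A|\ge 2^{-s^*}N^{km}$ and every one-wise independent distribution $\mu$ on $\mathbb Z_N^k$, the function $f\cdot\boldsymbol R^{\Lambda,M}_\mu[\phi_A]$ is $$\Big(|\mathcal U|,\ 2^{22}\eta^{-2}N^{8k}C,\ 2s^*,\ \delta_0+\eta^{-1}\delta\Big)\text{-bounded}.$$ -/

import Mathlib

open scoped BigOperators

noncomputable section

namespace LabeledMatching

/-- The probability of an event under a discrete distribution, as a real number. -/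
def prob {α : Type*} (D : PMF α) (E : Set α) : ℝ :=
  (D.toOuterMeasure E).toReal

/-- The expectation of a function under the uniform distribution on a finite type. -/
def expect {X : Type*} [Fintype X] (f : X → ℂ) : ℂ :=
  (∑ x, f x) / (Fintype.card X : ℂ)

/-- A distribution on `Γ ^ k` is one-wise independent if each of its `k` one-coordinate marginals
is the uniform distribution on `Γ`. -/
def IsOneWiseIndependent {k : ℕ} {Γ : Type*} [Fintype Γ] [Nonempty Γ]
    (μ : PMF (Fin k → Γ)) : Prop :=
  ∀ i : Fin k, μ.map (fun z => z i) = PMF.uniformOfFintype Γ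

/-- The density, with respect to the uniform distribution on `X`, of the uniform distribution
on `A`. -/
def uniformDensity {X : Type*} [Fintype X] [DecidableEq X] (A : Finset X) (x : X) : ℝ :=
  if x ∈ A then (Fintype.card X : ℝ) / (A.card : ℝ) else 0

/-! ### Fourier analysis on `ZMod N ^ Λ` -/

section Fourier

variable {N : ℕ} [NeZero N] {Λ : Type*} [Fintype Λ] [DecidableEq Λ]

/-- The character `χ_b(x) = exp ((2 π i / N) ∑ v, b v * x v)`; `ZMod.stdAddChar` is the map
`j ↦ exp (2 π i j / N)`. -/
def character (b x : Λ → ZMod N) : ℂ :=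
  ZMod.stdAddChar (∑ v, b v * x v)

/-- The Fourier coefficient `⟨f, χ_b⟩`, with the inner product normalized by the uniform
probability measure. -/
def charCoeff (f : (Λ → ZMod N) → ℂ) (b : Λ → ZMod N) : ℂ :=
  expect fun x => f x * (starRingEnd ℂ) (character b x)

/-- The Fourier `ℓ¹`-norm. -/
def wienerNorm (f : (Λ → ZMod N) → ℂ) : ℝ :=
  ∑ b : Λ → ZMod N, ‖charCoeff f b‖

/-- The degree-`d` part of `f`: the part of its Fourier expansion that is carried by the
characters whose index has exactly `d` nonzero coordinates. -/
def levelPart (f : (Λ → ZMod N) → ℂ) (d : ℕ) (x : Λ → ZMod N) : ℂ :=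
  ∑ b : Λ → ZMod N with hammingNorm b = d, charCoeff f b * character b x

/-- The Fourier growth bound `F_C(n, d, s)`. -/
def growthBound (C : ℝ) (n d : ℕ) (s : ℝ) : ℝ :=
  (C * √((n : ℝ) * max s (d : ℝ)) / (d : ℝ)) ^ ((d : ℝ) / 2)

/-- `(n, C, s, δ)`-boundedness of a nonnegative function on `ZMod N ^ Λ`. -/
structure IsBounded (n : ℕ) (C s δ : ℝ) (f : (Λ → ZMod N) → ℝ) : Prop where
  nonneg : ∀ x, 0 ≤ f x
  le_mean : 1 - δ ≤ (∑ x, f x) / (Fintype.card (Λ → ZMod N) : ℝ)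
  mean_le : (∑ x, f x) / (Fintype.card (Λ → ZMod N) : ℝ) ≤ 1 + δ
  level_le : ∀ d : ℕ, 1 ≤ d → (d : ℝ) ≤ (C ^ 2)⁻¹ * (n : ℝ) →
    wienerNorm (levelPart (fun x => (f x : ℂ)) d) ≤ growthBound C n d s
  le_max : ∀ x, f x ≤ (2 : ℝ) ^ s

end Fourier

/-! ### Universes and matchings -/

/-- A `k`-universe embedded in `Λ`: the `k` parts of the vertex set of a complete `k`-partite
hypergraph, that is, pairwise disjoint subsets of `Λ` of a common cardinality `card`. -/
structure KUniverse (k : ℕ) (Λ : Type*) where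
  parts : Fin k → Finset Λ
  card : ℕ
  card_parts : ∀ i, (parts i).card = card
  disjoint_parts : Pairwise fun i j => Disjoint (parts i) (parts j)

namespace KUniverse

variable {k : ℕ} {Λ : Type*} [DecidableEq Λ]

/-- The matchings with `m` edges: sets of `m` pairwise vertex-disjoint edges, where an edge is an
element of the Cartesian product of the parts. -/
def matchings (U : KUniverse k Λ) (m : ℕ) : Finset (Finset (Fin k → Λ)) :=
  (Fintype.piFinset U.parts).powerset.filter fun M =>
    M.card = m ∧ ∀ e ∈ M, ∀ e' ∈ M, e ≠ e' → ∀ i j, e i ≠ e' j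

/-- The probability that a uniformly random matching with `m` edges contains `S`. -/
def uniformContainProb (U : KUniverse k Λ) (m : ℕ) (S : Finset (Fin k → Λ)) : ℝ :=
  (((U.matchings m).filter fun M => S ⊆ M).card : ℝ) / ((U.matchings m).card : ℝ)

/-- Pseudo-uniformity of a distribution on the matchings with `m` edges. -/
def IsPseudoUniform (U : KUniverse k Λ) {m : ℕ} (D : PMF ↥(U.matchings m)) : Prop :=
  ∀ d : ℕ, d ≤ m → ∀ S ∈ U.matchings d,
    prob D {M | S ⊆ M.1} ≤ (2 : ℝ) ^ d * U.uniformContainProb m S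

end KUniverse

/-! ### The Markov operator of a matching -/

section Markov

variable {k N : ℕ} [NeZero N] {Λ : Type*}

/-- The labelings of the edges of `M` by elements of `ZMod N ^ k`. -/
abbrev Labeling (N : ℕ) (M : Finset (Fin k → Λ)) : Type _ :=
  ↥M → Fin k → ZMod N

/-- The stochastic matrix with entries `∏ e ∈ M, μ (x|ₑ - ξ e)`, where `x|ₑ` is the vector of the
values of `x` at the vertices of `e`. -/
def markovKernel (M : Finset (Fin k → Λ)) (μ : PMF (Fin k → ZMod N))
    (x : Λ → ZMod N) (ξ : Labeling N M) : ℝ :=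
  ∏ e : ↥M, (μ fun i => x (e.1 i) - ξ e i).toReal

/-- The linear operator of `markovKernel`, from functions of the labeling to functions on
`ZMod N ^ Λ`. -/
def markovOp [DecidableEq Λ] (M : Finset (Fin k → Λ)) (μ : PMF (Fin k → ZMod N))
    (g : Labeling N M → ℝ) (x : Λ → ZMod N) : ℝ :=
  ∑ ξ : Labeling N M, markovKernel M μ x ξ * g ξ

end Markov

end LabeledMatching

end

/-!
The function `f · R[φ]` is analysed in the Fourier basis of `ZMod N ^ Λ`. Since `M` is a matching,
the operator maps the character of labelings with index `γ` to a multiple, of modulus at most one,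
of the character of `ZMod N ^ Λ` whose index carries the labels of `γ` at the vertices of the edges
(`markovOp_eq_sum`). One-wise independence kills every `γ` with a block that has exactly one nonzero
entry. So the mass of the product at level `d` is at most the sum of `|φ̂(γ)| |f̂(b)|` over the
remaining `γ` and the vectors `b` for which `b + γ` has weight `d`. None of this depends on the
distribution, and a set `A` enters only through the bounds on `φ̂`; the good event only concerns
how labelings of `M` move the coefficients of `f`.

Two facts are used about `φ̂`. Its `ℓ²` norm is at most `2 ^ (s / 2)`, and the `ℓ¹` norm of any
shift of it over the remaining labelings of total weight `d` is at most `F_{19 q}(n, d, s)` with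
`q = N ^ k` (`sum_norm_tableCoeff_le`), by duality from a hypercontractive inequality (`hypercontractive`).

For the matching, switching edges shows that a set of edges is contained in `M` with probability at
most that of a product measure of density `4 m / n ^ k` (`prob_subset_le`), so the mean of a product
of edge weights over `M` is at most the exponential of a sum over all edges
(`pmfMean_prod_one_add_le`). A nonzero block with at least two nonzero entries, on an edge that
meets the support of `b` in `t` vertices, lowers the weight by at most `2 t - 2`. With a scale
parameter `z` this bounds the mean number of labelings that turn the weight of `b` into `d`.

For `b` of weight at most `n / C ^ 2`, the labeling is split into its parts on edges that meet the
support of `b` and on the other edges. The first part is counted on average, with `z` proportional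
to the base of the growth bound (`pmfMean_touchedMass_le_growthBound`, and
`pmfMean_touchedMass_zero_le` at level zero); the second adds its full weight and is summed by the
`ℓ¹` bound (`sum_smallWeight_le`). For `b` of larger weight the contribution is negligible: by
Cauchy-Schwarz it is controlled by the `ℓ²` norms of `φ̂` and `f̂`, by the number of vectors of
weight `d`, and by the mean number of labelings that bring such a `b` down to weight `d`, which is
tiny (`pmfMean_card_reweightings_large_le`). Markov's inequality, with geometric weights over the
levels, gives the three failure probabilities `η`.
-/

/-! ### Fourier analysis for a self-dual character table -/

namespace LabeledMatching

noncomputable section FourierTables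

/-- A character table identifying a finite abelian group with its own dual: `χ a x` is a
bimultiplicative unimodular pairing whose nontrivial rows and columns sum to zero. -/
structure IsSelfDual {Y : Type*} [Fintype Y] [AddCommGroup Y] (χ : Y → Y → ℂ) : Prop where
  add_left : ∀ a b x, χ (a + b) x = χ a x * χ b x
  add_right : ∀ a x y, χ a (x + y) = χ a x * χ a y
  norm_eq : ∀ a x, ‖χ a x‖ = 1
  sum_left : ∀ x, x ≠ 0 → ∑ a, χ a x = 0
  sum_right : ∀ a, a ≠ 0 → ∑ x, χ a x = 0

/-- The Fourier coefficient of `f` at `a` with respect to a character table. -/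
def tableCoeff {Y : Type*} [Fintype Y] (χ : Y → Y → ℂ) (f : Y → ℂ) (a : Y) : ℂ :=
  expect fun x => f x * (starRingEnd ℂ) (χ a x)

namespace IsSelfDual

variable {Y : Type*} [Fintype Y] [AddCommGroup Y] {χ : Y → Y → ℂ}

theorem ne_zero (h : IsSelfDual χ) (a x : Y) : χ a x ≠ 0 := by
  intro h0
  have := h.norm_eq a x
  simp [h0] at this

theorem zero_left (h : IsSelfDual χ) (x : Y) : χ 0 x = 1 := by
  have h1 := h.add_left 0 0 x
  rw [add_zero] at h1
  exact (mul_eq_left₀ (h.ne_zero 0 x)).1 h1.symm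

theorem zero_right (h : IsSelfDual χ) (a : Y) : χ a 0 = 1 := by
  have h1 := h.add_right a 0 0
  rw [add_zero] at h1
  exact (mul_eq_left₀ (h.ne_zero a 0)).1 h1.symm

theorem mul_conj (h : IsSelfDual χ) (a x : Y) : χ a x * (starRingEnd ℂ) (χ a x) = 1 := by
  rw [Complex.mul_conj, Complex.normSq_eq_norm_sq, h.norm_eq]; simp

theorem conj_eq_neg_left (h : IsSelfDual χ) (a x : Y) :
    (starRingEnd ℂ) (χ a x) = χ (-a) x := by
  have h1 : χ a x * χ (-a) x = 1 := by rw [← h.add_left, add_neg_cancel, h.zero_left]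
  exact mul_left_cancel₀ (h.ne_zero a x) ((h.mul_conj a x).trans h1.symm)

theorem conj_eq_neg_right (h : IsSelfDual χ) (a x : Y) :
    (starRingEnd ℂ) (χ a x) = χ a (-x) := by
  have h1 : χ a x * χ a (-x) = 1 := by rw [← h.add_right, add_neg_cancel, h.zero_right]
  exact mul_left_cancel₀ (h.ne_zero a x) ((h.mul_conj a x).trans h1.symm)

theorem sum_mul_conj_left [DecidableEq Y] (h : IsSelfDual χ) (x y : Y) :
    ∑ a, χ a x * (starRingEnd ℂ) (χ a y) = if x = y then (Fintype.card Y : ℂ) else 0 := by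
  simp_rw [h.conj_eq_neg_right, ← h.add_right]
  split_ifs with hxy
  · simp [hxy, h.zero_right]
  · exact h.sum_left _ (by rwa [← sub_eq_add_neg, sub_ne_zero])

theorem sum_mul_conj_right [DecidableEq Y] (h : IsSelfDual χ) (a b : Y) :
    ∑ x, χ a x * (starRingEnd ℂ) (χ b x) = if a = b then (Fintype.card Y : ℂ) else 0 := by
  simp_rw [h.conj_eq_neg_left, ← h.add_left]
  split_ifs with hxy
  · simp [hxy, h.zero_left]
  · exact h.sum_right _ (by rwa [← sub_eq_add_neg, sub_ne_zero])

theorem card_ne_zero : (Fintype.card Y : ℂ) ≠ 0 := by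
  exact_mod_cast Fintype.card_ne_zero

/-- Fourier inversion. -/
theorem inversion (h : IsSelfDual χ) (f : Y → ℂ) (x : Y) :
    ∑ a, tableCoeff χ f a * χ a x = f x := by
  classical
  have hc := card_ne_zero (Y := Y)
  simp only [tableCoeff, expect, div_mul_eq_mul_div, Finset.sum_mul]
  rw [← Finset.sum_div, Finset.sum_comm]
  have : ∀ y, ∑ a, f y * (starRingEnd ℂ) (χ a y) * χ a x
      = f y * if x = y then (Fintype.card Y : ℂ) else 0 := by
    intro y
    rw [← h.sum_mul_conj_left, Finset.mul_sum]
    exact Finset.sum_congr rfl fun a _ => by ring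
  simp only [this, mul_ite, mul_zero, Finset.sum_ite_eq, Finset.mem_univ, if_true]
  field_simp

theorem tableCoeff_sum (h : IsSelfDual χ) (p : Y → ℂ) (b : Y) :
    tableCoeff χ (fun x => ∑ a, p a * χ a x) b = p b := by
  classical
  have hc := card_ne_zero (Y := Y)
  simp only [tableCoeff, expect, Finset.sum_mul]
  rw [Finset.sum_comm]
  have : ∀ a, ∑ x, p a * χ a x * (starRingEnd ℂ) (χ b x)
      = p a * if a = b then (Fintype.card Y : ℂ) else 0 := by
    intro a
    rw [← h.sum_mul_conj_right, Finset.mul_sum]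
    exact Finset.sum_congr rfl fun a _ => by ring
  simp only [this, mul_ite, mul_zero, Finset.sum_ite_eq', Finset.mem_univ, if_true]
  field_simp

/-- Parseval's identity. -/
theorem parseval (h : IsSelfDual χ) (f : Y → ℂ) :
    ∑ a, ‖tableCoeff χ f a‖ ^ 2 = (∑ x, ‖f x‖ ^ 2) / Fintype.card Y := by
  have key : ∑ a, tableCoeff χ f a * (starRingEnd ℂ) (tableCoeff χ f a)
      = (∑ x, f x * (starRingEnd ℂ) (f x)) / Fintype.card Y := by
    have h1 : ∀ a, tableCoeff χ f a * (starRingEnd ℂ) (tableCoeff χ f a)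
        = (∑ x, tableCoeff χ f a * χ a x * (starRingEnd ℂ) (f x)) / Fintype.card Y := by
      intro a
      conv_lhs => rw [tableCoeff, expect, map_div₀, map_sum, map_natCast]
      rw [mul_div_assoc', Finset.mul_sum]
      congr 1
      refine Finset.sum_congr rfl fun x _ => ?_
      rw [map_mul, Complex.conj_conj, tableCoeff, expect]
      ring
    simp_rw [h1]
    rw [← Finset.sum_div, Finset.sum_comm]
    congr 1
    refine Finset.sum_congr rfl fun x _ => ?_
    rw [← Finset.sum_mul, h.inversion]
  simp only [Complex.mul_conj, Complex.normSq_eq_norm_sq] at key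
  exact_mod_cast key

theorem norm_tableCoeff_le (h : IsSelfDual χ) (f : Y → ℂ) (a : Y) :
    ‖tableCoeff χ f a‖ ≤ (∑ x, ‖f x‖) / Fintype.card Y := by
  rw [tableCoeff, expect, norm_div, Complex.norm_natCast]
  gcongr
  refine (norm_sum_le _ _).trans (Finset.sum_le_sum fun x _ => ?_)
  rw [norm_mul, RCLike.norm_conj, h.norm_eq, mul_one]

theorem tableCoeff_mul (h : IsSelfDual χ) (f : Y → ℂ) (a b : Y) :
    tableCoeff χ (fun x => f x * (starRingEnd ℂ) (χ a x)) b = tableCoeff χ f (a + b) := by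
  simp only [tableCoeff, h.add_left, map_mul, mul_assoc]

end IsSelfDual

theorem IsSelfDual.pi {ι Y : Type*} [Fintype ι] [DecidableEq ι] [Fintype Y] [DecidableEq Y]
    [AddCommGroup Y] {χ : Y → Y → ℂ} (h : IsSelfDual χ) :
    IsSelfDual (fun (a x : ι → Y) => ∏ i, χ (a i) (x i)) where
  add_left a b x := by simp [h.add_left, Finset.prod_mul_distrib]
  add_right a b x := by simp [h.add_right, Finset.prod_mul_distrib]
  norm_eq a x := by simp [norm_prod, h.norm_eq]
  sum_left x hx := by
    obtain ⟨i, hi⟩ := Function.ne_iff.1 hx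
    have := Finset.prod_univ_sum (fun _ : ι => (Finset.univ : Finset Y)) (fun i a => χ a (x i))
    rw [Fintype.piFinset_univ] at this
    rw [← this]
    exact Finset.prod_eq_zero (Finset.mem_univ i) (h.sum_left _ hi)
  sum_right a ha := by
    obtain ⟨i, hi⟩ := Function.ne_iff.1 ha
    have := Finset.prod_univ_sum (fun _ : ι => (Finset.univ : Finset Y)) (fun i x => χ (a i) x)
    rw [Fintype.piFinset_univ] at this
    rw [← this]
    exact Finset.prod_eq_zero (Finset.mem_univ i) (h.sum_right _ hi)

theorem isSelfDual_stdAddChar (N : ℕ) [NeZero N] :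
    IsSelfDual (fun a x : ZMod N => (ZMod.stdAddChar (a * x) : ℂ)) := by
  have key : ∀ a : ZMod N, a ≠ 0 → ∑ x : ZMod N, (ZMod.stdAddChar (a * x) : ℂ) = 0 := by
    intro a ha
    have := AddChar.sum_mulShift (R := ZMod N) (R' := ℂ) a (ZMod.isPrimitive_stdAddChar N)
    rw [if_neg ha] at this
    simpa [mul_comm] using this
  refine ⟨fun a b x => ?_, fun a x y => ?_, fun a x => ?_, fun x hx => ?_, key⟩
  · rw [add_mul, AddChar.map_add_eq_mul]
  · rw [mul_add, AddChar.map_add_eq_mul]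
  · simp
  · simpa [mul_comm] using key x hx

theorem character_eq_prod {N : ℕ} [NeZero N] {Λ : Type*} [Fintype Λ] (b x : Λ → ZMod N) :
    character b x = ∏ v, ZMod.stdAddChar (b v * x v) := by
  have h := map_prod (ZMod.stdAddChar (N := N)).toMonoidHom
    (fun v => Multiplicative.ofAdd (b v * x v)) Finset.univ
  rw [← ofAdd_sum] at h
  exact h

section Character

variable {N : ℕ} [NeZero N] {Λ : Type*} [Fintype Λ] [DecidableEq Λ]

theorem isSelfDual_character :
    IsSelfDual (character : (Λ → ZMod N) → (Λ → ZMod N) → ℂ) := by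
  have := (isSelfDual_stdAddChar N).pi (ι := Λ)
  convert this using 3
  exact character_eq_prod _ _

theorem charCoeff_eq_tableCoeff (f : (Λ → ZMod N) → ℂ) (b : Λ → ZMod N) :
    charCoeff f b = tableCoeff character f b := rfl

theorem charCoeff_levelPart (f : (Λ → ZMod N) → ℂ) (d : ℕ) (b : Λ → ZMod N) :
    charCoeff (levelPart f d) b = if hammingNorm b = d then charCoeff f b else 0 := by
  have := (isSelfDual_character (N := N) (Λ := Λ)).tableCoeff_sum
    (fun a => if hammingNorm a = d then charCoeff f a else 0) b
  rw [← this, charCoeff_eq_tableCoeff]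
  congr 1
  funext x
  rw [levelPart, Finset.sum_filter]
  exact Finset.sum_congr rfl fun a _ => by split_ifs <;> simp

theorem wienerNorm_levelPart (f : (Λ → ZMod N) → ℂ) (d : ℕ) :
    wienerNorm (levelPart f d) = ∑ b : Λ → ZMod N with hammingNorm b = d, ‖charCoeff f b‖ := by
  rw [wienerNorm, Finset.sum_filter]
  exact Finset.sum_congr rfl fun b _ => by rw [charCoeff_levelPart]; split_ifs <;> simp

end Character

end FourierTables

end LabeledMatching

/-! ### Hypercontractivity on product spaces -/

namespace LabeledMatching

noncomputable section Hypercontractivity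

/-- The tangent line inequality for `x ↦ x ^ p` on the nonnegative half-line. -/
theorem tangent_le_pow {t x : ℝ} (ht : 0 ≤ t) (hx : 0 ≤ x) (p : ℕ) :
    t ^ p + p * t ^ (p - 1) * (x - t) ≤ x ^ p := by
  rcases p with _ | p
  · simp
  induction p with
  | zero => simp
  | succ p ih =>
    have h1 := mul_le_mul_of_nonneg_left ih hx
    have h2 : 0 ≤ (p + 1) * t ^ p * (x - t) ^ 2 := by positivity
    simp only [Nat.add_sub_cancel] at h1 ⊢
    push_cast at h1 ⊢
    have e1 : x ^ (p + 1 + 1) = x * x ^ (p + 1) := by ring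
    rw [e1]
    refine le_trans (le_of_eq ?_) (add_le_add h1 (neg_nonpos.2 h2) |>.trans (by simp))
    ring

/-- Averaged over the sign of `B`, the first-order term of `(A + B) ^ p` cancels, and the growth is
governed by `h`, which is of order `B ^ 2 / A`. -/
theorem add_pow_add_sub_pow_le {A B h : ℝ} (hA : 0 ≤ A) (hh : 0 ≤ h) (hB : B ^ 2 ≤ 4 * A * h)
    (p : ℕ) : (A + B) ^ p + (A - B) ^ p ≤ 2 * (A + 4 * p * h) ^ p := by
  have key : ∀ p : ℕ, 0 ≤ (A + B) ^ p + (A - B) ^ p ∧ 0 ≤ B * ((A + B) ^ p - (A - B) ^ p) ∧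
      B * ((A + B) ^ p - (A - B) ^ p) ≤ 4 * p * h * ((A + B) ^ p + (A - B) ^ p) := by
    intro p
    induction p with
    | zero => norm_num
    | succ p ih =>
      obtain ⟨h1, h2, h3⟩ := ih
      set S := (A + B) ^ p + (A - B) ^ p with hS
      set D := (A + B) ^ p - (A - B) ^ p with hD
      have eS : (A + B) ^ (p + 1) + (A - B) ^ (p + 1) = A * S + B * D := by rw [hS, hD]; ring
      have eD : (A + B) ^ (p + 1) - (A - B) ^ (p + 1) = A * D + B * S := by rw [hS, hD]; ring
      rw [eS, eD]
      have h4 : 0 ≤ B ^ 2 * S := by positivity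
      have h5 : 0 ≤ A * (B * D) := mul_nonneg hA h2
      refine ⟨by positivity, by nlinarith, ?_⟩
      push_cast
      have h6 := mul_le_mul_of_nonneg_right hB h1
      have h7 := mul_le_mul_of_nonneg_left h3 hA
      have h8 : 0 ≤ 4 * ((p : ℝ) + 1) * h * (B * D) := by positivity
      nlinarith
  induction p with
  | zero => norm_num
  | succ p ih =>
    obtain ⟨h1, h2, h3⟩ := key p
    have e1 : (A + B) ^ (p + 1) + (A - B) ^ (p + 1)
        = A * ((A + B) ^ p + (A - B) ^ p) + B * ((A + B) ^ p - (A - B) ^ p) := by ring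
    rw [e1]
    calc _ ≤ (A + 4 * p * h) * ((A + B) ^ p + (A - B) ^ p) := by nlinarith
      _ ≤ (A + 4 * p * h) * (2 * (A + 4 * p * h) ^ p) := by gcongr
      _ = 2 * (A + 4 * p * h) ^ (p + 1) := by ring
      _ ≤ 2 * (A + 4 * (p + 1 : ℕ) * h) ^ (p + 1) := by
        gcongr
        linarith

theorem norm_add_pow_add_norm_sub_pow_le (a u : ℂ) {p : ℕ} (hp : 1 ≤ p) :
    ‖a + u‖ ^ (2 * p) + ‖a - u‖ ^ (2 * p) ≤ 2 * (‖a‖ ^ 2 + 5 * p * ‖u‖ ^ 2) ^ p := by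
  have hp' : (1 : ℝ) ≤ p := by exact_mod_cast hp
  have e1 : ‖a + u‖ ^ 2 = (‖a‖ ^ 2 + ‖u‖ ^ 2) + 2 * (inner ℝ a u) := by
    rw [norm_add_sq_real]; ring
  have e2 : ‖a - u‖ ^ 2 = (‖a‖ ^ 2 + ‖u‖ ^ 2) - 2 * (inner ℝ a u) := by
    rw [norm_sub_sq_real]; ring
  have hin : (inner ℝ a u) ^ 2 ≤ (‖a‖ * ‖u‖) ^ 2 := sq_le_sq' (by
    have := abs_real_inner_le_norm a u
    linarith [neg_abs_le (inner ℝ a u)]) (real_inner_le_norm a u)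
  have := add_pow_add_sub_pow_le (A := ‖a‖ ^ 2 + ‖u‖ ^ 2) (B := 2 * inner ℝ a u) (h := ‖u‖ ^ 2)
    (by positivity) (by positivity) (by nlinarith [sq_nonneg (‖u‖ ^ 2)]) p
  rw [pow_mul, pow_mul, e1, e2]
  refine this.trans ?_
  gcongr 2 * ?_ ^ p
  nlinarith [sq_nonneg ‖u‖]

/-- A mean-zero perturbation `u` of a constant `a` raises the `2p`-th moment of the constant by a
controlled amount. Symmetrization: the linear term is removed by the tangent at `-u`. -/
theorem sum_norm_add_pow_le {X : Type*} [Fintype X] (a : ℂ) (u : X → ℂ) (hu : ∑ x, u x = 0)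
    {R : ℝ} (hR : ∀ x, ‖u x‖ ^ 2 ≤ R) {p : ℕ} (hp : 1 ≤ p) :
    ∑ x, ‖a + u x‖ ^ (2 * p) ≤ Fintype.card X * (‖a‖ ^ 2 + 10 * p * R) ^ p := by
  set T : ℝ := p * (‖a‖ ^ 2) ^ (p - 1) with hT
  have hT0 : 0 ≤ T := by positivity
  have pt : ∀ x, ‖a + u x‖ ^ (2 * p) - T * (2 * inner ℝ a (u x))
      ≤ (‖a‖ ^ 2 + 10 * p * R) ^ p := by
    intro x
    have h1 := norm_add_pow_add_norm_sub_pow_le a (u x) hp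
    have h2 := tangent_le_pow (t := ‖a‖ ^ 2) (x := ‖a - u x‖ ^ 2) (by positivity)
      (by positivity) p
    rw [← hT, ← pow_mul, ← pow_mul] at h2
    have h3 : -(2 * inner ℝ a (u x)) ≤ ‖a - u x‖ ^ 2 - ‖a‖ ^ 2 := by
      rw [norm_sub_sq_real]; nlinarith [sq_nonneg ‖u x‖]
    have h4 := mul_le_mul_of_nonneg_left h3 hT0
    set y := 5 * p * ‖u x‖ ^ 2 with hy
    have hy0 : 0 ≤ y := by positivity
    have ht0 : 0 ≤ ‖a‖ ^ 2 := by positivity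
    have h5 := tangent_le_pow (t := ‖a‖ ^ 2 + y) (x := ‖a‖ ^ 2) (by positivity) ht0 p
    rw [← pow_mul ‖a‖ 2 p] at h5
    have h6 := tangent_le_pow (t := ‖a‖ ^ 2 + y) (x := ‖a‖ ^ 2 + 2 * y) (by positivity)
      (by positivity) p
    have h7 : (‖a‖ ^ 2 + 2 * y) ^ p ≤ (‖a‖ ^ 2 + 10 * p * R) ^ p := by
      refine pow_le_pow_left₀ (by positivity) ?_ p
      have : 5 * p * ‖u x‖ ^ 2 ≤ 5 * p * R := by gcongr; exact hR x
      rw [hy]; linarith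
    have h8 : p * (‖a‖ ^ 2 + y) ^ (p - 1) * (‖a‖ ^ 2 - (‖a‖ ^ 2 + y))
        + p * (‖a‖ ^ 2 + y) ^ (p - 1) * (‖a‖ ^ 2 + 2 * y - (‖a‖ ^ 2 + y)) = 0 := by ring
    linarith
  have hlin : ∑ x, T * (2 * inner ℝ a (u x)) = 0 := by
    rw [← Finset.mul_sum, ← Finset.mul_sum, ← inner_sum, hu]
    simp
  have := Finset.sum_le_sum fun x (_ : x ∈ Finset.univ) => pt x
  rw [Finset.sum_sub_distrib, hlin] at this
  simpa using this

/-- Minkowski's inequality in `L^p`, for a natural exponent and without roots. -/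
theorem sum_pow_sum_le {X I : Type*} [Fintype X] [Fintype I] {a : I → X → ℝ} {A : I → ℝ} {K : ℝ}
    (hK : 0 ≤ K) (ha : ∀ i x, 0 ≤ a i x) (hA : ∀ i, 0 ≤ A i) {p : ℕ} (hp : 1 ≤ p)
    (h : ∀ i, ∑ x, a i x ^ p ≤ K * A i ^ p) :
    ∑ x, (∑ i, a i x) ^ p ≤ K * (∑ i, A i) ^ p := by
  have hz : ∀ i, A i = 0 → ∀ x, a i x = 0 := by
    intro i hi x
    have h1 := h i
    rw [hi, zero_pow (by omega), mul_zero] at h1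
    have h2 :=
      (Finset.single_le_sum (fun y _ => pow_nonneg (ha i y) p) (Finset.mem_univ x)).trans h1
    exact pow_eq_zero_iff (by omega) |>.1 (le_antisymm h2 (pow_nonneg (ha i x) p))
  rcases (Finset.sum_nonneg fun i (_ : i ∈ Finset.univ) => hA i).eq_or_lt with h0 | hpos
  · have hA0 : ∀ i, A i = 0 := fun i =>
      (Finset.sum_eq_zero_iff_of_nonneg fun i _ => hA i).1 h0.symm i (Finset.mem_univ i)
    simp [hz _ (hA0 _), hA0, zero_pow (show p ≠ 0 by omega)]
  set S := ∑ i, A i with hS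
  have pt : ∀ x, (∑ i, a i x) ^ p ≤ S ^ p * ∑ i, A i / S * (a i x / A i) ^ p := by
    intro x
    have h1 := Real.pow_arith_mean_le_arith_mean_pow Finset.univ (fun i => A i / S)
      (fun i => a i x / A i) (fun i _ => div_nonneg (hA i) hpos.le)
      (by rw [← Finset.sum_div, div_self hpos.ne']) (fun i _ => div_nonneg (ha i x) (hA i)) p
    have h2 : ∑ i, a i x = S * ∑ i, A i / S * (a i x / A i) := by
      rw [Finset.mul_sum]
      refine Finset.sum_congr rfl fun i _ => ?_
      by_cases hi : A i = 0
      · simp [hi, hz i hi x]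
      · field_simp
    rw [h2, mul_pow]
    gcongr
  calc ∑ x, (∑ i, a i x) ^ p ≤ ∑ x, S ^ p * ∑ i, A i / S * (a i x / A i) ^ p :=
        Finset.sum_le_sum fun x _ => pt x
    _ = S ^ p * ∑ i, A i / S * ((∑ x, a i x ^ p) / A i ^ p) := by
        rw [← Finset.mul_sum, Finset.sum_comm]
        simp_rw [← Finset.mul_sum, div_pow, ← Finset.sum_div]
    _ ≤ S ^ p * ∑ i, A i / S * K := by
        gcongr with i _
        · exact div_nonneg (hA i) hpos.le
        · exact div_le_of_le_mul₀ (pow_nonneg (hA i) p) hK (h i)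
    _ = K * S ^ p := by
        rw [← Finset.sum_mul, ← Finset.sum_div, div_self hpos.ne']; ring

section Product

variable {X Y : Type*} [Fintype X] [Fintype Y] [DecidableEq Y] [Zero Y]

/-- Hypercontractivity for a single coordinate. -/
theorem sum_norm_expansion_pow_le {χ : Y → X → ℂ} (h0 : ∀ x, χ 0 x = 1)
    (hn : ∀ c x, ‖χ c x‖ ≤ 1) (hs : ∀ c, c ≠ 0 → ∑ x, χ c x = 0) {p : ℕ} (hp : 1 ≤ p)
    (W : Y → ℂ) :
    ∑ x, ‖∑ c, W c * χ c x‖ ^ (2 * p) ≤ Fintype.card X *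
      (∑ c, (if c = 0 then 1 else 10 * p * (Fintype.card Y : ℝ)) * ‖W c‖ ^ 2) ^ p := by
  set s : Finset Y := Finset.univ.erase 0 with hsdef
  have hsplit : ∀ x, ∑ c, W c * χ c x = W 0 + ∑ c ∈ s, W c * χ c x := by
    intro x
    rw [← Finset.add_sum_erase _ _ (Finset.mem_univ (0 : Y)), h0, mul_one]
  have hne : ∀ c ∈ s, c ≠ 0 := fun c hc => (Finset.mem_erase.1 hc).1
  have hmean : ∑ x, ∑ c ∈ s, W c * χ c x = 0 := by
    rw [Finset.sum_comm]
    refine Finset.sum_eq_zero fun c hc => ?_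
    rw [← Finset.mul_sum, hs c (hne c hc), mul_zero]
  have hbd : ∀ x, ‖∑ c ∈ s, W c * χ c x‖ ^ 2 ≤ Fintype.card Y * ∑ c ∈ s, ‖W c‖ ^ 2 := by
    intro x
    calc ‖∑ c ∈ s, W c * χ c x‖ ^ 2 ≤ (∑ c ∈ s, ‖W c‖) ^ 2 := by
          gcongr
          refine (norm_sum_le _ _).trans (Finset.sum_le_sum fun c _ => ?_)
          rw [norm_mul]
          exact mul_le_of_le_one_right (norm_nonneg _) (hn c x)
      _ ≤ s.card * ∑ c ∈ s, ‖W c‖ ^ 2 := sq_sum_le_card_mul_sum_sq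
      _ ≤ _ := by
          gcongr
          exact Finset.card_le_univ s
  have := sum_norm_add_pow_le (W 0) _ hmean hbd hp
  simp_rw [hsplit]
  refine this.trans (le_of_eq ?_)
  congr 2
  rw [← Finset.add_sum_erase _ _ (Finset.mem_univ (0 : Y)), if_pos rfl, one_mul]
  congr 1
  rw [← mul_assoc, Finset.mul_sum]
  refine Finset.sum_congr rfl fun c hc => ?_
  rw [if_neg (hne c hc)]

/-- Hypercontractivity by tensorization: the first coordinate is treated by the one-coordinate
case, and the others by induction and Minkowski's inequality. -/
theorem hypercontractive_fin {χ : Y → X → ℂ} (h0 : ∀ x, χ 0 x = 1)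
    (hn : ∀ c x, ‖χ c x‖ ≤ 1) (hs : ∀ c, c ≠ 0 → ∑ x, χ c x = 0) {p : ℕ} (hp : 1 ≤ p) (m : ℕ)
    (P : (Fin m → Y) → ℂ) :
    ∑ x : Fin m → X, ‖∑ c, P c * ∏ i, χ (c i) (x i)‖ ^ (2 * p) ≤ (Fintype.card X : ℝ) ^ m *
      (∑ c, (∏ i, if c i = 0 then 1 else 10 * p * (Fintype.card Y : ℝ)) * ‖P c‖ ^ 2) ^ p := by
  induction m with
  | zero => simp [← pow_mul]
  | succ m ih =>
    set κ : ℝ := 10 * p * (Fintype.card Y : ℝ) with hκ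
    have hκ0 : 0 ≤ κ := by positivity
    have hw0 : ∀ y : Y, 0 ≤ (if y = 0 then 1 else κ) := fun y => by split_ifs <;> simp [hκ0]
    have sumX : ∀ F : (Fin (m + 1) → X) → ℝ,
        ∑ x, F x = ∑ x' : Fin m → X, ∑ x0, F (Fin.cons x0 x') := by
      intro F
      rw [← (Fin.consEquiv fun _ => X).sum_comp, Fintype.sum_prod_type, Finset.sum_comm]
      rfl
    have sumY : ∀ {E : Type} [AddCommMonoid E] (F : (Fin (m + 1) → Y) → E),
        ∑ c, F c = ∑ c0, ∑ c' : Fin m → Y, F (Fin.cons c0 c') := by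
      intro E _ F
      rw [← (Fin.consEquiv fun _ => Y).sum_comp, Fintype.sum_prod_type]
      rfl
    rw [sumX, sumY]
    simp_rw [sumY, Fin.prod_univ_succ, Fin.cons_zero, Fin.cons_succ]
    set Q : Y → (Fin m → X) → ℂ := fun c0 x' =>
      ∑ c' : Fin m → Y, P (Fin.cons c0 c') * ∏ i, χ (c' i) (x' i) with hQ
    have h1 : ∀ (x' : Fin m → X) (x0 : X),
        ∑ c0, ∑ c' : Fin m → Y, P (Fin.cons c0 c') * (χ c0 x0 * ∏ i, χ (c' i) (x' i))
          = ∑ c0, Q c0 x' * χ c0 x0 := by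
      intro x' x0
      refine Finset.sum_congr rfl fun c0 _ => ?_
      rw [hQ, Finset.sum_mul]
      exact Finset.sum_congr rfl fun c' _ => by ring
    simp_rw [h1]
    calc ∑ x' : Fin m → X, ∑ x0, ‖∑ c0, Q c0 x' * χ c0 x0‖ ^ (2 * p)
        ≤ ∑ x' : Fin m → X, Fintype.card X *
            (∑ c0, (if c0 = 0 then 1 else κ) * ‖Q c0 x'‖ ^ 2) ^ p :=
          Finset.sum_le_sum fun x' _ => sum_norm_expansion_pow_le h0 hn hs hp _
      _ ≤ Fintype.card X * ((Fintype.card X : ℝ) ^ m * (∑ c0, (if c0 = 0 then 1 else κ) *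
            ∑ c' : Fin m → Y, (∏ i, if c' i = 0 then 1 else κ)
              * ‖P (Fin.cons c0 c')‖ ^ 2) ^ p) := by
          rw [← Finset.mul_sum]
          refine mul_le_mul_of_nonneg_left ?_ (by positivity)
          refine sum_pow_sum_le (by positivity) (fun c0 x' => mul_nonneg (hw0 _) (by positivity))
            (fun c0 => mul_nonneg (hw0 _) (Finset.sum_nonneg fun c' _ =>
              mul_nonneg (Finset.prod_nonneg fun i _ => hw0 _) (by positivity))) hp ?_
          intro c0
          have := ih fun c' => P (Fin.cons c0 c')
          simp_rw [mul_pow, ← Finset.mul_sum, ← pow_mul]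
          calc _ ≤ (if c0 = 0 then 1 else κ) ^ p * ((Fintype.card X : ℝ) ^ m * _) :=
                mul_le_mul_of_nonneg_left this (pow_nonneg (hw0 _) _)
            _ = _ := by ring
      _ = _ := by
          rw [← mul_assoc, ← pow_succ']
          simp_rw [Finset.mul_sum, mul_assoc]

/-- Hypercontractivity over a finite product space, for an expansion in products of functions
bounded by one, of which all but the constant one have mean zero. -/
theorem hypercontractive {ι : Type*} [Fintype ι] [DecidableEq ι] {χ : Y → X → ℂ}
    (h0 : ∀ x, χ 0 x = 1) (hn : ∀ c x, ‖χ c x‖ ≤ 1) (hs : ∀ c, c ≠ 0 → ∑ x, χ c x = 0) {p : ℕ}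
    (hp : 1 ≤ p) (P : (ι → Y) → ℂ) :
    ∑ x : ι → X, ‖∑ c, P c * ∏ i, χ (c i) (x i)‖ ^ (2 * p)
      ≤ (Fintype.card X : ℝ) ^ Fintype.card ι *
        (∑ c, (10 * p * (Fintype.card Y : ℝ)) ^ hammingNorm c * ‖P c‖ ^ 2) ^ p := by
  have e := Fintype.equivFin ι
  have main := hypercontractive_fin h0 hn hs hp (Fintype.card ι)
    (fun c => P (fun i => c (e i)))
  have sumX : ∀ F : (ι → X) → ℝ, ∑ x, F x = ∑ x : Fin (Fintype.card ι) → X, F fun i => x (e i) := by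
    intro F
    rw [← (e.symm.arrowCongr (Equiv.refl X)).sum_comp]
    rfl
  have sumY : ∀ {E : Type} [AddCommMonoid E] (F : (ι → Y) → E),
      ∑ c, F c = ∑ c : Fin (Fintype.card ι) → Y, F fun i => c (e i) := by
    intro E _ F
    rw [← (e.symm.arrowCongr (Equiv.refl Y)).sum_comp]
    rfl
  rw [sumX, sumY]
  simp_rw [sumY]
  convert main using 5 with x _ c _ c
  · congr 1
    exact e.prod_comp fun i => χ (c i) (x i)
  · rw [hammingNorm, ← Finset.prod_const, Finset.prod_filter, ← e.prod_comp]
    exact Finset.prod_congr rfl fun i _ => by by_cases h : c (e i) = 0 <;> simp [h]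

end Product

end Hypercontractivity

end LabeledMatching

/-! ### The level inequality -/

namespace LabeledMatching

noncomputable section LevelInequality

theorem sum_pow_hammingNorm_le {ι Y : Type*} [Fintype ι] [DecidableEq ι] [Fintype Y]
    [DecidableEq Y] [Zero Y] {y : ℝ} (hy : 0 ≤ y) :
    ∑ γ : ι → Y, y ^ hammingNorm γ ≤ Real.exp (Fintype.card ι * Fintype.card Y * y) := by
  have h1 : ∀ γ : ι → Y, y ^ hammingNorm γ = ∏ i, if γ i = 0 then 1 else y := by
    intro γ
    rw [hammingNorm, ← Finset.prod_const, Finset.prod_filter]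
    exact Finset.prod_congr rfl fun i _ => by by_cases h : γ i = 0 <;> simp [h]
  have h2 : ∑ c : Y, (if c = 0 then 1 else y) ≤ Real.exp (Fintype.card Y * y) := by
    calc ∑ c : Y, (if c = 0 then 1 else y) ≤ ∑ c : Y, ((if c = 0 then 1 else 0) + y) := by
          refine Finset.sum_le_sum fun c _ => ?_
          split_ifs <;> linarith
      _ = Fintype.card Y * y + 1 := by
          rw [Finset.sum_add_distrib]; simp [add_comm]
      _ ≤ _ := Real.add_one_le_exp _
  simp_rw [h1]
  rw [← Fintype.prod_sum fun (_ : ι) (c : Y) => if c = 0 then (1 : ℝ) else y, Finset.prod_const,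
    Finset.card_univ, mul_assoc, Real.exp_nat_mul]
  refine pow_le_pow_left₀ (Finset.sum_nonneg fun c _ => ?_) h2 _
  split_ifs <;> simp [hy]

variable {ι Y : Type*} [Fintype ι] [DecidableEq ι] [Fintype Y] [DecidableEq Y] [AddCommGroup Y]
  {χ : Y → Y → ℂ}

/-- The dual form of hypercontractivity: the Fourier weight of a function of mean absolute value
one, damped by `κ⁻¹` for each nonzero block, is at most a root of its maximum. -/
theorem damped_weight_pow_le (h : IsSelfDual χ) (g : (ι → Y) → ℂ) {T : ℝ}
    (hmean : ∑ x, ‖g x‖ = Fintype.card (ι → Y)) (hmax : ∀ x, ‖g x‖ ≤ T) {p : ℕ} (hp : 1 ≤ p) :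
    (∑ γ, (10 * p * (Fintype.card Y : ℝ))⁻¹ ^ hammingNorm γ *
      ‖tableCoeff (fun a x : ι → Y => ∏ i, χ (a i) (x i)) g γ‖ ^ 2) ^ p ≤ T := by
  set κ : ℝ := 10 * p * (Fintype.card Y : ℝ) with hκ
  set ĝ : (ι → Y) → ℂ := tableCoeff (fun a x : ι → Y => ∏ i, χ (a i) (x i)) g with hg
  set Q := ∑ γ, κ⁻¹ ^ hammingNorm γ * ‖ĝ γ‖ ^ 2 with hQ
  have hκ0 : 0 < κ := by
    have : 0 < Fintype.card Y := Fintype.card_pos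
    positivity
  have hT : 0 ≤ T := (norm_nonneg _).trans (hmax 0)
  have hQ0 : 0 ≤ Q := Finset.sum_nonneg fun γ _ => by positivity
  have hcard : (0 : ℝ) < Fintype.card (ι → Y) := by exact_mod_cast Fintype.card_pos
  set P : (ι → Y) → ℂ := fun x => ∑ γ, ((κ⁻¹ ^ hammingNorm γ : ℝ) * ĝ γ) * ∏ i, χ (γ i) (x i)
    with hP
  have hpair : (Q : ℂ) = (∑ x, g x * (starRingEnd ℂ) (P x)) / Fintype.card (ι → Y) := by
    have e1 : ∀ γ, ((κ⁻¹ ^ hammingNorm γ * ‖ĝ γ‖ ^ 2 : ℝ) : ℂ)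
        = (∑ x : ι → Y, g x *
            (starRingEnd ℂ) ((((κ⁻¹ ^ hammingNorm γ : ℝ) : ℂ) * ĝ γ) * ∏ i : ι, χ (γ i) (x i)))
          / Fintype.card (ι → Y) := by
      intro γ
      have e2 : ((‖ĝ γ‖ ^ 2 : ℝ) : ℂ) = ĝ γ * (starRingEnd ℂ) (ĝ γ) := by
        rw [Complex.mul_conj, Complex.normSq_eq_norm_sq]
      have hc : (Fintype.card (ι → Y) : ℂ) ≠ 0 := by exact_mod_cast hcard.ne'
      have e3 : ∑ x : ι → Y, g x * (starRingEnd ℂ) (∏ i, χ (γ i) (x i))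
          = ĝ γ * Fintype.card (ι → Y) := (div_eq_iff hc).1 rfl
      have e4 : ∑ x : ι → Y, g x *
            (starRingEnd ℂ) ((((κ⁻¹ ^ hammingNorm γ : ℝ) : ℂ) * ĝ γ) * ∏ i : ι, χ (γ i) (x i))
          = ((κ⁻¹ ^ hammingNorm γ : ℝ) : ℂ) * (starRingEnd ℂ) (ĝ γ) *
            ∑ x : ι → Y, g x * (starRingEnd ℂ) (∏ i, χ (γ i) (x i)) := by
        rw [Finset.mul_sum]
        refine Finset.sum_congr rfl fun x _ => ?_
        rw [map_mul, map_mul, Complex.conj_ofReal]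
        ring
      rw [eq_div_iff hc, Complex.ofReal_mul, e2, e4, e3]
      ring
    rw [hQ, Complex.ofReal_sum]
    simp_rw [e1]
    rw [← Finset.sum_div, Finset.sum_comm]
    simp_rw [hP, map_sum, Finset.mul_sum]
  have hQle : Q ≤ ∑ x, ‖g x‖ / Fintype.card (ι → Y) * ‖P x‖ := by
    have := congrArg norm hpair
    rw [Complex.norm_real, Real.norm_of_nonneg hQ0, norm_div, Complex.norm_natCast] at this
    rw [this]
    simp_rw [div_mul_eq_mul_div]
    rw [← Finset.sum_div]
    gcongr
    refine (norm_sum_le _ _).trans (le_of_eq (Finset.sum_congr rfl fun x _ => ?_))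
    rw [norm_mul, RCLike.norm_conj]
  have hhc := hypercontractive (χ := χ) (ι := ι) h.zero_left (fun c x => (h.norm_eq c x).le)
    h.sum_right hp (fun γ => (κ⁻¹ ^ hammingNorm γ : ℝ) * ĝ γ)
  have hW : ∑ γ : ι → Y, κ ^ hammingNorm γ * ‖((κ⁻¹ ^ hammingNorm γ : ℝ) : ℂ) * ĝ γ‖ ^ 2 = Q := by
    refine Finset.sum_congr rfl fun γ _ => ?_
    have hk : κ ^ hammingNorm γ * κ⁻¹ ^ hammingNorm γ = 1 := by
      rw [← mul_pow, mul_inv_cancel₀ hκ0.ne', one_pow]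
    rw [norm_mul, Complex.norm_real, Real.norm_of_nonneg (by positivity)]
    linear_combination κ⁻¹ ^ hammingNorm γ * ‖ĝ γ‖ ^ 2 * hk
  rw [← hκ, hW] at hhc
  have main : Q ^ (2 * p) ≤ T * Q ^ p := by
    calc Q ^ (2 * p) ≤ (∑ x, ‖g x‖ / Fintype.card (ι → Y) * ‖P x‖) ^ (2 * p) :=
          pow_le_pow_left₀ hQ0 hQle _
      _ ≤ ∑ x, ‖g x‖ / Fintype.card (ι → Y) * ‖P x‖ ^ (2 * p) :=
          Real.pow_arith_mean_le_arith_mean_pow _ _ _ (fun x _ => by positivity)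
            (by rw [← Finset.sum_div, hmean, div_self hcard.ne']) (fun x _ => norm_nonneg _) _
      _ ≤ ∑ x, T / Fintype.card (ι → Y) * ‖P x‖ ^ (2 * p) := by
          gcongr with x _
          exact hmax x
      _ = T / Fintype.card (ι → Y) * ∑ x, ‖P x‖ ^ (2 * p) := by rw [Finset.mul_sum]
      _ ≤ T / Fintype.card (ι → Y) * ((Fintype.card Y : ℝ) ^ Fintype.card ι * Q ^ p) := by
          gcongr
      _ = T * Q ^ p := by
          have : (Fintype.card (ι → Y) : ℝ) = (Fintype.card Y : ℝ) ^ Fintype.card ι := by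
            rw [Fintype.card_fun]; push_cast; rfl
          rw [this] at hcard ⊢
          field_simp
  rcases hQ0.eq_or_lt with h0 | hpos
  · rw [← h0, zero_pow (by omega)]; exact hT
  · rw [two_mul, pow_add] at main
    exact le_of_mul_le_mul_right main (pow_pos hpos p)

theorem growthBound_zero (C : ℝ) (n : ℕ) (s : ℝ) : growthBound C n 0 s = 1 := by
  simp [growthBound]

theorem growthBound_nonneg {C : ℝ} (hC : 0 ≤ C) (n d : ℕ) (s : ℝ) : 0 ≤ growthBound C n d s := by
  unfold growthBound; positivity

/-- The level inequality, in `ℓ¹` form: over labelings with at most `d / 2` nonzero blocks, the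
Fourier coefficients of a density bounded by `2 ^ s` have absolute sum at most
`F_{19 q}(n, d, s)`. -/
theorem sum_norm_tableCoeff_le (h : IsSelfDual χ) (g : (ι → Y) → ℂ) {s : ℝ} (hs : 0 < s)
    (hmean : ∑ x, ‖g x‖ = Fintype.card (ι → Y)) (hmax : ∀ x, ‖g x‖ ≤ (2 : ℝ) ^ s)
    {n d : ℕ} (hn : Fintype.card ι ≤ n) (hd : d ≤ n) :
    ∑ γ : ι → Y with 2 * hammingNorm γ ≤ d,
        ‖tableCoeff (fun a x : ι → Y => ∏ i, χ (a i) (x i)) g γ‖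
      ≤ growthBound (19 * Fintype.card Y) n d s := by
  set ĝ : (ι → Y) → ℂ := tableCoeff (fun a x : ι → Y => ∏ i, χ (a i) (x i)) g with hg
  have hcard : (0 : ℝ) < Fintype.card (ι → Y) := by exact_mod_cast Fintype.card_pos
  rcases Nat.eq_zero_or_pos d with rfl | hd0
  · rw [growthBound_zero]
    have : (Finset.univ.filter fun γ : ι → Y => 2 * hammingNorm γ ≤ 0) = {0} := by
      ext γ; simp
    rw [this, Finset.sum_singleton]
    refine (h.pi.norm_tableCoeff_le g 0).trans ?_
    rw [hmean, div_self hcard.ne']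
  have hdR : (0 : ℝ) < d := by exact_mod_cast hd0
  have hnR : (0 : ℝ) < n := by exact_mod_cast (hd0.trans_le hd)
  have hq : 1 ≤ (Fintype.card Y : ℝ) := by exact_mod_cast Fintype.card_pos
  set q : ℝ := (Fintype.card Y : ℝ) with hqdef
  set X : ℝ := max s d with hX
  -- the moment `2 * p` is of the order of the entropy deficit per level
  set p : ℕ := ⌈2 * s / d⌉₊ with hpdef
  have hp : 1 ≤ p := Nat.one_le_iff_ne_zero.2 (Nat.ceil_pos.2 (by positivity)).ne'
  have hpR : (1 : ℝ) ≤ p := by exact_mod_cast hp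
  have hple : (p : ℝ) ≤ 3 * X / d := by
    have h1 := (Nat.ceil_lt_add_one (show 0 ≤ 2 * s / d by positivity)).le
    refine h1.trans ?_
    rw [le_div_iff₀ hdR, add_mul, div_mul_cancel₀ _ hdR.ne']
    have := le_max_left s d
    have := le_max_right s (d : ℝ)
    linarith
  have hsp : s / p ≤ d / 2 := by
    have h1 := Nat.le_ceil (2 * s / d)
    rw [← hpdef, div_le_iff₀ hdR] at h1
    rw [div_le_div_iff₀ (by linarith) (by norm_num)]
    linarith
  set κ : ℝ := 10 * p * q with hκ
  have hκ1 : 1 ≤ κ := by nlinarith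
  have hκ0 : 0 < κ := by linarith
  -- `l` is the damping of the exponential-moment bound on the number of labelings, chosen so that
  -- the exponent `n * q * (κ * l)` equals `d / 2`
  set l : ℝ := d / (2 * q * κ * n) with hl
  have hl0 : 0 < l := by positivity
  have hl1 : l ≤ 1 := by
    rw [hl, div_le_one (by positivity)]
    have h1 : (d : ℝ) ≤ n := by exact_mod_cast hd
    have h2 : 1 ≤ 2 * q * κ := by nlinarith
    nlinarith
  have hQ := damped_weight_pow_le h g hmean hmax hp
  set Q := ∑ γ, κ⁻¹ ^ hammingNorm γ * ‖ĝ γ‖ ^ 2 with hQdef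
  have hQ0 : 0 ≤ Q := Finset.sum_nonneg fun γ _ => by positivity
  have hQle : Q ≤ (2 : ℝ) ^ ((d : ℝ) / 2) := by
    have h1 : Q ≤ ((2 : ℝ) ^ s) ^ ((p : ℝ)⁻¹) := by
      rw [← Real.rpow_natCast] at hQ
      calc Q = (Q ^ (p : ℝ)) ^ ((p : ℝ)⁻¹) := by
            rw [← Real.rpow_mul hQ0, mul_inv_cancel₀ (by linarith), Real.rpow_one]
        _ ≤ _ := Real.rpow_le_rpow (by positivity) hQ (by positivity)
    rw [← Real.rpow_mul (by norm_num), ← div_eq_mul_inv] at h1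
    exact h1.trans (Real.rpow_le_rpow_of_exponent_le (by norm_num) hsp)
  have hcount : ∑ γ : ι → Y with 2 * hammingNorm γ ≤ d, κ ^ hammingNorm γ
      ≤ (Real.exp 1 / l) ^ ((d : ℝ) / 2) := by
    have h1 : l ^ ((d : ℝ) / 2) * ∑ γ : ι → Y with 2 * hammingNorm γ ≤ d, κ ^ hammingNorm γ
        ≤ Real.exp (d / 2) := by
      rw [Finset.mul_sum]
      calc _ ≤ ∑ γ : ι → Y with 2 * hammingNorm γ ≤ d, (κ * l) ^ hammingNorm γ := by
            refine Finset.sum_le_sum fun γ hγ => ?_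
            have hγ' : (2 * hammingNorm γ : ℝ) ≤ d := by
              exact_mod_cast (Finset.mem_filter.1 hγ).2
            rw [mul_comm κ l, mul_pow l κ]
            refine mul_le_mul_of_nonneg_right ?_ (pow_nonneg hκ0.le _)
            rw [← Real.rpow_natCast]
            exact Real.rpow_le_rpow_of_exponent_ge hl0 hl1 (by linarith)
        _ ≤ ∑ γ : ι → Y, (κ * l) ^ hammingNorm γ :=
            Finset.sum_le_sum_of_subset_of_nonneg (Finset.filter_subset _ _)
              fun _ _ _ => by positivity
        _ ≤ Real.exp (Fintype.card ι * q * (κ * l)) :=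
            sum_pow_hammingNorm_le (mul_pos hκ0 hl0).le
        _ ≤ Real.exp (d / 2) := by
            rw [Real.exp_le_exp]
            have h2 : (Fintype.card ι : ℝ) ≤ n := by exact_mod_cast hn
            calc (Fintype.card ι : ℝ) * q * (κ * l) ≤ n * q * (κ * l) := by gcongr
              _ = d / 2 := by rw [hl]; field_simp
    rw [Real.div_rpow (Real.exp_pos 1).le hl0.le, le_div_iff₀ (by positivity),
      ← Real.exp_mul, one_mul, mul_comm]
    exact h1
  set Sm := ∑ γ : ι → Y with 2 * hammingNorm γ ≤ d, ‖ĝ γ‖ with hSm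
  have hCS : Sm ^ 2 ≤ (∑ γ : ι → Y with 2 * hammingNorm γ ≤ d, κ ^ hammingNorm γ) * Q := by
    have h1 := Finset.sum_mul_sq_le_sq_mul_sq
      (Finset.univ.filter fun γ : ι → Y => 2 * hammingNorm γ ≤ d)
      (fun γ => √(κ ^ hammingNorm γ)) (fun γ => √(κ⁻¹ ^ hammingNorm γ) * ‖ĝ γ‖)
    have e1 : ∀ γ : ι → Y, √(κ ^ hammingNorm γ) * (√(κ⁻¹ ^ hammingNorm γ) * ‖ĝ γ‖) = ‖ĝ γ‖ := by
      intro γ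
      rw [← mul_assoc, ← Real.sqrt_mul (by positivity), ← mul_pow, mul_inv_cancel₀ hκ0.ne']
      simp
    have e2 : ∀ γ : ι → Y, √(κ ^ hammingNorm γ) ^ 2 = κ ^ hammingNorm γ :=
      fun γ => Real.sq_sqrt (by positivity)
    have e3 : ∀ γ : ι → Y, (√(κ⁻¹ ^ hammingNorm γ) * ‖ĝ γ‖) ^ 2
        = κ⁻¹ ^ hammingNorm γ * ‖ĝ γ‖ ^ 2 := by
      intro γ
      rw [mul_pow, Real.sq_sqrt (by positivity)]
    simp_rw [e1, e2, e3] at h1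
    refine h1.trans ?_
    gcongr
    exact Finset.sum_le_sum_of_subset_of_nonneg (Finset.filter_subset _ _)
      fun _ _ _ => by positivity
  have hfin : Sm ^ 2 ≤ growthBound (19 * q) n d s ^ 2 := by
    calc Sm ^ 2 ≤ (Real.exp 1 / l) ^ ((d : ℝ) / 2) * (2 : ℝ) ^ ((d : ℝ) / 2) :=
          hCS.trans (mul_le_mul hcount hQle hQ0 (by positivity))
      _ = (Real.exp 1 / l * 2) ^ ((d : ℝ) / 2) :=
          (Real.mul_rpow (by positivity) (by norm_num)).symm
      _ ≤ ((19 * q * √(n * X) / d) ^ 2) ^ ((d : ℝ) / 2) := by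
          refine Real.rpow_le_rpow (by positivity) ?_ (by positivity)
          have hX0 : 0 < X := hs.trans_le (le_max_left _ _)
          rw [div_pow, mul_pow, Real.sq_sqrt (by positivity), hl, hκ]
          have he := Real.exp_one_lt_d9.le
          calc Real.exp 1 / (d / (2 * q * (10 * p * q) * n)) * 2
              = 40 * Real.exp 1 * q ^ 2 * n / d * p := by field_simp; ring
            _ ≤ 40 * Real.exp 1 * q ^ 2 * n / d * (3 * X / d) := by gcongr
            _ = (120 * Real.exp 1) * (q ^ 2 * (n * X) / d ^ 2) := by field_simp; ring
            _ ≤ 361 * (q ^ 2 * (n * X) / d ^ 2) := by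
                refine mul_le_mul_of_nonneg_right ?_ (by positivity)
                linarith
            _ = (19 * q) ^ 2 * (n * X) / d ^ 2 := by ring
      _ = growthBound (19 * q) n d s ^ 2 := by
          rw [growthBound, ← Real.rpow_natCast, ← Real.rpow_natCast,
            ← Real.rpow_mul (by positivity), ← Real.rpow_mul (by positivity),
            mul_comm _ ((d : ℝ) / 2)]
  exact (pow_le_pow_iff_left₀ (Finset.sum_nonneg fun _ _ => norm_nonneg _)
    (growthBound_nonneg (by positivity) _ _ _) two_ne_zero).1 hfin

end LevelInequality

end LabeledMatching

/-! ### Fourier expansion of the Markov operator -/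

namespace LabeledMatching

noncomputable section MarkovExpansion

variable {k N : ℕ} [NeZero N] {Λ : Type*} [Fintype Λ] [DecidableEq Λ] {M : Finset (Fin k → Λ)}

/-- The vector on `Λ` that carries the labels of `γ` at the vertices of the edges of `M` and
vanishes elsewhere (labels are added up at vertices shared by several edges, of which a matching
has none). -/
def extendLabeling (γ : Labeling N M) (v : Λ) : ZMod N :=
  ∑ e : ↥M, ∑ i, if e.1 i = v then γ e i else 0

/-- The Fourier coefficients of a function of the labeling. -/
def labelCoeff (g : Labeling N M → ℂ) (γ : Labeling N M) : ℂ :=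
  tableCoeff (fun a x : ↥M → Fin k → ZMod N => ∏ e, character (a e) (x e)) g γ

/-- A labeling none of whose blocks has exactly one nonzero entry. The operators of one-wise
independent distributions kill the characters of all other labelings. -/
def NoSingleton (γ : Labeling N M) : Prop :=
  ∀ e, hammingNorm (γ e) ≠ 1

/-- The Fourier transform of a distribution on `ZMod N ^ k`. -/
def pmfTransform (μ : PMF (Fin k → ZMod N)) (y : Fin k → ZMod N) : ℂ :=
  ∑ z, ((μ z).toReal : ℂ) * (starRingEnd ℂ) (character y z)

theorem sum_pmf_toReal {α : Type*} [Fintype α] (μ : PMF α) : ∑ z, (μ z).toReal = 1 := by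
  have h := μ.tsum_coe
  rw [tsum_fintype] at h
  rw [← ENNReal.toReal_sum fun z _ => μ.apply_ne_top z, h, ENNReal.toReal_one]

theorem norm_pmfTransform_le (μ : PMF (Fin k → ZMod N)) (y : Fin k → ZMod N) :
    ‖pmfTransform μ y‖ ≤ 1 := by
  rw [← sum_pmf_toReal μ]
  refine (norm_sum_le _ _).trans (Finset.sum_le_sum fun z _ => ?_)
  rw [norm_mul, RCLike.norm_conj, isSelfDual_character.norm_eq, mul_one, Complex.norm_real,
    Real.norm_of_nonneg ENNReal.toReal_nonneg]

theorem sum_filter_toReal_of_isOneWiseIndependent {μ : PMF (Fin k → ZMod N)}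
    (hμ : IsOneWiseIndependent μ) (i : Fin k) (t : ZMod N) :
    ∑ z : Fin k → ZMod N with z i = t, (μ z).toReal = (N : ℝ)⁻¹ := by
  have h1 := congrArg (fun ν : PMF (ZMod N) => (ν t).toReal) (hμ i)
  simp only [PMF.map_apply, PMF.uniformOfFintype_apply, ZMod.card, tsum_fintype] at h1
  rw [ENNReal.toReal_inv, ENNReal.toReal_natCast] at h1
  rw [← h1, ENNReal.toReal_sum, Finset.sum_filter]
  · refine Finset.sum_congr rfl fun z _ => ?_
    by_cases h : z i = t
    · simp [h]
    · simp [h, Ne.symm h]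
  · intro z _
    split_ifs
    · exact μ.apply_ne_top z
    · simp

/-- A character of weight one depends on a single coordinate, whose marginal is uniform. -/
theorem pmfTransform_eq_zero {μ : PMF (Fin k → ZMod N)} (hμ : IsOneWiseIndependent μ)
    {y : Fin k → ZMod N} (hy : hammingNorm y = 1) : pmfTransform μ y = 0 := by
  obtain ⟨i, hi⟩ := Finset.card_eq_one.1 hy
  have hi0 : y i ≠ 0 := by
    have : i ∈ (Finset.univ.filter fun j => y j ≠ 0) := by rw [hi]; simp
    simpa using this
  have hj0 : ∀ j, j ≠ i → y j = 0 := by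
    intro j hj
    by_contra h
    have : j ∈ (Finset.univ.filter fun j => y j ≠ 0) := by simpa using h
    rw [hi] at this
    exact hj (by simpa using this)
  have hchar : ∀ z, character y z = ZMod.stdAddChar (y i * z i) := by
    intro z
    rw [character, Finset.sum_eq_single i (fun j _ hj => by rw [hj0 j hj, zero_mul]) (by simp)]
  have h1 : pmfTransform μ y = ∑ t : ZMod N, ((N : ℝ)⁻¹ : ℝ) *
      (starRingEnd ℂ) (ZMod.stdAddChar (y i * t) : ℂ) := by
    rw [pmfTransform, ← Finset.sum_fiberwise (s := Finset.univ) (g := fun z => z i)]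
    refine Finset.sum_congr rfl fun t _ => ?_
    rw [← sum_filter_toReal_of_isOneWiseIndependent hμ i t, Complex.ofReal_sum, Finset.sum_mul]
    refine Finset.sum_congr rfl fun z hz => ?_
    rw [hchar, (Finset.mem_filter.1 hz).2]
  rw [h1, ← Finset.mul_sum, ← map_sum, (isSelfDual_stdAddChar N).sum_right _ hi0]
  simp

theorem character_extendLabeling (γ : Labeling N M) (x : Λ → ZMod N) :
    character (extendLabeling γ) x = ∏ e : ↥M, character (γ e) fun i => x (e.1 i) := by
  have h1 : ∑ v, extendLabeling γ v * x v = ∑ e : ↥M, ∑ i, γ e i * x (e.1 i) := by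
    simp only [extendLabeling, Finset.sum_mul, ite_mul, zero_mul]
    rw [Finset.sum_comm]
    refine Finset.sum_congr rfl fun e _ => ?_
    rw [Finset.sum_comm]
    simp
  rw [character, h1]
  have h := map_prod (ZMod.stdAddChar (N := N)).toMonoidHom
    (fun e : ↥M => Multiplicative.ofAdd (∑ i, γ e i * x (e.1 i))) Finset.univ
  rw [← ofAdd_sum] at h
  exact h

/-- The operator maps the character `γ` of labelings to a multiple of the character of `Λ` that
carries the labels of `γ`. -/
theorem markovOp_eq_sum (μ : PMF (Fin k → ZMod N)) (g : Labeling N M → ℝ) (x : Λ → ZMod N) :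
    ((markovOp M μ g x : ℝ) : ℂ) = ∑ γ : Labeling N M,
      (labelCoeff (fun ξ => (g ξ : ℂ)) γ * ∏ e, pmfTransform μ (γ e)) *
        character (extendLabeling γ) x := by
  have hblock : ∀ (y w : Fin k → ZMod N),
      ∑ z, ((μ (w - z)).toReal : ℂ) * character y z = pmfTransform μ y * character y w := by
    intro y w
    rw [← Equiv.sum_comp (Equiv.subLeft w), pmfTransform, Finset.sum_mul]
    refine Finset.sum_congr rfl fun z _ => ?_
    simp only [Equiv.subLeft_apply, sub_sub_cancel]
    rw [isSelfDual_character.conj_eq_neg_right, mul_assoc, ← isSelfDual_character.add_right,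
      neg_add_eq_sub]
  have hinv : ∀ ξ : Labeling N M, (g ξ : ℂ) = ∑ γ, labelCoeff (fun ξ => (g ξ : ℂ)) γ *
      ∏ e, character (γ e) (ξ e) := fun ξ =>
    ((isSelfDual_character.pi (ι := ↥M)).inversion (fun ξ => (g ξ : ℂ)) ξ).symm
  have hpush : ((markovOp M μ g x : ℝ) : ℂ) = ∑ ξ : Labeling N M,
      (∏ e : ↥M, ((μ fun i => x (e.1 i) - ξ e i).toReal : ℂ)) * (g ξ : ℂ) := by
    simp [markovOp, markovKernel]
  rw [hpush.trans (Finset.sum_congr rfl fun ξ _ => congrArg (_ * ·) (hinv ξ))]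
  simp_rw [Finset.mul_sum]
  rw [Finset.sum_comm]
  refine Finset.sum_congr rfl fun γ _ => ?_
  rw [character_extendLabeling, mul_assoc, ← Finset.prod_mul_distrib]
  simp_rw [← hblock]
  rw [Fintype.prod_sum, Finset.mul_sum]
  refine Finset.sum_congr rfl fun ξ _ => ?_
  rw [Finset.prod_mul_distrib]
  have : ∀ e : ↥M, (μ fun i => x (e.1 i) - ξ e i) = μ ((fun i => x (e.1 i)) - ξ e) := fun e => rfl
  simp_rw [this]
  ring

theorem charCoeff_mul_markovOp (μ : PMF (Fin k → ZMod N)) (g : Labeling N M → ℝ)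
    (f : (Λ → ZMod N) → ℝ) (a : Λ → ZMod N) :
    charCoeff (fun x => ((f x * markovOp M μ g x : ℝ) : ℂ)) a = ∑ γ : Labeling N M,
      (labelCoeff (fun ξ => (g ξ : ℂ)) γ * ∏ e, pmfTransform μ (γ e)) *
        charCoeff (fun x => (f x : ℂ)) (a - extendLabeling γ) := by
  simp only [charCoeff, expect, mul_div_assoc', Finset.mul_sum]
  rw [← Finset.sum_div, Finset.sum_comm]
  congr 1
  refine Finset.sum_congr rfl fun x _ => ?_
  rw [Complex.ofReal_mul, markovOp_eq_sum, Finset.mul_sum, Finset.sum_mul]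
  refine Finset.sum_congr rfl fun γ _ => ?_
  rw [isSelfDual_character.conj_eq_neg_left (a - _), neg_sub, sub_eq_add_neg,
    isSelfDual_character.add_left, ← isSelfDual_character.conj_eq_neg_left]
  ring

omit [Fintype Λ] [DecidableEq Λ] in
theorem prod_pmfTransform_eq_zero {μ : PMF (Fin k → ZMod N)} (hμ : IsOneWiseIndependent μ)
    {γ : Labeling N M} (hγ : ¬ NoSingleton γ) : ∏ e, pmfTransform μ (γ e) = 0 := by
  simp only [NoSingleton, not_forall, not_not] at hγ
  obtain ⟨e, he⟩ := hγ
  exact Finset.prod_eq_zero (Finset.mem_univ e) (pmfTransform_eq_zero hμ he)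

omit [Fintype Λ] [DecidableEq Λ] in
theorem norm_prod_pmfTransform_le (μ : PMF (Fin k → ZMod N)) (γ : Labeling N M) :
    ‖∏ e, pmfTransform μ (γ e)‖ ≤ 1 := by
  rw [norm_prod]
  exact Finset.prod_le_one (fun _ _ => norm_nonneg _) fun e _ => norm_pmfTransform_le μ _

open Classical in
/-- The level-`d` Fourier mass of the product comes from pairs of a coefficient of `f` at `b` and a
labeling that moves `b` to weight `d`. -/
theorem sum_norm_charCoeff_mul_markovOp_le {μ : PMF (Fin k → ZMod N)}
    (hμ : IsOneWiseIndependent μ) (g : Labeling N M → ℝ) (f : (Λ → ZMod N) → ℝ) (d : ℕ) :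
    ∑ a : Λ → ZMod N with hammingNorm a = d,
        ‖charCoeff (fun x => ((f x * markovOp M μ g x : ℝ) : ℂ)) a‖
      ≤ ∑ γ : Labeling N M with NoSingleton γ, ‖labelCoeff (fun ξ => (g ξ : ℂ)) γ‖ *
          ∑ b : Λ → ZMod N with hammingNorm (b + extendLabeling γ) = d,
            ‖charCoeff (fun x => (f x : ℂ)) b‖ := by
  have hpt : ∀ a, ‖charCoeff (fun x => ((f x * markovOp M μ g x : ℝ) : ℂ)) a‖
      ≤ ∑ γ : Labeling N M with NoSingleton γ, ‖labelCoeff (fun ξ => (g ξ : ℂ)) γ‖ *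
          ‖charCoeff (fun x => (f x : ℂ)) (a - extendLabeling γ)‖ := by
    intro a
    rw [charCoeff_mul_markovOp, Finset.sum_filter]
    refine (norm_sum_le _ _).trans (Finset.sum_le_sum fun γ _ => ?_)
    split_ifs with hγ
    · rw [norm_mul, norm_mul]
      gcongr
      exact mul_le_of_le_one_right (norm_nonneg _) (norm_prod_pmfTransform_le μ γ)
    · rw [prod_pmfTransform_eq_zero hμ hγ]; simp
  refine (Finset.sum_le_sum fun a _ => hpt a).trans (le_of_eq ?_)
  rw [Finset.sum_comm]
  refine Finset.sum_congr rfl fun γ _ => ?_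
  rw [← Finset.mul_sum]
  congr 1
  rw [Finset.sum_filter, Finset.sum_filter, ← Equiv.sum_comp (Equiv.addRight (extendLabeling γ))]
  simp

omit [NeZero N] [Fintype Λ] in
theorem extendLabeling_zero : extendLabeling (0 : Labeling N M) = 0 := by
  funext v
  simp [extendLabeling]

open Classical in
/-- Multiplication by the operator changes the mean by the Fourier coefficients of `f` that are
cancelled by a nonzero labeling. -/
theorem norm_charCoeff_zero_sub_le {μ : PMF (Fin k → ZMod N)}
    (hμ : IsOneWiseIndependent μ) (g : Labeling N M → ℝ) (f : (Λ → ZMod N) → ℝ)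
    (hg : labelCoeff (fun ξ => (g ξ : ℂ)) (0 : Labeling N M) = 1) :
    ‖charCoeff (fun x => ((f x * markovOp M μ g x : ℝ) : ℂ)) 0
        - charCoeff (fun x => (f x : ℂ)) 0‖
      ≤ ∑ γ : Labeling N M with NoSingleton γ ∧ γ ≠ 0, ‖labelCoeff (fun ξ => (g ξ : ℂ)) γ‖ *
          ∑ b : Λ → ZMod N with hammingNorm (b + extendLabeling γ) = 0,
            ‖charCoeff (fun x => (f x : ℂ)) b‖ := by
  have h0 : ∏ e : ↥M, pmfTransform μ ((0 : Labeling N M) e) = 1 := by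
    refine Finset.prod_eq_one fun e _ => ?_
    have : ∀ z : Fin k → ZMod N, character ((0 : Labeling N M) e) z = 1 := fun z =>
      isSelfDual_character.zero_left z
    simp only [pmfTransform, this, map_one, mul_one]
    exact_mod_cast sum_pmf_toReal μ
  rw [charCoeff_mul_markovOp, ← Finset.add_sum_erase _ _ (Finset.mem_univ (0 : Labeling N M)),
    hg, h0, extendLabeling_zero, sub_zero, one_mul, one_mul, add_sub_cancel_left]
  refine (norm_sum_le _ _).trans ?_
  have hsub : (Finset.univ.filter fun γ : Labeling N M => NoSingleton γ ∧ γ ≠ 0)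
      ⊆ Finset.univ.erase 0 := by
    intro γ hγ
    simpa using (Finset.mem_filter.1 hγ).2.2
  rw [← Finset.sum_subset hsub]
  · refine Finset.sum_le_sum fun γ _ => ?_
    have : (Finset.univ.filter fun b : Λ → ZMod N => hammingNorm (b + extendLabeling γ) = 0)
        = {0 - extendLabeling γ} := by
      ext b
      simp [hammingNorm_eq_zero, add_eq_zero_iff_eq_neg]
    rw [this, Finset.sum_singleton, norm_mul, norm_mul]
    gcongr
    exact mul_le_of_le_one_right (norm_nonneg _) (norm_prod_pmfTransform_le μ γ)
  · intro γ hγ hγ'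
    have : ¬ NoSingleton γ := fun h => hγ' (by simpa [h] using hγ)
    rw [prod_pmfTransform_eq_zero hμ this]
    simp

theorem charCoeff_zero (f : (Λ → ZMod N) → ℝ) :
    charCoeff (fun x => (f x : ℂ)) 0
      = (((∑ x, f x) / (Fintype.card (Λ → ZMod N) : ℝ) : ℝ) : ℂ) := by
  simp only [charCoeff, expect, isSelfDual_character.zero_left]
  push_cast
  simp

omit [Fintype Λ] in
theorem sum_markovKernel (μ : PMF (Fin k → ZMod N)) (x : Λ → ZMod N) :
    ∑ ξ : Labeling N M, markovKernel M μ x ξ = 1 := by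
  simp only [markovKernel]
  rw [← Fintype.prod_sum fun (e : ↥M) (z : Fin k → ZMod N) =>
    (μ fun i => x (e.1 i) - z i).toReal]
  refine Finset.prod_eq_one fun e _ => ?_
  rw [← sum_pmf_toReal μ, ← Equiv.sum_comp (Equiv.subLeft fun i => x (e.1 i)) fun z => (μ z).toReal]
  rfl

omit [Fintype Λ] in
theorem markovOp_nonneg (μ : PMF (Fin k → ZMod N)) {g : Labeling N M → ℝ} (hg : ∀ ξ, 0 ≤ g ξ)
    (x : Λ → ZMod N) : 0 ≤ markovOp M μ g x :=
  Finset.sum_nonneg fun ξ _ =>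
    mul_nonneg (Finset.prod_nonneg fun _ _ => ENNReal.toReal_nonneg) (hg ξ)

omit [Fintype Λ] in
theorem markovOp_le (μ : PMF (Fin k → ZMod N)) {g : Labeling N M → ℝ} {T : ℝ}
    (hg : ∀ ξ, g ξ ≤ T) (x : Λ → ZMod N) : markovOp M μ g x ≤ T := by
  calc markovOp M μ g x ≤ ∑ ξ : Labeling N M, markovKernel M μ x ξ * T :=
        Finset.sum_le_sum fun ξ _ => mul_le_mul_of_nonneg_left (hg ξ)
          (Finset.prod_nonneg fun _ _ => ENNReal.toReal_nonneg)
    _ = T := by rw [← Finset.sum_mul, sum_markovKernel, one_mul]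

end MarkovExpansion

end LabeledMatching

/-! ### Random matchings -/

namespace LabeledMatching

noncomputable section RandomMatchings

variable {k : ℕ} {Λ : Type*} [DecidableEq Λ]

namespace KUniverse

theorem mem_matchings {U : KUniverse k Λ} {m : ℕ} {M : Finset (Fin k → Λ)} :
    M ∈ U.matchings m ↔ (∀ e ∈ M, ∀ i, e i ∈ U.parts i) ∧ M.card = m ∧
      ∀ e ∈ M, ∀ e' ∈ M, e ≠ e' → ∀ i j, e i ≠ e' j := by
  simp [matchings, Finset.subset_iff, Fintype.mem_piFinset]

omit [DecidableEq Λ] in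
theorem eq_of_mem_parts {U : KUniverse k Λ} {i j : Fin k} {v : Λ} (hi : v ∈ U.parts i)
    (hj : v ∈ U.parts j) : i = j := by
  by_contra h
  exact Finset.disjoint_left.1 (U.disjoint_parts h) hi hj

/-- Switching: exchanging the edge `e` for any edge on unused vertices keeps the other edges, and
the exchange can be undone once the new edge is known. -/
theorem card_filter_insert_mul_le (hk : 1 ≤ k) (U : KUniverse k Λ) {m : ℕ}
    {S : Finset (Fin k → Λ)} {e : Fin k → Λ} (he : e ∉ S) :
    ((U.matchings m).filter fun M => insert e S ⊆ M).card * (U.card - m) ^ k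
      ≤ ((U.matchings m).filter fun M => S ⊆ M).card * m := by
  set A := (U.matchings m).filter fun M => insert e S ⊆ M with hA
  set B := (U.matchings m).filter fun M => S ⊆ M with hB
  set R : Finset (Fin k → Λ) → Finset (Fin k → Λ) := fun M =>
    Fintype.piFinset fun i => U.parts i \ M.image fun a => a i with hR
  have hRcard : ∀ M ∈ A, (U.card - m) ^ k ≤ (R M).card := by
    intro M hM
    have hMm := (mem_matchings.1 (Finset.mem_filter.1 hM).1).2.1
    rw [hR, Fintype.card_piFinset]
    calc (U.card - m) ^ k = ∏ _i : Fin k, (U.card - m) := by simp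
      _ ≤ _ := by
        refine Finset.prod_le_prod' fun i _ => ?_
        refine le_trans ?_ (Finset.le_card_sdiff _ _)
        rw [U.card_parts i, ← hMm]
        exact Nat.sub_le_sub_left Finset.card_image_le _
  have hnotmem : ∀ M : Finset (Fin k → Λ), ∀ e' ∈ R M, e' ∉ M := by
    intro M e' he' hmem
    have := Fintype.mem_piFinset.1 he' ⟨0, hk⟩
    exact (Finset.mem_sdiff.1 this).2 (Finset.mem_image_of_mem (fun a => a ⟨0, hk⟩) hmem)
  calc A.card * (U.card - m) ^ k = ∑ M ∈ A, (U.card - m) ^ k := by simp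
    _ ≤ ∑ M ∈ A, (R M).card := Finset.sum_le_sum hRcard
    _ = (A.sigma R).card := (Finset.card_sigma _ _).symm
    _ ≤ (B.sigma fun M => M).card := by
        refine Finset.card_le_card_of_injOn
          (fun p => ⟨insert p.2 (p.1.erase e), p.2⟩) ?_ ?_
        · rintro ⟨M, e'⟩ hp
          obtain ⟨hMA, he'⟩ := Finset.mem_sigma.1 (Finset.mem_coe.1 hp)
          simp only at hMA he'
          obtain ⟨hMm, hSM⟩ := Finset.mem_filter.1 hMA
          obtain ⟨hparts, hcard, hdisj⟩ := mem_matchings.1 hMm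
          have hnm := hnotmem M e' he'
          have heM : e ∈ M := hSM (Finset.mem_insert_self e S)
          have he'i : ∀ i, e' i ∈ U.parts i ∧ e' i ∉ M.image fun a => a i := fun i =>
            Finset.mem_sdiff.1 (Fintype.mem_piFinset.1 he' i)
          have hne : ∀ a ∈ M, ∀ i j, e' i ≠ a j := by
            intro a ha i j hij
            have hji : i = j := eq_of_mem_parts (he'i i).1 (hij ▸ hparts a ha j)
            subst hji
            exact (he'i i).2 (Finset.mem_image.2 ⟨a, ha, hij.symm⟩)
          refine Finset.mem_coe.2 (Finset.mem_sigma.2 ⟨?_, Finset.mem_insert_self _ _⟩)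
          refine Finset.mem_filter.2 ⟨mem_matchings.2 ⟨?_, ?_, ?_⟩, ?_⟩
          · intro a ha i
            rcases Finset.mem_insert.1 ha with rfl | ha
            · exact (he'i i).1
            · exact hparts a (Finset.mem_of_mem_erase ha) i
          · rw [Finset.card_insert_of_notMem fun h => hnm (Finset.mem_of_mem_erase h),
              Finset.card_erase_of_mem heM, hcard]
            have : 0 < M.card := Finset.card_pos.2 ⟨e, heM⟩
            omega
          · intro a ha a' ha' haa' i j
            rcases Finset.mem_insert.1 ha with rfl | ha <;>
              rcases Finset.mem_insert.1 ha' with rfl | ha'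
            · exact absurd rfl haa'
            · exact hne a' (Finset.mem_of_mem_erase ha') i j
            · exact (hne a (Finset.mem_of_mem_erase ha) j i).symm
            · exact hdisj a (Finset.mem_of_mem_erase ha) a' (Finset.mem_of_mem_erase ha') haa' i j
          · intro a ha
            refine Finset.mem_insert_of_mem (Finset.mem_erase.2 ⟨?_, ?_⟩)
            · rintro rfl; exact he ha
            · exact hSM (Finset.mem_insert_of_mem ha)
        · rintro ⟨M, e'⟩ hp ⟨M', e''⟩ hp' heq
          obtain ⟨hMA, he'⟩ := Finset.mem_sigma.1 (Finset.mem_coe.1 hp)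
          obtain ⟨hMA', he''⟩ := Finset.mem_sigma.1 (Finset.mem_coe.1 hp')
          simp only at hMA he' hMA' he''
          have h2 : e' = e'' := by simpa using congrArg (fun p => p.2) heq
          subst h2
          have h1 : insert e' (M.erase e) = insert e' (M'.erase e) := by
            simpa using congrArg (fun p => p.1) heq
          have hr : ∀ M ∈ A, e' ∈ R M →
              insert e ((insert e' (M.erase e)).erase e') = M := by
            intro M hM he'
            rw [Finset.erase_insert fun h => hnotmem M e' he' (Finset.mem_of_mem_erase h),
              Finset.insert_erase ((Finset.mem_filter.1 hM).2 (Finset.mem_insert_self e S))]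
          have : M = M' := by rw [← hr M hMA he', h1, hr M' hMA' he'']
          subst this
          rfl
    _ = B.card * m := by
        rw [Finset.card_sigma, Finset.sum_const_nat]
        exact fun M hM => (mem_matchings.1 (Finset.mem_filter.1 hM).1).2.1

theorem uniformContainProb_le (hk : 1 ≤ k) (U : KUniverse k Λ) {m : ℕ} (hm : 2 * k * m ≤ U.card)
    (hU : 0 < U.card) (S : Finset (Fin k → Λ)) :
    U.uniformContainProb m S ≤ (2 * m / (U.card : ℝ) ^ k) ^ S.card := by
  have hn : (0 : ℝ) < U.card := by exact_mod_cast hU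
  have hmn : m ≤ U.card := by nlinarith
  -- Bernoulli's inequality: `(n - m) ^ k ≥ n ^ k / 2`
  have hbern : (U.card : ℝ) ^ k ≤ 2 * ((U.card - m : ℕ) : ℝ) ^ k := by
    have hm' : (2 : ℝ) * k * m ≤ U.card := by exact_mod_cast hm
    have hmn' : (m : ℝ) ≤ U.card := by exact_mod_cast hmn
    have h1 : (m : ℝ) / U.card ≤ 1 := (div_le_one hn).2 hmn'
    have h2 := one_add_mul_le_pow (show (-2 : ℝ) ≤ -(m / U.card) by linarith) k
    have h3 : (k : ℝ) * (m / U.card) ≤ 1 / 2 := by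
      rw [mul_div_assoc', div_le_iff₀ hn]; linarith
    have h4 : ((U.card - m : ℕ) : ℝ) = U.card * (1 + -(m / U.card)) := by
      rw [Nat.cast_sub hmn]; field_simp; ring
    rw [h4, mul_pow]
    have h5 : (1 : ℝ) ≤ 2 * (1 + -(m / U.card)) ^ k := by linarith
    nlinarith [pow_pos hn k]
  have hnk : (0 : ℝ) < (U.card : ℝ) ^ k := pow_pos hn k
  induction S using Finset.induction_on with
  | empty =>
    simp only [Finset.card_empty, pow_zero, uniformContainProb, Finset.empty_subset,
      Finset.filter_true]
    exact div_self_le_one _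
  | insert e S he ih =>
    have h1 := card_filter_insert_mul_le hk U (m := m) he
    have h1' : (((U.matchings m).filter fun M => insert e S ⊆ M).card : ℝ)
          * ((U.card - m : ℕ) : ℝ) ^ k
        ≤ (((U.matchings m).filter fun M => S ⊆ M).card : ℝ) * m := by exact_mod_cast h1
    have h2 : (((U.matchings m).filter fun M => insert e S ⊆ M).card : ℝ)
        ≤ (((U.matchings m).filter fun M => S ⊆ M).card : ℝ) * (2 * m / (U.card : ℝ) ^ k) := by
      rw [mul_div_assoc', le_div_iff₀ hnk]
      have := mul_le_mul_of_nonneg_left hbern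
        (Nat.cast_nonneg (α := ℝ) ((U.matchings m).filter fun M => insert e S ⊆ M).card)
      linarith
    rw [Finset.card_insert_of_notMem he, pow_succ]
    calc U.uniformContainProb m (insert e S)
        ≤ (((U.matchings m).filter fun M => S ⊆ M).card : ℝ) * (2 * m / (U.card : ℝ) ^ k)
            / ((U.matchings m).card : ℝ) := by
          rw [uniformContainProb]; gcongr
      _ = U.uniformContainProb m S * (2 * m / (U.card : ℝ) ^ k) := by
          rw [uniformContainProb]; ring
      _ ≤ _ := by gcongr

end KUniverse

/-- The expectation of a real function under a distribution on a finite type. -/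
def pmfMean {α : Type*} [Fintype α] (D : PMF α) (X : α → ℝ) : ℝ :=
  ∑ M, (D M).toReal * X M

open Classical in
theorem prob_eq_sum {α : Type*} [Fintype α] (D : PMF α) (E : Set α) :
    prob D E = ∑ M, if M ∈ E then (D M).toReal else 0 := by
  rw [prob, PMF.toOuterMeasure_apply_fintype, ENNReal.toReal_sum]
  · refine Finset.sum_congr rfl fun M _ => ?_
    by_cases h : M ∈ E <;> simp [h]
  · intro M _
    by_cases h : M ∈ E <;> simp [h, D.apply_ne_top]

section pmfMean

variable {α : Type*} [Fintype α] (D : PMF α)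

theorem pmfMean_mono {X Y : α → ℝ} (h : ∀ M, X M ≤ Y M) : pmfMean D X ≤ pmfMean D Y :=
  Finset.sum_le_sum fun M _ => mul_le_mul_of_nonneg_left (h M) ENNReal.toReal_nonneg

theorem pmfMean_sum {I : Type*} (s : Finset I) (X : I → α → ℝ) :
    pmfMean D (fun M => ∑ i ∈ s, X i M) = ∑ i ∈ s, pmfMean D (X i) := by
  simp only [pmfMean, Finset.mul_sum]
  exact Finset.sum_comm

theorem pmfMean_add (X Y : α → ℝ) :
    pmfMean D (fun M => X M + Y M) = pmfMean D X + pmfMean D Y := by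
  simp only [pmfMean, mul_add, Finset.sum_add_distrib]

theorem pmfMean_const_mul (c : ℝ) (X : α → ℝ) :
    pmfMean D (fun M => c * X M) = c * pmfMean D X := by
  simp only [pmfMean, Finset.mul_sum]
  exact Finset.sum_congr rfl fun M _ => by ring

/-- Markov's inequality: an event whose failure forces `W ≥ 1` has probability at least
`1 - E W`. -/
theorem one_sub_pmfMean_le_prob {W : α → ℝ} (hW : ∀ M, 0 ≤ W M) {G : Set α}
    (h : ∀ M, M ∉ G → 1 ≤ W M) : 1 - pmfMean D W ≤ prob D G := by
  classical
  rw [prob_eq_sum, ← sum_pmf_toReal D, pmfMean, ← Finset.sum_sub_distrib]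
  refine Finset.sum_le_sum fun M _ => ?_
  have h0 : 0 ≤ (D M).toReal := ENNReal.toReal_nonneg
  split_ifs with hM
  · nlinarith [hW M]
  · nlinarith [h M hM]

end pmfMean

/-- Every set of edges is contained in the random matching with probability at most that of a
product measure of density `4 m / n ^ k`. -/
theorem prob_subset_le (hk : 1 ≤ k) {U : KUniverse k Λ} {m : ℕ} (hm : 2 * k * m ≤ U.card)
    (hU : 0 < U.card) {D : PMF ↥(U.matchings m)} (hD : U.IsPseudoUniform D)
    (S : Finset (Fin k → Λ)) :
    prob D {M | S ⊆ M.1} ≤ (4 * m / (U.card : ℝ) ^ k) ^ S.card := by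
  classical
  by_cases hS : ∃ M ∈ U.matchings m, S ⊆ M
  · obtain ⟨M, hM, hSM⟩ := hS
    obtain ⟨h1, h2, h3⟩ := KUniverse.mem_matchings.1 hM
    have hmem : S ∈ U.matchings S.card := KUniverse.mem_matchings.2
      ⟨fun e he => h1 e (hSM he), rfl, fun e he e' he' => h3 e (hSM he) e' (hSM he')⟩
    refine (hD S.card (h2 ▸ Finset.card_le_card hSM) S hmem).trans ?_
    calc (2 : ℝ) ^ S.card * U.uniformContainProb m S
        ≤ 2 ^ S.card * (2 * m / (U.card : ℝ) ^ k) ^ S.card := by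
          gcongr
          exact U.uniformContainProb_le hk hm hU S
      _ = _ := by rw [← mul_pow]; congr 1; ring
  · have : prob D {M | S ⊆ M.1} = 0 := by
      rw [prob_eq_sum]
      refine Finset.sum_eq_zero fun M _ => if_neg fun h => hS ⟨M.1, M.2, h⟩
    rw [this]
    positivity

/-- Under a pseudo-uniform distribution, the edges of a random matching behave, for upper bounds
on the means of products, like independent edges of density `4 m / n ^ k`. -/
theorem pmfMean_prod_one_add_le (hk : 1 ≤ k) {U : KUniverse k Λ} {m : ℕ}
    (hm : 2 * k * m ≤ U.card) (hU : 0 < U.card) {D : PMF ↥(U.matchings m)}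
    (hD : U.IsPseudoUniform D) {v : (Fin k → Λ) → ℝ} (hv : ∀ e, 0 ≤ v e) :
    pmfMean D (fun M => ∏ e ∈ M.1, (1 + v e))
      ≤ Real.exp (4 * m / (U.card : ℝ) ^ k * ∑ e ∈ Fintype.piFinset U.parts, v e) := by
  classical
  set ρ : ℝ := 4 * m / (U.card : ℝ) ^ k with hρ
  have hρ0 : 0 ≤ ρ := by positivity
  set E := Fintype.piFinset U.parts with hE
  have h1 : ∀ M : ↥(U.matchings m), ∏ e ∈ M.1, (1 + v e)
      = ∑ S ∈ E.powerset, if S ⊆ M.1 then ∏ e ∈ S, v e else 0 := by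
    intro M
    have hME : M.1 ⊆ E := Finset.mem_powerset.1 (Finset.mem_filter.1 M.2).1
    rw [Finset.prod_one_add, ← Finset.sum_filter]
    refine Finset.sum_congr ?_ fun _ _ => rfl
    ext S
    simp only [Finset.mem_powerset, Finset.mem_filter]
    exact ⟨fun h => ⟨h.trans hME, h⟩, fun h => h.2⟩
  calc pmfMean D (fun M => ∏ e ∈ M.1, (1 + v e))
      = ∑ S ∈ E.powerset, pmfMean D fun M => if S ⊆ M.1 then ∏ e ∈ S, v e else 0 := by
        simp_rw [h1]; exact pmfMean_sum D _ _
    _ = ∑ S ∈ E.powerset, prob D {M | S ⊆ M.1} * ∏ e ∈ S, v e := by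
        refine Finset.sum_congr rfl fun S _ => ?_
        rw [prob_eq_sum, Finset.sum_mul, pmfMean]
        refine Finset.sum_congr rfl fun M _ => ?_
        simp only [Set.mem_ofPred_eq]
        split_ifs <;> simp
    _ ≤ ∑ S ∈ E.powerset, ρ ^ S.card * ∏ e ∈ S, v e := by
        refine Finset.sum_le_sum fun S _ => ?_
        exact mul_le_mul_of_nonneg_right (prob_subset_le hk hm hU hD S)
          (Finset.prod_nonneg fun e _ => hv e)
    _ = ∏ e ∈ E, (1 + ρ * v e) := by
        rw [Finset.prod_one_add]
        refine Finset.sum_congr rfl fun S _ => ?_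
        rw [Finset.prod_mul_distrib, Finset.prod_const]
    _ ≤ ∏ e ∈ E, Real.exp (ρ * v e) := by
        refine Finset.prod_le_prod (fun e _ => ?_) fun e _ => ?_
        · have := hv e; positivity
        · rw [add_comm]; exact Real.add_one_le_exp _
    _ = _ := by rw [← Real.exp_sum, Finset.mul_sum]

end RandomMatchings

end LabeledMatching

/-! ### Counting labelings that change the weight of a vector -/

namespace LabeledMatching

noncomputable section Counting

variable {k N : ℕ} [NeZero N] {Λ : Type*} [Fintype Λ] [DecidableEq Λ] {M : Finset (Fin k → Λ)}

/-- The restriction of a vector to the vertices of an edge. -/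
def restrictEdge (b : Λ → ZMod N) (e : Fin k → Λ) : Fin k → ZMod N := fun i => b (e i)

omit [Fintype Λ] in
theorem vertex_injective {U : KUniverse k Λ} {m : ℕ} (hM : M ∈ U.matchings m) :
    Function.Injective fun p : ↥M × Fin k => p.1.1 p.2 := by
  obtain ⟨h1, -, h3⟩ := KUniverse.mem_matchings.1 hM
  rintro ⟨e, i⟩ ⟨e', j⟩ h
  simp only at h
  have hee : e = e' := by
    by_contra hne
    exact h3 e e.2 e' e'.2 (fun h => hne (Subtype.ext h)) i j h
  subst hee
  have : i = j := KUniverse.eq_of_mem_parts (h1 e e.2 i) (h ▸ h1 e e.2 j)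
  rw [this]

omit [NeZero N] [Fintype Λ] in
theorem restrictEdge_extendLabeling {U : KUniverse k Λ} {m : ℕ} (hM : M ∈ U.matchings m)
    (γ : Labeling N M) (e : ↥M) : restrictEdge (extendLabeling γ) e.1 = γ e := by
  funext i
  have hinj := vertex_injective hM
  rw [restrictEdge, extendLabeling, Finset.sum_eq_single e, Finset.sum_eq_single i]
  · simp
  · intro j _ hj
    exact if_neg fun h => hj (congrArg Prod.snd (@hinj (e, j) (e, i) h))
  · simp
  · intro e' _ he'
    refine Finset.sum_eq_zero fun j _ => if_neg fun h => he' ?_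
    exact congrArg Prod.fst (@hinj (e', j) (e, i) h)
  · simp

omit [NeZero N] in
/-- Replacing `b` by `b + extendLabeling γ` changes its weight edge by edge. -/
theorem hammingNorm_add_extendLabeling {U : KUniverse k Λ} {m : ℕ} (hM : M ∈ U.matchings m)
    (b : Λ → ZMod N) (γ : Labeling N M) :
    hammingNorm (b + extendLabeling γ) + ∑ e : ↥M, hammingNorm (restrictEdge b e.1)
      = hammingNorm b + ∑ e : ↥M, hammingNorm (restrictEdge b e.1 + γ e) := by
  set φ : ↥M × Fin k → Λ := fun p => p.1.1 p.2 with hφ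
  have hinj : Function.Injective φ := vertex_injective hM
  set V : Finset Λ := Finset.univ.image φ with hV
  have hsplit : ∀ c : Λ → ZMod N, hammingNorm c
      = ∑ e : ↥M, hammingNorm (restrictEdge c e.1) + ∑ v ∈ Vᶜ, if c v ≠ 0 then 1 else 0 := by
    intro c
    have h1 : hammingNorm c = ∑ v, if c v ≠ 0 then 1 else 0 := by
      rw [hammingNorm, Finset.card_filter]
    rw [h1, ← Finset.sum_add_sum_compl V, hV, Finset.sum_image fun p _ p' _ h => hinj h,
      Fintype.sum_prod_type]
    congr 1
    refine Finset.sum_congr rfl fun e _ => ?_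
    rw [hammingNorm, Finset.card_filter]
    rfl
  have hoff : ∀ v ∈ Vᶜ, extendLabeling γ v = 0 := by
    intro v hv
    refine Finset.sum_eq_zero fun e _ => Finset.sum_eq_zero fun i _ => if_neg fun h => ?_
    exact Finset.mem_compl.1 hv (Finset.mem_image.2 ⟨(e, i), Finset.mem_univ _, h⟩)
  have hon : ∀ e : ↥M, restrictEdge (b + extendLabeling γ) e.1 = restrictEdge b e.1 + γ e := by
    intro e
    rw [← restrictEdge_extendLabeling hM γ e]
    rfl
  rw [hsplit (b + extendLabeling γ), hsplit b]
  simp_rw [hon]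
  have : ∑ v ∈ Vᶜ, (if (b + extendLabeling γ) v ≠ 0 then 1 else 0)
      = ∑ v ∈ Vᶜ, if b v ≠ 0 then 1 else 0 :=
    Finset.sum_congr rfl fun v hv => by rw [Pi.add_apply, hoff v hv, add_zero]
  rw [this]
  ring

omit [NeZero N] in
/-- A nonzero block has at least two nonzero entries, so on an edge that meets the support of `b`
in `t` vertices it changes the weight from `t` to at least `2 - t`. -/
theorem hammingNorm_add_two_mul_le {U : KUniverse k Λ} {m : ℕ} (hM : M ∈ U.matchings m)
    (b : Λ → ZMod N) {γ : Labeling N M} (hγ : NoSingleton γ) :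
    hammingNorm b + ∑ e : ↥M, (if γ e = 0 then 0 else 2) ≤ hammingNorm (b + extendLabeling γ)
      + ∑ e : ↥M, if γ e = 0 then 0 else 2 * hammingNorm (restrictEdge b e.1) := by
  have h1 := hammingNorm_add_extendLabeling hM b γ
  have h2 : ∑ e : ↥M, (hammingNorm (restrictEdge b e.1) + if γ e = 0 then 0 else 2)
      ≤ ∑ e : ↥M, (hammingNorm (restrictEdge b e.1 + γ e) +
          if γ e = 0 then 0 else 2 * hammingNorm (restrictEdge b e.1)) := by
    refine Finset.sum_le_sum fun e _ => ?_
    by_cases he : γ e = 0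
    · simp [he]
    · rw [if_neg he, if_neg he]
      have h3 : hammingNorm (γ e) ≠ 0 := by rwa [Ne, hammingNorm_eq_zero]
      have h4 := hγ e
      have h5 : hammingNorm (γ e) ≤ hammingNorm (restrictEdge b e.1)
          + hammingNorm (restrictEdge b e.1 + γ e) := by
        have := hammingDist_triangle (γ e) (-(restrictEdge b e.1)) 0
        have hneg : ∀ y : Fin k → ZMod N, hammingNorm (-y) = hammingNorm y := fun y => by
          simp [hammingNorm]
        rw [hammingDist_zero_right, hammingDist_zero_right, hammingDist_eq_hammingNorm,
          ← neg_add, hneg, hneg, add_comm (γ e)] at this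
        omega
      omega
  rw [Finset.sum_add_distrib, Finset.sum_add_distrib] at h2
  omega

open Classical in
/-- The labelings without singleton blocks, supported on the edges in `T`, that turn the weight of
`b` into `d`. -/
def reweightings (T : Set (Fin k → Λ)) (b : Λ → ZMod N) (d : ℕ) (M : Finset (Fin k → Λ)) :
    Finset (Labeling N M) :=
  Finset.univ.filter fun γ => NoSingleton γ ∧ (∀ e : ↥M, γ e ≠ 0 → e.1 ∈ T) ∧
    hammingNorm (b + extendLabeling γ) = d

theorem mem_reweightings {T : Set (Fin k → Λ)} {b : Λ → ZMod N} {d : ℕ} {γ : Labeling N M} :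
    γ ∈ reweightings T b d M ↔ NoSingleton γ ∧ (∀ e : ↥M, γ e ≠ 0 → e.1 ∈ T) ∧
      hammingNorm (b + extendLabeling γ) = d := by
  simp [reweightings]

open Classical in
/-- An edge that meets the support of `b` in `t` vertices and carries a nonzero block can lower
the weight by at most `2 * (t - 1)`, so it is charged `z ^ (2 * t - 2)`. -/
theorem card_reweightings_mul_le {U : KUniverse k Λ} {m : ℕ} (hM : M ∈ U.matchings m)
    (T : Set (Fin k → Λ)) (b : Λ → ZMod N) (d : ℕ) {z : ℝ} (hz : 1 ≤ z) :
    ((reweightings T b d M).card : ℝ) * z ^ hammingNorm b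
      ≤ z ^ d * ∏ e ∈ M, (1 + if e ∈ T then (N : ℝ) ^ k *
          ((z ^ 2)⁻¹ * (z ^ 2) ^ hammingNorm (restrictEdge b e)) else 0) := by
  have hz0 : 0 < z := by linarith
  set v : (Fin k → Λ) → ℝ := fun e =>
    if e ∈ T then (z ^ 2)⁻¹ * (z ^ 2) ^ hammingNorm (restrictEdge b e) else 0 with hv
  have hv0 : ∀ e, 0 ≤ v e := fun e => by rw [hv]; simp only; split_ifs <;> positivity
  have hpt : ∀ γ ∈ reweightings T b d M,
      z ^ hammingNorm b ≤ z ^ d * ∏ e : ↥M, if γ e = 0 then 1 else v e.1 := by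
    intro γ hγ
    obtain ⟨-, h1, h2, h3⟩ := Finset.mem_filter.1 hγ
    have h4 := hammingNorm_add_two_mul_le hM b h1
    rw [h3] at h4
    have h5 := pow_le_pow_right₀ hz h4
    rw [pow_add, pow_add, ← Finset.prod_pow_eq_pow_sum, ← Finset.prod_pow_eq_pow_sum] at h5
    have h6 : 0 < ∏ e : ↥M, z ^ (if γ e = 0 then 0 else 2) :=
      Finset.prod_pos fun e _ => by positivity
    have h7 : (∏ e : ↥M, z ^ (if γ e = 0 then 0 else 2 * hammingNorm (restrictEdge b e.1)))
        = (∏ e : ↥M, if γ e = 0 then 1 else v e.1) *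
          ∏ e : ↥M, z ^ (if γ e = 0 then 0 else 2) := by
      rw [← Finset.prod_mul_distrib]
      refine Finset.prod_congr rfl fun e _ => ?_
      by_cases he : γ e = 0
      · simp [he]
      · simp only [if_neg he, hv, if_pos (h2 e he)]
        rw [pow_mul]
        field_simp
    rw [h7, ← mul_assoc] at h5
    exact le_of_mul_le_mul_right h5 h6
  calc ((reweightings T b d M).card : ℝ) * z ^ hammingNorm b
      = ∑ γ ∈ reweightings T b d M, z ^ hammingNorm b := by simp
    _ ≤ ∑ γ ∈ reweightings T b d M, z ^ d * ∏ e : ↥M, (if γ e = 0 then 1 else v e.1) :=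
        Finset.sum_le_sum hpt
    _ ≤ ∑ γ : Labeling N M, z ^ d * ∏ e : ↥M, (if γ e = 0 then 1 else v e.1) := by
        refine Finset.sum_le_sum_of_subset_of_nonneg (Finset.subset_univ _) fun γ _ _ => ?_
        refine mul_nonneg (by positivity) (Finset.prod_nonneg fun e _ => ?_)
        split_ifs <;> simp [hv0]
    _ = z ^ d * ∏ e : ↥M, ∑ y : Fin k → ZMod N, (if y = 0 then 1 else v e.1) := by
        rw [← Finset.mul_sum, Fintype.prod_sum]
    _ ≤ z ^ d * ∏ e : ↥M, (1 + (N : ℝ) ^ k * v e.1) := by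
        refine mul_le_mul_of_nonneg_left (Finset.prod_le_prod (fun e _ => ?_) fun e _ => ?_)
          (by positivity)
        · refine Finset.sum_nonneg fun y _ => ?_
          split_ifs <;> simp [hv0]
        · calc ∑ y : Fin k → ZMod N, (if y = 0 then 1 else v e.1)
              ≤ ∑ y : Fin k → ZMod N, ((if y = 0 then 1 else 0) + v e.1) := by
                refine Finset.sum_le_sum fun y _ => ?_
                split_ifs <;> linarith [hv0 e.1]
            _ = 1 + (N : ℝ) ^ k * v e.1 := by
                rw [Finset.sum_add_distrib]
                simp [ZMod.card]
    _ = _ := by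
        congr 1
        rw [Finset.prod_coe_sort M fun e => 1 + (N : ℝ) ^ k * v e]
        refine Finset.prod_congr rfl fun e _ => ?_
        simp only [hv, mul_ite, mul_zero]

section EdgeSums

variable (U : KUniverse k Λ) (b : Λ → ZMod N)

omit [NeZero N] [Fintype Λ] [DecidableEq Λ] in
theorem pow_hammingNorm_restrictEdge (e : Fin k → Λ) (Z : ℝ) :
    Z ^ hammingNorm (restrictEdge b e) = ∏ i, if b (e i) = 0 then 1 else Z := by
  rw [hammingNorm, ← Finset.prod_const, Finset.prod_filter]
  refine Finset.prod_congr rfl fun i _ => ?_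
  by_cases h : b (e i) = 0 <;> simp [restrictEdge, h]

omit [NeZero N] [Fintype Λ] [DecidableEq Λ] in
theorem sum_part_le (i : Fin k) {Z ω : ℝ} (hZ : 0 ≤ Z)
    (hω : (((U.parts i).filter fun v => b v ≠ 0).card : ℝ) ≤ ω) :
    ∑ v ∈ U.parts i, (if b v = 0 then 1 else Z) ≤ U.card + Z * ω := by
  calc ∑ v ∈ U.parts i, (if b v = 0 then 1 else Z)
      ≤ ∑ v ∈ U.parts i, (1 + if b v ≠ 0 then Z else 0) := by
        refine Finset.sum_le_sum fun v _ => ?_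
        by_cases h : b v = 0 <;> simp [h]
    _ = U.card + Z * (((U.parts i).filter fun v => b v ≠ 0).card : ℝ) := by
        rw [Finset.sum_add_distrib, ← Finset.sum_filter]
        simp [U.card_parts, mul_comm]
    _ ≤ _ := by gcongr

omit [NeZero N] [Fintype Λ] [DecidableEq Λ] in
theorem sum_pow_restrictEdge_le {Z ω : ℝ} (hZ : 0 ≤ Z)
    (hω : ∀ i, (((U.parts i).filter fun v => b v ≠ 0).card : ℝ) ≤ ω) :
    ∑ e ∈ Fintype.piFinset U.parts, Z ^ hammingNorm (restrictEdge b e)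
      ≤ (U.card + Z * ω) ^ k := by
  simp_rw [pow_hammingNorm_restrictEdge]
  rw [← Finset.prod_univ_sum U.parts fun _ v => if b v = 0 then (1 : ℝ) else Z]
  calc _ ≤ ∏ _i : Fin k, (U.card + Z * ω) := by
        refine Finset.prod_le_prod (fun i _ => Finset.sum_nonneg fun v _ => ?_)
          fun i _ => sum_part_le U b i hZ (hω i)
        split_ifs <;> simp [hZ]
    _ = _ := by simp

omit [NeZero N] [Fintype Λ] [DecidableEq Λ] in
theorem sum_pow_restrictEdge_touched_le {Z ω : ℝ} (hZ : 0 ≤ Z)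
    (hω : ∀ i, (((U.parts i).filter fun v => b v ≠ 0).card : ℝ) ≤ ω) :
    ∑ e ∈ Fintype.piFinset U.parts with restrictEdge b e ≠ 0,
        Z ^ hammingNorm (restrictEdge b e)
      ≤ k * (Z * ω * (U.card + Z * ω) ^ (k - 1)) := by
  have hω0 : 0 ≤ Z * ω ∨ k = 0 := by
    rcases k with _ | k
    · exact Or.inr rfl
    · exact Or.inl (mul_nonneg hZ ((Nat.cast_nonneg _).trans (hω 0)))
  rcases hω0 with hω0 | rfl
  swap
  · refine le_trans (le_of_eq ?_) (by simp : (0 : ℝ) ≤ _)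
    refine Finset.sum_eq_zero fun e he => ?_
    exact absurd (Subsingleton.elim _ _) (Finset.mem_filter.1 he).2
  have hone : ∀ i : Fin k, ∑ e ∈ Fintype.piFinset U.parts with b (e i) ≠ 0,
      Z ^ hammingNorm (restrictEdge b e) ≤ Z * ω * (U.card + Z * ω) ^ (k - 1) := by
    intro i
    set g : Fin k → Λ → ℝ := fun j v =>
      if j = i then (if b v = 0 then 0 else Z) else (if b v = 0 then 1 else Z) with hg
    have h1 : ∀ e : Fin k → Λ, (if b (e i) ≠ 0 then Z ^ hammingNorm (restrictEdge b e) else 0)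
        = ∏ j, g j (e j) := by
      intro e
      rw [pow_hammingNorm_restrictEdge]
      split_ifs with h
      · refine Finset.prod_congr rfl fun j _ => ?_
        simp only [hg]
        split_ifs with h2 h3
        · subst h3; exact absurd h2 h
        all_goals rfl
      · symm
        refine Finset.prod_eq_zero (Finset.mem_univ i) ?_
        simp only [not_not] at h
        simp [hg, h]
    rw [Finset.sum_filter]
    simp_rw [h1]
    rw [← Finset.prod_univ_sum U.parts g, ← Finset.mul_prod_erase _ _ (Finset.mem_univ i)]
    have h2 : ∑ v ∈ U.parts i, g i v ≤ Z * ω := by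
      have : ∑ v ∈ U.parts i, g i v = Z * (((U.parts i).filter fun v => b v ≠ 0).card : ℝ) := by
        rw [Finset.card_filter, Nat.cast_sum, Finset.mul_sum]
        refine Finset.sum_congr rfl fun v _ => ?_
        by_cases h : b v = 0 <;> simp [hg, h]
      rw [this]
      exact mul_le_mul_of_nonneg_left (hω i) hZ
    have hg0 : ∀ j v, 0 ≤ g j v := fun j v => by
      simp only [hg]; split_ifs <;> simp [hZ]
    refine mul_le_mul h2 ?_ (Finset.prod_nonneg fun j _ => Finset.sum_nonneg fun v _ => hg0 j v)
      hω0
    calc ∏ j ∈ Finset.univ.erase i, ∑ v ∈ U.parts j, g j v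
        ≤ ∏ j ∈ Finset.univ.erase i, (U.card + Z * ω) := by
          refine Finset.prod_le_prod (fun j _ => Finset.sum_nonneg fun v _ => hg0 j v)
            fun j hj => ?_
          have hji : j ≠ i := (Finset.mem_erase.1 hj).1
          simp only [hg, if_neg hji]
          exact sum_part_le U b j hZ (hω j)
      _ = _ := by simp
  calc _ ≤ ∑ i : Fin k, ∑ e ∈ Fintype.piFinset U.parts with b (e i) ≠ 0,
          Z ^ hammingNorm (restrictEdge b e) := by
        simp_rw [Finset.sum_filter]
        rw [Finset.sum_comm]
        refine Finset.sum_le_sum fun e _ => ?_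
        have h0 : ∀ i ∈ (Finset.univ : Finset (Fin k)),
            0 ≤ if b (e i) ≠ 0 then Z ^ hammingNorm (restrictEdge b e) else 0 := fun i _ => by
          split_ifs <;> positivity
        split_ifs with h
        · obtain ⟨i, hi⟩ := Function.ne_iff.1 h
          have hi' : b (e i) ≠ 0 := hi
          refine le_trans (le_of_eq ?_) (Finset.single_le_sum h0 (Finset.mem_univ i))
          rw [if_pos hi']
        · exact Finset.sum_nonneg h0
    _ ≤ ∑ i : Fin k, Z * ω * (U.card + Z * ω) ^ (k - 1) := Finset.sum_le_sum fun i _ => hone i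
    _ = _ := by simp

end EdgeSums

end Counting

end LabeledMatching

/-! ### Vectors of small weight -/

namespace LabeledMatching

noncomputable section SmallWeights

variable {k N : ℕ} [NeZero N] {Λ : Type*} [Fintype Λ] [DecidableEq Λ]

/-- The mean number of labelings that turn the weight of `b` into `d`, with a free scale `z`. -/
theorem pmfMean_card_reweightings_mul_le (hk : 1 ≤ k) {U : KUniverse k Λ} {m : ℕ}
    (hm : 2 * k * m ≤ U.card) (hU : 0 < U.card) {D : PMF ↥(U.matchings m)}
    (hD : U.IsPseudoUniform D) (T : Set (Fin k → Λ)) [DecidablePred (· ∈ T)] (b : Λ → ZMod N)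
    (d : ℕ) {z : ℝ} (hz : 1 ≤ z) :
    pmfMean D (fun M => ((reweightings T b d M.1).card : ℝ)) * z ^ hammingNorm b
      ≤ z ^ d * Real.exp (4 * m / (U.card : ℝ) ^ k * ((N : ℝ) ^ k * ((z ^ 2)⁻¹ *
          ∑ e ∈ Fintype.piFinset U.parts with e ∈ T,
            (z ^ 2) ^ hammingNorm (restrictEdge b e)))) := by
  classical
  set v : (Fin k → Λ) → ℝ := fun e => if e ∈ T then (N : ℝ) ^ k *
    ((z ^ 2)⁻¹ * (z ^ 2) ^ hammingNorm (restrictEdge b e)) else 0 with hv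
  have hv0 : ∀ e, 0 ≤ v e := fun e => by simp only [hv]; split_ifs <;> positivity
  have h1 := pmfMean_prod_one_add_le hk hm hU hD hv0
  have h2 : ∑ e ∈ Fintype.piFinset U.parts, v e = (N : ℝ) ^ k * ((z ^ 2)⁻¹ *
      ∑ e ∈ Fintype.piFinset U.parts with e ∈ T, (z ^ 2) ^ hammingNorm (restrictEdge b e)) := by
    rw [Finset.sum_filter, Finset.mul_sum, Finset.mul_sum]
    refine Finset.sum_congr rfl fun e _ => ?_
    simp only [hv]
    split_ifs <;> simp
  rw [h2] at h1
  refine le_trans ?_ (mul_le_mul_of_nonneg_left h1 (by positivity))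
  rw [mul_comm, ← pmfMean_const_mul, ← pmfMean_const_mul]
  refine pmfMean_mono D fun M => ?_
  have := card_reweightings_mul_le M.2 T b d hz
  rw [mul_comm]
  convert this using 4
  simp only [hv]
  split_ifs <;> rfl

omit [NeZero N] [DecidableEq Λ] in
theorem card_part_support_le (U : KUniverse k Λ) (b : Λ → ZMod N) (i : Fin k) :
    ((U.parts i).filter fun v => b v ≠ 0).card ≤ hammingNorm b :=
  Finset.card_le_card (Finset.filter_subset_filter _ (Finset.subset_univ _))

/-- The numerical consequence of the bound on the number of edges that all later estimates use. -/
theorem mul_pow_le_of_le {k N n m : ℕ} (hN : 2 ≤ N)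
    (h : 2 ^ 18 * N ^ (10 * k) * m ≤ n) : 64 * (k * N ^ k * 65 ^ k) * m ≤ n := by
  have h1 : k ≤ N ^ k := (Nat.lt_pow_self (by omega)).le
  have h2 : 65 ^ k ≤ N ^ (7 * k) := by
    rw [pow_mul]
    refine Nat.pow_le_pow_left ?_ k
    exact le_trans (by norm_num) (Nat.pow_le_pow_left hN 7)
  have h3 : k * N ^ k * 65 ^ k ≤ N ^ (10 * k) := by
    calc k * N ^ k * 65 ^ k ≤ N ^ k * N ^ k * N ^ (7 * k) := by gcongr
      _ = N ^ (9 * k) := by rw [← pow_add, ← pow_add]; congr 1; ring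
      _ ≤ N ^ (10 * k) := Nat.pow_le_pow_right (by omega) (by omega)
  calc 64 * (k * N ^ k * 65 ^ k) * m ≤ 2 ^ 18 * N ^ (10 * k) * m := by gcongr; norm_num
    _ ≤ n := h

/-- As long as `z ^ 2` times the weight of `b` is at most of the order of the size of the universe,
the exponential factor costs at most `2` per unit of weight. -/
theorem pmfMean_card_touched_le (hk : 1 ≤ k) (hN : 2 ≤ N) {U : KUniverse k Λ} {m : ℕ}
    (hm : 2 ^ 18 * N ^ (10 * k) * m ≤ U.card) (hm0 : 0 < m) {D : PMF ↥(U.matchings m)}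
    (hD : U.IsPseudoUniform D) (b : Λ → ZMod N) (d : ℕ) {z : ℝ} (hz : 1 ≤ z)
    (hzb : z ^ 2 * hammingNorm b ≤ 64 * U.card) :
    pmfMean D (fun M => ((reweightings {e | restrictEdge b e ≠ 0} b d M.1).card : ℝ))
      * z ^ hammingNorm b ≤ z ^ d * 2 ^ hammingNorm b := by
  classical
  have hz0 : 0 < z := by linarith
  have hnum := mul_pow_le_of_le hN hm
  have h65 : 1 ≤ 65 ^ k := Nat.one_le_pow _ _ (by norm_num)
  have hNk : 1 ≤ N ^ k := Nat.one_le_pow _ _ (by omega)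
  have hm2 : 2 * k * m ≤ U.card := by
    refine le_trans ?_ hnum
    have : k * 1 * 1 ≤ k * N ^ k * 65 ^ k := by gcongr
    nlinarith
  have hU : 0 < U.card := by
    have : 0 < 2 * k * m := by positivity
    omega
  refine (pmfMean_card_reweightings_mul_le hk hm2 hU hD _ b d hz).trans ?_
  refine mul_le_mul_of_nonneg_left ?_ (by positivity)
  have hn : (0 : ℝ) < U.card := by exact_mod_cast hU
  set n : ℝ := (U.card : ℝ) with hndef
  set w : ℕ := hammingNorm b with hw
  have hsum := sum_pow_restrictEdge_touched_le U b (Z := z ^ 2) (ω := w) (by positivity)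
    fun i => by exact_mod_cast card_part_support_le U b i
  have hle : 4 * m / n ^ k * ((N : ℝ) ^ k * ((z ^ 2)⁻¹ *
      ∑ e ∈ Fintype.piFinset U.parts with restrictEdge b e ≠ 0,
        (z ^ 2) ^ hammingNorm (restrictEdge b e))) ≤ w / 2 := by
    have hpow : (n + z ^ 2 * w) ^ (k - 1) ≤ 65 ^ k * n ^ (k - 1) := by
      calc (n + z ^ 2 * w) ^ (k - 1) ≤ (65 * n) ^ (k - 1) := by
            gcongr; linarith
        _ = 65 ^ (k - 1) * n ^ (k - 1) := mul_pow _ _ _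
        _ ≤ 65 ^ k * n ^ (k - 1) := by gcongr <;> norm_num
    have hnk : n ^ k = n * n ^ (k - 1) := by
      rw [← pow_succ']; congr 1; omega
    have hnumR : 64 * ((k : ℝ) * (N : ℝ) ^ k * 65 ^ k) * m ≤ n := by
      rw [hndef]; exact_mod_cast hnum
    calc _ ≤ 4 * m / n ^ k * ((N : ℝ) ^ k * ((z ^ 2)⁻¹ *
            (k * (z ^ 2 * w * (65 ^ k * n ^ (k - 1)))))) := by
          gcongr
          refine hsum.trans ?_
          gcongr
      _ = (4 * (k * (N : ℝ) ^ k * 65 ^ k) * m) / n * w := by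
          rw [hnk]
          have : n ^ (k - 1) ≠ 0 := pow_ne_zero _ hn.ne'
          field_simp
      _ ≤ 1 / 2 * w := by
          refine mul_le_mul_of_nonneg_right ?_ (Nat.cast_nonneg _)
          rw [div_le_iff₀ hn]
          have : 0 ≤ (k * (N : ℝ) ^ k * 65 ^ k) * m := by positivity
          linarith
      _ = w / 2 := by ring
  calc _ ≤ Real.exp (w / 2) := Real.exp_le_exp.2 hle
    _ = Real.exp (1 / 2) ^ w := by rw [← Real.exp_nat_mul]; congr 1; ring
    _ ≤ 2 ^ w := by
      gcongr
      have h1 : Real.exp (1 / 2) ^ 2 ≤ 2 ^ 2 := by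
        rw [← Real.exp_nat_mul]
        have := Real.exp_one_lt_d9
        norm_num at this ⊢
        linarith
      exact (pow_le_pow_iff_left₀ (Real.exp_pos _).le (by norm_num) two_ne_zero).1 h1

theorem mul_sqrt_eq {a : ℝ} (ha : 0 ≤ a) (x : ℝ) : a * √x = √(a ^ 2 * x) := by
  rw [Real.sqrt_mul (sq_nonneg a), Real.sqrt_sq ha]

/-- The base of the growth bound: `F_C(n, d, s) = growthBase C n s d ^ d`. -/
def growthBase (C : ℝ) (n : ℕ) (s : ℝ) (d : ℕ) : ℝ := √(C * √((n : ℝ) * max s (d : ℝ)) / (d : ℝ))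

theorem growthBound_eq_pow {C : ℝ} (hC : 0 ≤ C) (n d : ℕ) (s : ℝ) :
    growthBound C n d s = growthBase C n s d ^ d := by
  rw [growthBound, growthBase, Real.rpow_div_two_eq_sqrt _ (by positivity), Real.rpow_natCast]

section GrowthBase

variable {C s : ℝ} {n : ℕ}

theorem growthBase_sq (hC : 0 ≤ C) (d : ℕ) :
    growthBase C n s d ^ 2 = C * √((n : ℝ) * max s (d : ℝ)) / d :=
  Real.sq_sqrt (by positivity)

theorem one_le_growthBase (hC : 1 ≤ C) {d : ℕ} (hd : 1 ≤ d) (hdn : d ≤ n) :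
    1 ≤ growthBase C n s d := by
  have hd' : (0 : ℝ) < d := by exact_mod_cast hd
  have hdn' : (d : ℝ) ≤ n := by exact_mod_cast hdn
  rw [growthBase, Real.one_le_sqrt, one_le_div hd']
  have h1 : (d : ℝ) ≤ √((n : ℝ) * max s (d : ℝ)) := by
    apply Real.le_sqrt_of_sq_le
    rw [sq]
    exact mul_le_mul hdn' (le_max_right _ _) hd'.le (by positivity)
  nlinarith

theorem growthBase_anti (hC : 0 ≤ C) {d w : ℕ} (hd : 1 ≤ d) (hdw : d ≤ w) :
    growthBase C n s w ≤ growthBase C n s d := by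
  have hd' : (0 : ℝ) < d := by exact_mod_cast hd
  have hdw' : (d : ℝ) ≤ w := by exact_mod_cast hdw
  have hw' : (0 : ℝ) < w := hd'.trans_le hdw'
  refine Real.sqrt_le_sqrt ?_
  rw [mul_div_assoc, mul_div_assoc]
  refine mul_le_mul_of_nonneg_left ?_ hC
  rw [div_le_div_iff₀ hw' hd']
  have hmax : 0 ≤ max s (d : ℝ) := hd'.le.trans (le_max_right _ _)
  have hmax' : 0 ≤ max s (w : ℝ) := hw'.le.trans (le_max_right _ _)
  have hkey : max s (w : ℝ) * (d : ℝ) ^ 2 ≤ max s (d : ℝ) * (w : ℝ) ^ 2 := by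
    rcases max_cases s (w : ℝ) with ⟨h, -⟩ | ⟨h, -⟩
    · rw [h]
      exact mul_le_mul (le_max_left _ _) (by gcongr) (by positivity) hmax
    · rw [h]
      calc (w : ℝ) * d ^ 2 = d * (w * d) := by ring
        _ ≤ max s (d : ℝ) * (w * w) := by
            gcongr
            exact le_max_right _ _
        _ = _ := by ring
  calc √((n : ℝ) * max s (w : ℝ)) * d = √((n : ℝ) * (max s (w : ℝ) * d ^ 2)) := by
        rw [mul_comm, mul_sqrt_eq hd'.le]
        congr 1; ring
    _ ≤ √((n : ℝ) * (max s (d : ℝ) * w ^ 2)) := by gcongr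
    _ = √((n : ℝ) * max s (d : ℝ)) * w := by
        rw [mul_comm _ (w : ℝ), mul_sqrt_eq hw'.le]
        congr 1; ring

/-- Raising the level in the base of the growth bound costs only a factor `2 ^ d`. -/
theorem growthBase_pow_le (hC : 0 ≤ C) {d w : ℕ} (hw : 1 ≤ w) (hwd : w ≤ d) :
    growthBase C n s w ^ w ≤ 2 ^ d * growthBase C n s d ^ w := by
  have hw' : (0 : ℝ) < w := by exact_mod_cast hw
  have hwd' : (w : ℝ) ≤ d := by exact_mod_cast hwd
  have hd' : (0 : ℝ) < d := hw'.trans_le hwd'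
  have h1 : growthBase C n s w ≤ √((d : ℝ) / w) * growthBase C n s d := by
    rw [growthBase, growthBase, ← Real.sqrt_mul (by positivity)]
    refine Real.sqrt_le_sqrt ?_
    have h2 : √((n : ℝ) * max s (w : ℝ)) ≤ √((n : ℝ) * max s (d : ℝ)) := by
      gcongr
    calc C * √((n : ℝ) * max s (w : ℝ)) / w ≤ C * √((n : ℝ) * max s (d : ℝ)) / w := by gcongr
      _ = _ := by field_simp
  have h3 : √((d : ℝ) / w) ^ w ≤ 2 ^ d := by
    refine (pow_le_pow_iff_left₀ (by positivity) (by positivity) two_ne_zero).1 ?_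
    rw [← pow_mul, mul_comm w 2, pow_mul, Real.sq_sqrt (by positivity)]
    calc ((d : ℝ) / w) ^ w ≤ Real.exp ((d : ℝ) / w) ^ w := by
          gcongr
          linarith [Real.add_one_le_exp ((d : ℝ) / w)]
      _ = Real.exp 1 ^ d := by
          rw [← Real.exp_nat_mul, ← Real.exp_nat_mul]
          congr 1
          field_simp
      _ ≤ 4 ^ d := by
          gcongr
          linarith [Real.exp_one_lt_d9]
      _ = (2 ^ d) ^ 2 := by rw [← pow_mul, mul_comm, pow_mul]; norm_num
  calc growthBase C n s w ^ w ≤ (√((d : ℝ) / w) * growthBase C n s d) ^ w :=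
        pow_le_pow_left₀ (Real.sqrt_nonneg _) h1 w
    _ = √((d : ℝ) / w) ^ w * growthBase C n s d ^ w := mul_pow _ _ _
    _ ≤ _ := by
        gcongr
        exact pow_nonneg (Real.sqrt_nonneg _) _

end GrowthBase

theorem sum_Icc_half_pow_le (W : ℕ) : ∑ w ∈ Finset.Icc 1 W, (1 / 2 : ℝ) ^ w ≤ 1 := by
  have : ∀ W : ℕ, ∑ w ∈ Finset.Icc 1 W, (1 / 2 : ℝ) ^ w = 1 - (1 / 2) ^ W := by
    intro W
    induction W with
    | zero => simp
    | succ W ih => rw [Finset.sum_Icc_succ_top (by omega), ih]; ring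
  rw [this]
  have : (0 : ℝ) ≤ (1 / 2) ^ W := by positivity
  linarith

/-- The total coefficient mass `A` that labelings touching the low-weight, nonzero vectors `b` move
to level `d`. -/
def touchedMass (A : (Λ → ZMod N) → ℝ) (W d : ℕ) (M : Finset (Fin k → Λ)) : ℝ :=
  ∑ b : Λ → ZMod N with 1 ≤ hammingNorm b ∧ hammingNorm b ≤ W,
    A b * (reweightings {e | restrictEdge b e ≠ 0} b d M).card

/-- A level-by-level bound on the coefficients `A` and on the mean number of reweightings combine to
a bound on the mean touched mass. -/
theorem pmfMean_touchedMass_le {U : KUniverse k Λ} {m : ℕ} {D : PMF ↥(U.matchings m)}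
    {A : (Λ → ZMod N) → ℝ} (hA : ∀ b, 0 ≤ A b) {W d : ℕ} {F c : ℕ → ℝ} {K : ℝ} (hK : 0 ≤ K)
    (hF : ∀ w, 1 ≤ w → w ≤ W → ∑ b : Λ → ZMod N with hammingNorm b = w, A b ≤ F w)
    (hc : ∀ b : Λ → ZMod N, 1 ≤ hammingNorm b → hammingNorm b ≤ W →
      pmfMean D (fun M => ((reweightings {e | restrictEdge b e ≠ 0} b d M.1).card : ℝ))
        ≤ c (hammingNorm b))
    (hc0 : ∀ w, 0 ≤ c w)
    (hFc : ∀ w, 1 ≤ w → w ≤ W → F w * c w ≤ K * (1 / 2) ^ w) :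
    pmfMean D (fun M => touchedMass A W d M.1) ≤ K := by
  simp only [touchedMass]
  rw [pmfMean_sum]
  simp_rw [pmfMean_const_mul]
  calc _ ≤ ∑ b : Λ → ZMod N with 1 ≤ hammingNorm b ∧ hammingNorm b ≤ W,
          A b * c (hammingNorm b) := by
        refine Finset.sum_le_sum fun b hb => mul_le_mul_of_nonneg_left ?_ (hA b)
        exact hc b (Finset.mem_filter.1 hb).2.1 (Finset.mem_filter.1 hb).2.2
    _ = ∑ w ∈ Finset.Icc 1 W, ∑ b : Λ → ZMod N with hammingNorm b = w, A b * c w := by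
        rw [← Finset.sum_fiberwise_of_maps_to (t := Finset.Icc 1 W)
          (g := fun b : Λ → ZMod N => hammingNorm b)
          (fun b hb => Finset.mem_Icc.2 (Finset.mem_filter.1 hb).2)]
        refine Finset.sum_congr rfl fun w hw => ?_
        refine Finset.sum_congr ?_ fun b hb => ?_
        · ext b
          simp only [Finset.mem_filter, Finset.mem_univ, true_and]
          refine ⟨fun h => h.2, fun h => ⟨?_, h⟩⟩
          rw [h]; exact Finset.mem_Icc.1 hw
        · rw [(Finset.mem_filter.1 hb).2]
    _ ≤ ∑ w ∈ Finset.Icc 1 W, K * (1 / 2) ^ w := by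
        refine Finset.sum_le_sum fun w hw => ?_
        obtain ⟨h1, h2⟩ := Finset.mem_Icc.1 hw
        rw [← Finset.sum_mul]
        exact (mul_le_mul_of_nonneg_right (hF w h1 h2) (hc0 w)).trans (hFc w h1 h2)
    _ ≤ K := by
        rw [← Finset.mul_sum]
        exact mul_le_of_le_one_right hK (sum_Icc_half_pow_le W)

/-- On average, touched labelings do not spoil the growth bound at a positive level. -/
theorem pmfMean_touchedMass_le_growthBound (hk : 1 ≤ k) (hN : 2 ≤ N) {U : KUniverse k Λ} {m : ℕ}
    (hm : 2 ^ 18 * N ^ (10 * k) * m ≤ U.card) (hm0 : 0 < m) {D : PMF ↥(U.matchings m)}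
    (hD : U.IsPseudoUniform D) {A : (Λ → ZMod N) → ℝ} (hA : ∀ b, 0 ≤ A b) {C s : ℝ} (hC : 1 ≤ C)
    (hCs : C ^ 2 * s ≤ U.card) {W d : ℕ} (hW : C ^ 2 * W ≤ U.card) (hd1 : 1 ≤ d) (hd : d ≤ W)
    (hF : ∀ w, 1 ≤ w → w ≤ W →
      ∑ b : Λ → ZMod N with hammingNorm b = w, A b ≤ growthBound C U.card w s) :
    pmfMean D (fun M => touchedMass A W d M.1) ≤ 16 ^ d * growthBound C U.card d s := by
  have hC0 : 0 ≤ C := by linarith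
  set n := U.card with hn
  have hWn : W ≤ n := by
    have : (W : ℝ) ≤ n := (le_mul_of_one_le_left (Nat.cast_nonneg W) (one_le_pow₀ hC)).trans hW
    exact_mod_cast this
  -- the scale at which the weight is traded against the growth bound
  set z : ℕ → ℝ := fun w => 8 * growthBase C n s (max w d) with hz
  have hvW : ∀ w, w ≤ W → max w d ≤ W := fun w hw => max_le hw hd
  have hz1 : ∀ w, w ≤ W → 1 ≤ z w := fun w hw => by
    have := one_le_growthBase (n := n) (s := s) hC (hd1.trans (le_max_right w d))
      ((hvW w hw).trans hWn)
    simp only [hz]; linarith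
  have hzw : ∀ w, w ≤ W → z w ^ 2 * w ≤ 64 * n := by
    intro w hw
    have hv0 : (0 : ℝ) < (max w d : ℕ) := by
      exact_mod_cast lt_of_lt_of_le hd1 (le_max_right w d)
    simp only [hz]
    rw [mul_pow, growthBase_sq hC0]
    set v : ℕ := max w d with hv
    have hwv : (w : ℝ) ≤ v := by exact_mod_cast le_max_left w d
    have h1 : C * √((n : ℝ) * max s (v : ℝ)) ≤ n := by
      have h2 : C ^ 2 * max s (v : ℝ) ≤ n := by
        rcases max_cases s (v : ℝ) with ⟨h, -⟩ | ⟨h, -⟩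
        · rw [h]; exact hCs
        · rw [h]
          have : (v : ℝ) ≤ W := by exact_mod_cast hvW w hw
          exact le_trans (by gcongr) hW
      calc C * √((n : ℝ) * max s (v : ℝ)) = √(C ^ 2 * ((n : ℝ) * max s (v : ℝ))) :=
            mul_sqrt_eq hC0 _
        _ ≤ √((n : ℝ) ^ 2) := by
            refine Real.sqrt_le_sqrt ?_
            nlinarith [Nat.cast_nonneg (α := ℝ) n]
        _ = n := Real.sqrt_sq (by positivity)
    calc (8 : ℝ) ^ 2 * (C * √((n : ℝ) * max s (v : ℝ)) / v) * w
        = 64 * (C * √((n : ℝ) * max s (v : ℝ))) * (w / v) := by ring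
      _ ≤ 64 * n * 1 := by
          gcongr
          rwa [div_le_one hv0]
      _ = 64 * n := by ring
  refine pmfMean_touchedMass_le hA (F := fun w => growthBound C n w s)
    (c := fun w => z w ^ d * 2 ^ w / z w ^ w) ?_ hF ?_ ?_ ?_
  · exact mul_nonneg (by positivity) (growthBound_nonneg hC0 _ _ _)
  · intro b _ hbW
    have hz0 : 0 < z (hammingNorm b) := by linarith [hz1 _ hbW]
    rw [le_div_iff₀ (by positivity)]
    exact pmfMean_card_touched_le hk hN hm hm0 hD b d (hz1 _ hbW) (hzw _ hbW)
  · intro w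
    have : 0 ≤ z w := mul_nonneg (by norm_num) (Real.sqrt_nonneg _)
    positivity
  · intro w hw1 hwW
    rw [growthBound_eq_pow hC0, growthBound_eq_pow hC0]
    have hzpos : 0 < z w := by linarith [hz1 w hwW]
    have h4 : (2 : ℝ) ^ w / 8 ^ w ≤ (1 / 2) ^ w := by
      rw [← div_pow]
      exact pow_le_pow_left₀ (by norm_num) (by norm_num) w
    have hbase : ∀ w, 0 ≤ growthBase C n s w := fun w => Real.sqrt_nonneg _
    rcases le_total d w with hdw | hwd
    · have hy : 0 < growthBase C n s w :=
        lt_of_lt_of_le one_pos (one_le_growthBase hC hw1 (hwW.trans hWn))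
      simp only [hz, max_eq_left hdw]
      calc growthBase C n s w ^ w * ((8 * growthBase C n s w) ^ d * 2 ^ w /
              (8 * growthBase C n s w) ^ w)
          = 8 ^ d * growthBase C n s w ^ d * (2 ^ w / 8 ^ w) := by
            rw [mul_pow, mul_pow]; field_simp
        _ ≤ 16 ^ d * growthBase C n s d ^ d * (1 / 2) ^ w := by
            have := growthBase_anti (n := n) (s := s) hC0 hd1 hdw
            gcongr
            · exact mul_nonneg (by positivity) (pow_nonneg (hbase _) _)
            · norm_num
    · have hy : 0 < growthBase C n s d :=
        lt_of_lt_of_le one_pos (one_le_growthBase hC hd1 (hd.trans hWn))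
      simp only [hz, max_eq_right hwd]
      calc growthBase C n s w ^ w * ((8 * growthBase C n s d) ^ d * 2 ^ w /
              (8 * growthBase C n s d) ^ w)
          ≤ (2 ^ d * growthBase C n s d ^ w) * ((8 * growthBase C n s d) ^ d * 2 ^ w /
              (8 * growthBase C n s d) ^ w) := by
            gcongr
            exact growthBase_pow_le hC0 hw1 hwd
        _ = (2 * 8) ^ d * growthBase C n s d ^ d * (2 ^ w / 8 ^ w) := by
            rw [mul_pow, mul_pow, mul_pow]; field_simp
        _ ≤ 16 ^ d * growthBase C n s d ^ d * (1 / 2) ^ w := by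
            gcongr
            norm_num

/-- On average, the coefficients of `f` that touched labelings cancel entirely have small mass. -/
theorem pmfMean_touchedMass_zero_le (hk : 1 ≤ k) (hN : 2 ≤ N) {U : KUniverse k Λ} {m : ℕ}
    (hm : 2 ^ 18 * N ^ (10 * k) * m ≤ U.card) (hm0 : 0 < m) {D : PMF ↥(U.matchings m)}
    (hD : U.IsPseudoUniform D) {A : (Λ → ZMod N) → ℝ} (hA : ∀ b, 0 ≤ A b) {C s δ : ℝ}
    (hC : 1 ≤ C) (hδ0 : 0 < δ) (hδ1 : δ ≤ 1) (hδs : (2 : ℝ) ^ (-s) ≤ δ / 2)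
    (hCs : C ^ 2 * s ≤ δ ^ 4 * U.card) {W : ℕ} (hW : C ^ 2 * W ≤ U.card)
    (hF : ∀ w, 1 ≤ w → w ≤ W →
      ∑ b : Λ → ZMod N with hammingNorm b = w, A b ≤ growthBound C U.card w s) :
    pmfMean D (fun M => touchedMass A W 0 M.1) ≤ δ / 2 := by
  have hC0 : 0 ≤ C := by linarith
  set n := U.card with hn
  have hWn : W ≤ n := by
    have : (W : ℝ) ≤ n := (le_mul_of_one_le_left (Nat.cast_nonneg W) (one_le_pow₀ hC)).trans hW
    exact_mod_cast this
  -- below the entropy deficit `s` there is room for an additional factor `1 / δ` in the scale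
  set ε : ℕ → ℝ := fun w => if (w : ℝ) ≤ s then δ else 1 with hε
  have hε0 : ∀ w, 0 < ε w := fun w => by simp only [hε]; split_ifs <;> simp [hδ0]
  have hε1 : ∀ w, ε w ≤ 1 := fun w => by simp only [hε]; split_ifs <;> simp [hδ1]
  set z : ℕ → ℝ := fun w => 8 * growthBase C n s w / ε w with hz
  have hbase1 : ∀ w, 1 ≤ w → w ≤ W → 1 ≤ growthBase C n s w := fun w h1 hw =>
    one_le_growthBase hC h1 (hw.trans hWn)
  have hz1 : ∀ w, 1 ≤ w → w ≤ W → 1 ≤ z w := fun w h1 hw => by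
    simp only [hz]
    rw [one_le_div (hε0 w)]
    linarith [hε1 w, hbase1 w h1 hw]
  have hzw : ∀ w, 1 ≤ w → w ≤ W → z w ^ 2 * w ≤ 64 * n := by
    intro w hw1 hw
    have hw0 : (0 : ℝ) < w := by exact_mod_cast hw1
    simp only [hz]
    rw [div_pow, mul_pow, growthBase_sq hC0]
    have h1 : C * √((n : ℝ) * max s (w : ℝ)) ≤ n * ε w ^ 2 := by
      have h2 : C ^ 2 * max s (w : ℝ) ≤ ε w ^ 4 * n := by
        simp only [hε]
        split_ifs with hws
        · rw [max_eq_left hws]; exact hCs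
        · rw [max_eq_right (not_le.1 hws).le, one_pow, one_mul]
          have : (w : ℝ) ≤ W := by exact_mod_cast hw
          exact le_trans (by gcongr) hW
      calc C * √((n : ℝ) * max s (w : ℝ)) = √(C ^ 2 * ((n : ℝ) * max s (w : ℝ))) :=
            mul_sqrt_eq hC0 _
        _ ≤ √(((n : ℝ) * ε w ^ 2) ^ 2) := by
            refine Real.sqrt_le_sqrt ?_
            nlinarith [Nat.cast_nonneg (α := ℝ) n]
        _ = n * ε w ^ 2 := Real.sqrt_sq (by positivity)
    have hεw := hε0 w
    calc (8 : ℝ) ^ 2 * (C * √((n : ℝ) * max s (w : ℝ)) / w) / ε w ^ 2 * w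
        = 64 * (C * √((n : ℝ) * max s (w : ℝ))) / ε w ^ 2 := by field_simp; ring
      _ ≤ 64 * (n * ε w ^ 2) / ε w ^ 2 := by gcongr
      _ = 64 * n := by field_simp
  refine pmfMean_touchedMass_le hA (F := fun w => growthBound C n w s)
    (c := fun w => 2 ^ w / z w ^ w) (by positivity) hF ?_ ?_ ?_
  · intro b hb1 hbW
    have hz0 : 0 < z (hammingNorm b) := by linarith [hz1 _ hb1 hbW]
    rw [le_div_iff₀ (by positivity)]
    have := pmfMean_card_touched_le hk hN hm hm0 hD b 0 (hz1 _ hb1 hbW) (hzw _ hb1 hbW)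
    simpa using this
  · intro w
    have : 0 ≤ z w := div_nonneg (mul_nonneg (by norm_num) (Real.sqrt_nonneg _)) (hε0 w).le
    positivity
  · intro w hw1 hwW
    have hy : 0 < growthBase C n s w := lt_of_lt_of_le one_pos (hbase1 w hw1 hwW)
    have hεw := hε0 w
    rw [growthBound_eq_pow hC0]
    have e1 : growthBase C n s w ^ w * (2 ^ w / z w ^ w) = ε w ^ w * (1 / 2) ^ w * (1 / 2) ^ w := by
      simp only [hz]
      have : (8 : ℝ) ^ w = 2 ^ w * 2 ^ w * 2 ^ w := by rw [← mul_pow, ← mul_pow]; norm_num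
      rw [div_pow, mul_pow, this, one_div, inv_pow]
      field_simp
    rw [e1]
    refine mul_le_mul_of_nonneg_right ?_ (by positivity)
    simp only [hε]
    split_ifs with hws
    · calc δ ^ w * (1 / 2) ^ w ≤ δ ^ 1 * (1 / 2) ^ 1 := by
            gcongr ?_ * ?_
            · exact pow_le_pow_of_le_one hδ0.le hδ1 hw1
            · exact pow_le_pow_of_le_one (by norm_num) (by norm_num) hw1
        _ = δ / 2 := by ring
    · rw [one_pow, one_mul]
      refine le_trans ?_ hδs
      rw [one_div, inv_pow, ← Real.rpow_natCast, ← Real.rpow_neg (by norm_num)]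
      exact Real.rpow_le_rpow_of_exponent_le (by norm_num) (by linarith [not_le.1 hws])

end SmallWeights

end LabeledMatching

/-! ### Vectors of large weight -/

namespace LabeledMatching

noncomputable section LargeWeights

variable {k N : ℕ} [NeZero N] {Λ : Type*} [Fintype Λ] [DecidableEq Λ]

/-- The number of vectors of weight `d`, bounded through the generating function of the weight. -/
theorem card_level_mul_le (d : ℕ) {ω : ℝ} (hω : 0 ≤ ω) (hL : 0 < Fintype.card Λ) :
    ((Finset.univ.filter fun a : Λ → ZMod N => hammingNorm a = d).card : ℝ) * ω ^ d
      ≤ Real.exp ω * (N * Fintype.card Λ) ^ d := by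
  have hN : (0 : ℝ) < N := by exact_mod_cast Nat.pos_of_ne_zero (NeZero.ne N)
  have hL' : (0 : ℝ) < Fintype.card Λ := by exact_mod_cast hL
  set y : ℝ := ω / (N * Fintype.card Λ) with hy
  have hy0 : 0 ≤ y := by positivity
  have h1 := sum_pow_hammingNorm_le (ι := Λ) (Y := ZMod N) hy0
  rw [ZMod.card] at h1
  have h2 : (Fintype.card Λ : ℝ) * N * y = ω := by rw [hy]; field_simp
  rw [h2] at h1
  have h3 : ((Finset.univ.filter fun a : Λ → ZMod N => hammingNorm a = d).card : ℝ) * y ^ d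
      ≤ Real.exp ω := by
    refine le_trans ?_ h1
    calc _ = ∑ a : Λ → ZMod N with hammingNorm a = d, y ^ hammingNorm a := by
          rw [← nsmul_eq_mul, ← Finset.sum_const]
          exact Finset.sum_congr rfl fun a ha => by rw [(Finset.mem_filter.1 ha).2]
      _ ≤ _ := Finset.sum_le_sum_of_subset_of_nonneg (Finset.filter_subset _ _)
          fun _ _ _ => by positivity
  have h4 : ω = y * (N * Fintype.card Λ) := by rw [hy]; field_simp
  conv_lhs => rw [h4, mul_pow, ← mul_assoc]
  gcongr

theorem exp_quarter_mul_exp_le (ω : ℕ) : Real.exp (ω / 4) * Real.exp ω ≤ 4 ^ ω := by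
  rw [← Real.exp_add]
  have h1 : (ω : ℝ) / 4 + ω = ω * (5 / 4) := by ring
  rw [h1, Real.exp_nat_mul]
  gcongr
  refine (pow_le_pow_iff_left₀ (Real.exp_pos _).le (by norm_num) four_ne_zero).1 ?_
  rw [← Real.exp_nat_mul]
  have h2 : ((4 : ℕ) : ℝ) * (5 / 4) = (5 : ℕ) * 1 := by norm_num
  rw [h2, Real.exp_nat_mul]
  calc Real.exp 1 ^ 5 ≤ 3 ^ 5 := by
        gcongr
        linarith [Real.exp_one_lt_d9]
    _ ≤ 4 ^ 4 := by norm_num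

theorem two_rpow_mul_pow_le {N d ω : ℕ} {s : ℝ} (hs : 4 * s + (4 + N) * d ≤ ω) :
    (2 : ℝ) ^ (4 * s) * (16 * N) ^ d ≤ 2 ^ ω := by
  have h1 : (N : ℝ) ^ d ≤ 2 ^ (N * d) := by
    rw [pow_mul]
    gcongr
    exact_mod_cast Nat.lt_two_pow_self.le
  calc (2 : ℝ) ^ (4 * s) * (16 * N) ^ d ≤ 2 ^ (4 * s) * (2 ^ (4 * d) * 2 ^ (N * d)) := by
        rw [mul_pow, pow_mul]
        gcongr
        norm_num
    _ = (2 : ℝ) ^ (4 * s + (4 + N) * d) := by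
        rw [← pow_add, ← Real.rpow_natCast, ← Real.rpow_add (by norm_num)]
        congr 1
        push_cast
        ring
    _ ≤ (2 : ℝ) ^ (ω : ℝ) := Real.rpow_le_rpow_of_exponent_le (by norm_num) hs
    _ = 2 ^ ω := Real.rpow_natCast _ _

set_option maxHeartbeats 1000000 in
/-- A vector of weight larger than `d` by a large factor has, on average, very few labelings that
bring its weight down to `d`: few enough to pay for all vectors of weight `d` and for a power
of `2 ^ s`. -/
theorem pmfMean_card_reweightings_large_le (hk : 1 ≤ k) (hN : 2 ≤ N) {U : KUniverse k Λ} {m : ℕ}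
    (hm : 2 ^ 18 * N ^ (10 * k) * (m * Fintype.card Λ ^ 2) ≤ U.card ^ 3) (hm0 : 0 < m)
    (hUL : U.card ≤ Fintype.card Λ) {D : PMF ↥(U.matchings m)} (hD : U.IsPseudoUniform D)
    (b : Λ → ZMod N) (d : ℕ) {s : ℝ} {ω : ℕ} (hω : ω = min (hammingNorm b) U.card) (hω1 : 1 ≤ ω)
    (hs : 4 * s + (4 + N) * d ≤ ω) (hd : (2 * k + 1) * d ≤ ω) :
    pmfMean D (fun M => ((reweightings Set.univ b d M.1).card : ℝ)) *
      ((2 : ℝ) ^ (4 * s) * 2 ^ d *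
        (Finset.univ.filter fun a : Λ → ZMod N => hammingNorm a = d).card) ≤ 1 := by
  classical
  have hU : 0 < U.card := by
    have : ω ≤ U.card := hω ▸ min_le_right _ _
    omega
  have hL : 0 < Fintype.card Λ := hU.trans_le hUL
  have hn : (0 : ℝ) < U.card := by exact_mod_cast hU
  have hLR : (0 : ℝ) < Fintype.card Λ := by exact_mod_cast hL
  have hωR : (0 : ℝ) < ω := by exact_mod_cast hω1
  have hkR : (0 : ℝ) < k := by exact_mod_cast hk
  have hnum := mul_pow_le_of_le hN hm
  have h65 : 1 ≤ 65 ^ k := Nat.one_le_pow _ _ (by norm_num)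
  have hNk : 1 ≤ N ^ k := Nat.one_le_pow _ _ (by omega)
  have hnumL : 64 * (k * N ^ k * 65 ^ k) * m * Fintype.card Λ ≤ U.card ^ 2 := by
    refine Nat.le_of_mul_le_mul_right (c := U.card) ?_ hU
    calc 64 * (k * N ^ k * 65 ^ k) * m * Fintype.card Λ * U.card
        ≤ 64 * (k * N ^ k * 65 ^ k) * m * Fintype.card Λ * Fintype.card Λ := by gcongr
      _ = 64 * (k * N ^ k * 65 ^ k) * (m * Fintype.card Λ ^ 2) := by ring
      _ ≤ U.card ^ 3 := hnum
      _ = U.card ^ 2 * U.card := by ring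
  have hnum1 : 64 * (k * N ^ k * 65 ^ k) * m ≤ U.card := by
    refine Nat.le_of_mul_le_mul_right (c := U.card) ?_ hU
    calc 64 * (k * N ^ k * 65 ^ k) * m * U.card
        ≤ 64 * (k * N ^ k * 65 ^ k) * m * Fintype.card Λ := by gcongr
      _ ≤ U.card ^ 2 := hnumL
      _ = U.card * U.card := by ring
  have hm2 : 2 * k * m ≤ U.card := by
    refine le_trans ?_ hnum1
    have : k * 1 * 1 ≤ k * N ^ k * 65 ^ k := by gcongr
    nlinarith
  set n : ℝ := (U.card : ℝ) with hndef
  set L : ℝ := (Fintype.card Λ : ℝ) with hLdef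
  have hnL : n ≤ L := by rw [hndef, hLdef]; exact_mod_cast hUL
  have hωn : (ω : ℝ) ≤ n := by
    rw [hndef]; exact_mod_cast (hω ▸ min_le_right _ _ : ω ≤ U.card)
  have hωb : ω ≤ hammingNorm b := hω ▸ min_le_left _ _
  -- the scale `z = 8 ρ p`, where `p` pays for the vertices outside the universe
  set ρ : ℝ := √(n / ω) with hρ
  set p : ℝ := (L / n) ^ ((2 * k : ℝ)⁻¹) with hp
  have hρ1 : 1 ≤ ρ := by rw [hρ, Real.one_le_sqrt, one_le_div hωR]; exact hωn
  have hp1 : 1 ≤ p := Real.one_le_rpow ((one_le_div hn).2 hnL) (by positivity)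
  have hρ2 : ρ ^ 2 = n / ω := Real.sq_sqrt (by positivity)
  have hp2 : p ^ (2 * k) = L / n := by
    rw [hp, ← Real.rpow_natCast, ← Real.rpow_mul (by positivity)]
    push_cast
    rw [inv_mul_cancel₀ (by positivity), Real.rpow_one]
  set z : ℝ := 8 * ρ * p with hz
  have hz1 : 1 ≤ z := by
    have : 1 ≤ ρ * p := one_le_mul_of_one_le_of_one_le hρ1 hp1
    rw [hz, mul_assoc]; linarith
  have hz0 : 0 < z := by linarith
  have hp0 : 0 < p := by linarith
  have hρ0 : 0 < ρ := by linarith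
  have hz2 : z ^ 2 * ω = 64 * n * p ^ 2 := by
    rw [hz, mul_pow, mul_pow, hρ2]; field_simp; norm_num
  have hmain := pmfMean_card_reweightings_mul_le hk hm2 hU hD Set.univ b d hz1
  have hsum := sum_pow_restrictEdge_le U b (Z := z ^ 2) (ω := ω) (by positivity) fun i => by
    have h1 := card_part_support_le U b i
    have h2 : ((U.parts i).filter fun v => b v ≠ 0).card ≤ U.card :=
      (Finset.card_filter_le _ _).trans (U.card_parts i).le
    have h3 := le_min h1 h2
    rw [← hω] at h3
    exact_mod_cast h3
  have hexp : 4 * m / n ^ k * ((N : ℝ) ^ k * ((z ^ 2)⁻¹ *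
      ∑ e ∈ Fintype.piFinset U.parts with e ∈ Set.univ,
        (z ^ 2) ^ hammingNorm (restrictEdge b e))) ≤ ω / 4 := by
    have hfil : (Fintype.piFinset U.parts).filter (fun e => e ∈ Set.univ)
        = Fintype.piFinset U.parts := Finset.filter_true_of_mem fun _ _ => Set.mem_univ _
    rw [hfil]
    have hS : ∑ e ∈ Fintype.piFinset U.parts, (z ^ 2) ^ hammingNorm (restrictEdge b e)
        ≤ 65 ^ k * n ^ k * (L / n) := by
      refine hsum.trans ?_
      rw [hz2, ← hp2, pow_mul, ← mul_pow, ← mul_pow]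
      have : 1 ≤ p ^ 2 := one_le_pow₀ hp1
      gcongr
      nlinarith
    have hzinv : (z ^ 2)⁻¹ ≤ ω / (64 * n) := by
      rw [inv_le_comm₀ (by positivity) (by positivity), inv_div, div_le_iff₀ hωR, hz2]
      have : 1 ≤ p ^ 2 := one_le_pow₀ hp1
      nlinarith
    have hnumR : 64 * ((k : ℝ) * (N : ℝ) ^ k * 65 ^ k) * m * L ≤ n ^ 2 := by
      rw [hndef, hLdef]; exact_mod_cast hnumL
    have hk1 : (1 : ℝ) ≤ k := by exact_mod_cast hk
    calc _ ≤ 4 * m / n ^ k * ((N : ℝ) ^ k * (ω / (64 * n) * (65 ^ k * n ^ k * (L / n)))) := by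
          gcongr
      _ = (1 * (N : ℝ) ^ k * 65 ^ k * m * L) / n ^ 2 * (ω / 16) := by
          field_simp; norm_num
      _ ≤ (k * (N : ℝ) ^ k * 65 ^ k * m * L) / n ^ 2 * (ω / 16) := by gcongr
      _ ≤ 1 * (ω / 16) := by
          refine mul_le_mul_of_nonneg_right ?_ (by positivity)
          rw [div_le_one (by positivity)]
          have : 0 ≤ k * (N : ℝ) ^ k * 65 ^ k * m * L := by positivity
          linarith
      _ ≤ ω / 4 := by linarith
  set X := pmfMean D (fun M => ((reweightings Set.univ b d M.1).card : ℝ)) with hX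
  have hX0 : 0 ≤ X := Finset.sum_nonneg fun M _ =>
    mul_nonneg ENNReal.toReal_nonneg (Nat.cast_nonneg _)
  have hXz : X * z ^ ω ≤ z ^ d * Real.exp (ω / 4) :=
    calc X * z ^ ω ≤ X * z ^ hammingNorm b := by gcongr
      _ ≤ _ := hmain
      _ ≤ _ := by gcongr
  set a := (Finset.univ.filter fun a : Λ → ZMod N => hammingNorm a = d).card with ha
  have hcount : (a : ℝ) ≤ Real.exp ω * (N * p ^ (2 * k) * ρ ^ 2) ^ d := by
    have h1 := card_level_mul_le (N := N) (Λ := Λ) d hωR.le hL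
    rw [← le_div_iff₀ (by positivity), mul_div_assoc, ← div_pow] at h1
    refine h1.trans (le_of_eq ?_)
    rw [hp2, hρ2]
    congr 2
    field_simp
    rfl
  have hexp4 := exp_quarter_mul_exp_le ω
  have htwo := two_rpow_mul_pow_le (N := N) hs
  have hρω : ρ ^ (3 * d) ≤ ρ ^ ω := pow_le_pow_right₀ hρ1 (by nlinarith)
  have hpω : p ^ ((2 * k + 1) * d) ≤ p ^ ω := pow_le_pow_right₀ hp1 hd
  have hfinal : z ^ d * Real.exp (ω / 4) * ((2 : ℝ) ^ (4 * s) * 2 ^ d * a) ≤ z ^ ω := by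
    calc z ^ d * Real.exp (ω / 4) * ((2 : ℝ) ^ (4 * s) * 2 ^ d * a)
        ≤ z ^ d * Real.exp (ω / 4) * ((2 : ℝ) ^ (4 * s) * 2 ^ d *
            (Real.exp ω * (N * p ^ (2 * k) * ρ ^ 2) ^ d)) := by gcongr
      _ = (Real.exp (ω / 4) * Real.exp ω) * ((2 : ℝ) ^ (4 * s) * (16 * N) ^ d) *
            ρ ^ (3 * d) * p ^ ((2 * k + 1) * d) := by
          have e16 : (16 : ℝ) ^ d = 8 ^ d * 2 ^ d := by rw [← mul_pow]; norm_num
          rw [hz]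
          simp only [mul_pow]
          rw [e16, pow_mul ρ, pow_mul p ((2 * k + 1)), pow_succ p (2 * k), mul_pow (p ^ (2 * k)),
            show ρ ^ 3 = ρ ^ 2 * ρ by ring, mul_pow (ρ ^ 2)]
          ring
      _ ≤ 4 ^ ω * 2 ^ ω * ρ ^ ω * p ^ ω := by gcongr
      _ = z ^ ω := by
          rw [hz, mul_pow, mul_pow, ← mul_pow 4 2]; norm_num
  have hzω : 0 < z ^ ω := by positivity
  refine le_of_mul_le_mul_right (a := z ^ ω) ?_ hzω
  calc X * ((2 : ℝ) ^ (4 * s) * 2 ^ d * a) * z ^ ω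
      = X * z ^ ω * ((2 : ℝ) ^ (4 * s) * 2 ^ d * a) := by ring
    _ ≤ z ^ d * Real.exp (ω / 4) * ((2 : ℝ) ^ (4 * s) * 2 ^ d * a) := by gcongr
    _ ≤ 1 * z ^ ω := by rw [one_mul]; exact hfinal

end LargeWeights

end LabeledMatching

/-! ### Touched and untouched parts of a labeling -/

namespace LabeledMatching

noncomputable section Splitting

variable {k N : ℕ} [NeZero N] {Λ : Type*} [Fintype Λ] [DecidableEq Λ] {M : Finset (Fin k → Λ)}

/-- The number of nonzero labels, over all edges and all positions within them. -/
def totalWeight (γ : Labeling N M) : ℕ := ∑ e, hammingNorm (γ e)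

omit [NeZero N] [Fintype Λ] [DecidableEq Λ] in
theorem two_mul_hammingNorm_le_totalWeight {γ : Labeling N M} (hγ : NoSingleton γ) :
    2 * hammingNorm γ ≤ totalWeight γ := by
  rw [hammingNorm, Finset.card_filter, Finset.mul_sum, totalWeight]
  refine Finset.sum_le_sum fun e _ => ?_
  by_cases he : γ e = 0
  · simp [he]
  · have h1 : hammingNorm (γ e) ≠ 0 := by rwa [Ne, hammingNorm_eq_zero]
    have h2 := hγ e
    simp only [ne_eq, he, not_false_eq_true, if_true]
    omega

/-- The part of a labeling on the edges that meet the support of `b`. -/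
def touchedPart (b : Λ → ZMod N) (γ : Labeling N M) : Labeling N M :=
  fun e => if restrictEdge b e.1 = 0 then 0 else γ e

omit [NeZero N] in
/-- Labels on edges that avoid the support of `b` add their full weight. -/
theorem hammingNorm_add_eq_touchedPart {U : KUniverse k Λ} {m : ℕ} (hM : M ∈ U.matchings m)
    (b : Λ → ZMod N) (γ : Labeling N M) :
    hammingNorm (b + extendLabeling γ)
      = hammingNorm (b + extendLabeling (touchedPart b γ)) + totalWeight (γ - touchedPart b γ) := by
  have h1 := hammingNorm_add_extendLabeling hM b γ
  have h2 := hammingNorm_add_extendLabeling hM b (touchedPart b γ)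
  have h3 : ∑ e : ↥M, hammingNorm (restrictEdge b e.1 + γ e)
      = ∑ e : ↥M, hammingNorm (restrictEdge b e.1 + touchedPart b γ e)
        + totalWeight (γ - touchedPart b γ) := by
    rw [totalWeight, ← Finset.sum_add_distrib]
    refine Finset.sum_congr rfl fun e _ => ?_
    by_cases h : restrictEdge b e.1 = 0 <;> simp [touchedPart, h]
  omega

omit [NeZero N] [Fintype Λ] [DecidableEq Λ] in
theorem noSingleton_touchedPart {γ : Labeling N M} (hγ : NoSingleton γ) (b : Λ → ZMod N) :
    NoSingleton (touchedPart b γ) := by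
  intro e
  by_cases h : restrictEdge b e.1 = 0
  · simp [touchedPart, h]
  · simpa [touchedPart, h] using hγ e

omit [NeZero N] [Fintype Λ] [DecidableEq Λ] in
theorem noSingleton_sub_touchedPart {γ : Labeling N M} (hγ : NoSingleton γ) (b : Λ → ZMod N) :
    NoSingleton (γ - touchedPart b γ) := by
  intro e
  by_cases h : restrictEdge b e.1 = 0
  · simpa [touchedPart, h] using hγ e
  · simp [touchedPart, h]

open Classical in
/-- For a fixed `b`, a labeling splits into its touched part, which is counted, and its untouched
part, over which the coefficients `Φ` are summed. -/
theorem sum_reaching_le {U : KUniverse k Λ} {m : ℕ} (hM : M ∈ U.matchings m)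
    {Φ : Labeling N M → ℝ} (hΦ : ∀ γ, 0 ≤ Φ γ) {G : ℕ → ℝ} {d : ℕ}
    (hB : ∀ γ₁ : Labeling N M, ∀ d₂ ≤ d,
      ∑ γ₂ : Labeling N M with NoSingleton γ₂ ∧ totalWeight γ₂ = d₂, Φ (γ₁ + γ₂) ≤ G d₂)
    (b : Λ → ZMod N) :
    ∑ γ : Labeling N M with NoSingleton γ ∧ hammingNorm (b + extendLabeling γ) = d, Φ γ
      ≤ ∑ d₁ ∈ Finset.range (d + 1),
          ((reweightings {e | restrictEdge b e ≠ 0} b d₁ M).card : ℝ) * G (d - d₁) := by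
  set Γ := Finset.univ.filter fun γ : Labeling N M =>
    NoSingleton γ ∧ hammingNorm (b + extendLabeling γ) = d with hΓ
  set P : ℕ → Finset (Labeling N M) := fun d₂ => Finset.univ.filter fun γ : Labeling N M =>
    NoSingleton γ ∧ totalWeight γ = d₂ with hP
  set S : Finset ((_ : ℕ) × (Labeling N M × Labeling N M)) := (Finset.range (d + 1)).sigma
    fun d₁ => reweightings {e | restrictEdge b e ≠ 0} b d₁ M ×ˢ P (d - d₁) with hS
  set split : Labeling N M → (_ : ℕ) × (Labeling N M × Labeling N M) := fun γ =>
    ⟨hammingNorm (b + extendLabeling (touchedPart b γ)),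
      (touchedPart b γ, γ - touchedPart b γ)⟩ with hsplit
  have hadd : ∀ γ, (split γ).2.1 + (split γ).2.2 = γ := fun γ => add_sub_cancel _ _
  have hinj : Set.InjOn split Γ := by
    intro γ _ γ' _ h
    rw [← hadd γ, h, hadd γ']
  have hmem : Γ.image split ⊆ S := by
    intro q hq
    obtain ⟨γ, hγ, rfl⟩ := Finset.mem_image.1 hq
    obtain ⟨-, hγ1, hγ2⟩ := Finset.mem_filter.1 hγ
    have h1 := hammingNorm_add_eq_touchedPart hM b γ
    rw [hγ2] at h1
    refine Finset.mem_sigma.2 ⟨?_, Finset.mem_product.2 ⟨?_, ?_⟩⟩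
    · simp only [hsplit, Finset.mem_range]; omega
    · refine mem_reweightings.2 ⟨noSingleton_touchedPart hγ1 b, ?_, rfl⟩
      intro e he h0
      exact he (by simp only [hsplit, touchedPart, h0, if_true])
    · refine Finset.mem_filter.2 ⟨Finset.mem_univ _, noSingleton_sub_touchedPart hγ1 b, ?_⟩
      simp only [hsplit]; omega
  calc ∑ γ ∈ Γ, Φ γ = ∑ q ∈ Γ.image split, Φ (q.2.1 + q.2.2) := by
        rw [Finset.sum_image hinj]
        exact Finset.sum_congr rfl fun γ _ => by rw [hadd]
    _ ≤ ∑ q ∈ S, Φ (q.2.1 + q.2.2) :=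
        Finset.sum_le_sum_of_subset_of_nonneg hmem fun _ _ _ => hΦ _
    _ = ∑ d₁ ∈ Finset.range (d + 1), ∑ γ₁ ∈ reweightings {e | restrictEdge b e ≠ 0} b d₁ M,
          ∑ γ₂ ∈ P (d - d₁), Φ (γ₁ + γ₂) := by
        rw [hS, Finset.sum_sigma]
        exact Finset.sum_congr rfl fun d₁ _ => Finset.sum_product _ _ _
    _ ≤ _ := by
        refine Finset.sum_le_sum fun d₁ _ => ?_
        rw [← nsmul_eq_mul, ← Finset.sum_const]
        exact Finset.sum_le_sum fun γ₁ _ => hB γ₁ _ (Nat.sub_le _ _)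

theorem card_reweightings_zero_le (d : ℕ) :
    (reweightings {e | restrictEdge (0 : Λ → ZMod N) e ≠ 0} (0 : Λ → ZMod N) d M).card
      ≤ if d = 0 then 1 else 0 := by
  have h : ∀ γ ∈ reweightings {e | restrictEdge (0 : Λ → ZMod N) e ≠ 0} (0 : Λ → ZMod N) d M,
      γ = 0 ∧ d = 0 := by
    intro γ hγ
    obtain ⟨-, h1, h2⟩ := mem_reweightings.1 hγ
    have h0 : γ = 0 := by
      funext e
      by_contra he
      exact h1 e he rfl
    subst h0
    rw [extendLabeling_zero, add_zero, hammingNorm_zero] at h2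
    exact ⟨rfl, h2.symm⟩
  split_ifs with hd
  · exact Finset.card_le_one.2 fun γ hγ γ' hγ' => (h γ hγ).1.trans (h γ' hγ').1.symm
  · exact le_of_eq (Finset.card_eq_zero.2
      (Finset.eq_empty_of_forall_notMem fun γ hγ => hd (h γ hγ).2))

open Classical in
/-- The contribution of vectors `b` of weight at most `W` to level `d` is at most a convolution of
touched masses with the coefficient sums `G` of the untouched parts. The vector `b = 0` is touched
by no edge and appears only at level `0`. -/
theorem sum_smallWeight_le {U : KUniverse k Λ} {m : ℕ} (hM : M ∈ U.matchings m)
    {Φ : Labeling N M → ℝ} (hΦ : ∀ γ, 0 ≤ Φ γ) {A : (Λ → ZMod N) → ℝ} (hA : ∀ b, 0 ≤ A b)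
    {G : ℕ → ℝ} (hG : ∀ d, 0 ≤ G d) {d W : ℕ}
    (hB : ∀ γ₁ : Labeling N M, ∀ d₂ ≤ d,
      ∑ γ₂ : Labeling N M with NoSingleton γ₂ ∧ totalWeight γ₂ = d₂, Φ (γ₁ + γ₂) ≤ G d₂) :
    ∑ γ : Labeling N M with NoSingleton γ, Φ γ *
        ∑ b : Λ → ZMod N with hammingNorm (b + extendLabeling γ) = d ∧ hammingNorm b ≤ W, A b
      ≤ ∑ d₁ ∈ Finset.range (d + 1),
          ((if d₁ = 0 then A 0 else 0) + touchedMass A W d₁ M) * G (d - d₁) := by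
  have hb0 : ∀ b : Λ → ZMod N, hammingNorm b = 0 ↔ b = 0 := fun b => hammingNorm_eq_zero
  calc ∑ γ : Labeling N M with NoSingleton γ, Φ γ *
        ∑ b : Λ → ZMod N with hammingNorm (b + extendLabeling γ) = d ∧ hammingNorm b ≤ W, A b
      = ∑ b : Λ → ZMod N with hammingNorm b ≤ W, A b * ∑ γ : Labeling N M
          with NoSingleton γ ∧ hammingNorm (b + extendLabeling γ) = d, Φ γ := by
        simp_rw [Finset.mul_sum]
        rw [Finset.sum_comm' (t' := Finset.univ.filter fun b : Λ → ZMod N => hammingNorm b ≤ W)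
          (s' := fun b => Finset.univ.filter fun γ : Labeling N M =>
            NoSingleton γ ∧ hammingNorm (b + extendLabeling γ) = d)]
        · exact Finset.sum_congr rfl fun _ _ => Finset.sum_congr rfl fun _ _ => mul_comm _ _
        · intro γ b
          simp only [Finset.mem_filter, Finset.mem_univ, true_and]
          tauto
    _ ≤ ∑ b : Λ → ZMod N with hammingNorm b ≤ W, A b * ∑ d₁ ∈ Finset.range (d + 1),
          ((reweightings {e | restrictEdge b e ≠ 0} b d₁ M).card : ℝ) * G (d - d₁) :=
        Finset.sum_le_sum fun b _ =>
          mul_le_mul_of_nonneg_left (sum_reaching_le hM hΦ hB b) (hA b)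
    _ = ∑ d₁ ∈ Finset.range (d + 1), (∑ b : Λ → ZMod N with hammingNorm b ≤ W, A b *
          (reweightings {e | restrictEdge b e ≠ 0} b d₁ M).card) * G (d - d₁) := by
        simp_rw [Finset.mul_sum, Finset.sum_mul]
        rw [Finset.sum_comm]
        exact Finset.sum_congr rfl fun _ _ => Finset.sum_congr rfl fun _ _ => by ring
    _ ≤ _ := by
        refine Finset.sum_le_sum fun d₁ _ => mul_le_mul_of_nonneg_right ?_ (hG _)
        have hsplit : (Finset.univ.filter fun b : Λ → ZMod N => hammingNorm b ≤ W)
            = insert 0 (Finset.univ.filter fun b : Λ → ZMod N =>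
                1 ≤ hammingNorm b ∧ hammingNorm b ≤ W) := by
          ext b
          simp only [Finset.mem_filter, Finset.mem_univ, true_and, Finset.mem_insert, ← hb0]
          omega
        rw [hsplit, Finset.sum_insert (by simp), touchedMass]
        refine add_le_add ?_ (le_of_eq ?_)
        · have h := card_reweightings_zero_le (N := N) (M := M) d₁
          split_ifs with h0
          · rw [if_pos h0] at h
            have h' : ((reweightings {e | restrictEdge (0 : Λ → ZMod N) e ≠ 0}
                (0 : Λ → ZMod N) d₁ M).card : ℝ)
              ≤ 1 := by exact_mod_cast h
            exact mul_le_of_le_one_right (hA 0) h'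
          · rw [if_neg h0, Nat.le_zero] at h
            rw [h]; simp
        · exact Finset.sum_congr rfl fun b _ => rfl

/-- The squared coefficient mass `A` that labelings move from weights above `W` to level `d`. -/
def largeMass (A : (Λ → ZMod N) → ℝ) (W d : ℕ) (M : Finset (Fin k → Λ)) : ℝ :=
  ∑ b : Λ → ZMod N with W < hammingNorm b, A b ^ 2 * (reweightings Set.univ b d M).card

open Classical in
/-- The contribution of vectors `b` of weight above `W` to level `d`, by the Cauchy-Schwarz
inequality: a labeling and the vector of weight `d` that it leads to determine `b`. -/
theorem sum_largeWeight_le (Φ : Labeling N M → ℝ) (A : (Λ → ZMod N) → ℝ) (d W : ℕ) :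
    ∑ γ : Labeling N M with NoSingleton γ, Φ γ *
        ∑ b : Λ → ZMod N with hammingNorm (b + extendLabeling γ) = d ∧ W < hammingNorm b, A b
      ≤ √((∑ γ, Φ γ ^ 2) *
          (Finset.univ.filter fun a : Λ → ZMod N => hammingNorm a = d).card *
            largeMass A W d M) := by
  refine Real.le_sqrt_of_sq_le ?_
  set S : Finset ((_ : Labeling N M) × (Λ → ZMod N)) :=
    (Finset.univ.filter fun γ : Labeling N M => NoSingleton γ).sigma fun γ =>
      Finset.univ.filter fun b : Λ → ZMod N =>
        hammingNorm (b + extendLabeling γ) = d ∧ W < hammingNorm b with hS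
  have h1 : ∑ γ : Labeling N M with NoSingleton γ, Φ γ *
        ∑ b : Λ → ZMod N with hammingNorm (b + extendLabeling γ) = d ∧ W < hammingNorm b, A b
      = ∑ q ∈ S, Φ q.1 * A q.2 := by
    rw [hS, Finset.sum_sigma]
    exact Finset.sum_congr rfl fun γ _ => Finset.mul_sum _ _ _
  have h2 : ∑ q ∈ S, Φ q.1 ^ 2 ≤ (∑ γ, Φ γ ^ 2) *
      (Finset.univ.filter fun a : Λ → ZMod N => hammingNorm a = d).card := by
    rw [hS, Finset.sum_sigma, Finset.sum_mul]
    refine le_trans ?_ (Finset.sum_le_sum_of_subset_of_nonneg (Finset.filter_subset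
      (fun γ : Labeling N M => NoSingleton γ) _) fun _ _ _ => by positivity)
    refine Finset.sum_le_sum fun γ _ => ?_
    simp only [Finset.sum_const, nsmul_eq_mul]
    rw [mul_comm]
    refine mul_le_mul_of_nonneg_left ?_ (sq_nonneg _)
    rw [Nat.cast_le]
    refine Finset.card_le_card_of_injOn (fun b => b + extendLabeling γ) (fun b hb => ?_)
      fun _ _ _ _ h => add_right_cancel h
    simpa using (Finset.mem_filter.1 hb).2.1
  have h3 : ∑ q ∈ S, A q.2 ^ 2 = largeMass A W d M := by
    rw [hS, Finset.sum_sigma, largeMass]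
    rw [Finset.sum_comm' (t' := Finset.univ.filter fun b : Λ → ZMod N => W < hammingNorm b)
      (s' := fun b => reweightings Set.univ b d M)]
    · refine Finset.sum_congr rfl fun b _ => ?_
      simp only [Finset.sum_const, nsmul_eq_mul, mul_comm]
    · intro γ b
      simp only [Finset.mem_filter, Finset.mem_univ, true_and, mem_reweightings, Set.mem_univ,
        implies_true]
      tauto
  rw [h1]
  calc (∑ q ∈ S, Φ q.1 * A q.2) ^ 2 ≤ (∑ q ∈ S, Φ q.1 ^ 2) * ∑ q ∈ S, A q.2 ^ 2 :=
        Finset.sum_mul_sq_le_sq_mul_sq _ _ _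
    _ ≤ _ := by
        rw [h3]
        refine mul_le_mul_of_nonneg_right h2 ?_
        exact Finset.sum_nonneg fun b _ => by positivity

theorem pmfMean_largeMass_mul_le {U : KUniverse k Λ} {m : ℕ} {D : PMF ↥(U.matchings m)}
    {A : (Λ → ZMod N) → ℝ} {W d : ℕ} {T : ℝ}
    (hc : ∀ b : Λ → ZMod N, W < hammingNorm b →
      pmfMean D (fun M => ((reweightings Set.univ b d M.1).card : ℝ)) * T ≤ 1) :
    pmfMean D (fun M => largeMass A W d M.1) * T ≤ ∑ b, A b ^ 2 := by
  simp only [largeMass]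
  rw [pmfMean_sum]
  simp_rw [pmfMean_const_mul]
  rw [Finset.sum_mul]
  refine le_trans ?_ (Finset.sum_le_sum_of_subset_of_nonneg (Finset.filter_subset
    (fun b : Λ → ZMod N => W < hammingNorm b) _) fun _ _ _ => sq_nonneg _)
  refine Finset.sum_le_sum fun b hb => ?_
  rw [mul_assoc]
  exact mul_le_of_le_one_right (sq_nonneg _) (hc b (Finset.mem_filter.1 hb).2)

end Splitting

noncomputable section GrowthComparison

theorem growthBase_sq_mul {C K : ℝ} (hK : 0 ≤ K) (n : ℕ) (s : ℝ) (d : ℕ) :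
    growthBase (K ^ 2 * C) n s d = K * growthBase C n s d := by
  rw [growthBase, growthBase, mul_sqrt_eq hK]
  congr 1
  ring

theorem growthBase_mono_left {C C' : ℝ} (hC : C ≤ C') (n : ℕ) (s : ℝ) (d : ℕ) :
    growthBase C n s d ≤ growthBase C' n s d := by
  unfold growthBase
  gcongr

theorem growthBase_mono_right {C : ℝ} (hC : 0 ≤ C) (n : ℕ) {s s' : ℝ} (hs : s ≤ s') (d : ℕ) :
    growthBase C n s d ≤ growthBase C n s' d := by
  unfold growthBase
  gcongr

/-- The growth bound is submultiplicative in the level, up to constants per level. -/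
theorem growthBound_mul_le {C K : ℝ} (hC : 1 ≤ C) (hK : 1 ≤ K) {n d₁ d₂ : ℕ} {s : ℝ} :
    growthBound C n d₁ s * growthBound K n d₂ s
      ≤ 4 ^ (d₁ + d₂) * growthBase (K * C) n s (d₁ + d₂) ^ (d₁ + d₂) := by
  have key : ∀ {B : ℝ}, 1 ≤ B → B ≤ K * C → ∀ w ≤ d₁ + d₂,
      growthBound B n w s ≤ 2 ^ (d₁ + d₂) * growthBase (K * C) n s (d₁ + d₂) ^ w := by
    intro B hB hBK w hw
    have hB0 : 0 ≤ B := by linarith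
    rcases Nat.eq_zero_or_pos w with rfl | hw0
    · rw [growthBound_zero, pow_zero, mul_one]
      exact one_le_pow₀ (by norm_num)
    · rw [growthBound_eq_pow hB0]
      refine (growthBase_pow_le hB0 hw0 hw).trans ?_
      refine mul_le_mul_of_nonneg_left ?_ (by positivity)
      exact pow_le_pow_left₀ (Real.sqrt_nonneg _) (growthBase_mono_left hBK _ _ _) _
  have h1 := key hC (by nlinarith) d₁ (Nat.le_add_right _ _)
  have h2 := key hK (by nlinarith) d₂ (Nat.le_add_left _ _)
  have h0 : 0 ≤ growthBase (K * C) n s (d₁ + d₂) := Real.sqrt_nonneg _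
  calc _ ≤ (2 ^ (d₁ + d₂) * growthBase (K * C) n s (d₁ + d₂) ^ d₁) *
        (2 ^ (d₁ + d₂) * growthBase (K * C) n s (d₁ + d₂) ^ d₂) :=
        mul_le_mul h1 h2 (growthBound_nonneg (by linarith) _ _ _) (by positivity)
    _ = (2 * 2) ^ (d₁ + d₂) * growthBase (K * C) n s (d₁ + d₂) ^ (d₁ + d₂) := by
        rw [mul_pow, pow_add (growthBase _ _ _ _)]; ring
    _ = _ := by norm_num

theorem sum_pow_thirtyTwo_le (d : ℕ) :
    31 * ∑ i ∈ Finset.range (d + 1), (32 : ℝ) ^ i ≤ 32 ^ (d + 1) := by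
  have : ∀ d : ℕ, 31 * ∑ i ∈ Finset.range d, (32 : ℝ) ^ i = 32 ^ d - 1 := by
    intro d
    induction d with
    | zero => simp
    | succ d ih => rw [Finset.sum_range_succ, mul_add, ih]; ring
  rw [this]; linarith

end GrowthComparison

end LabeledMatching

/-! ### Densities on labelings and comparison of growth bounds -/

namespace LabeledMatching

noncomputable section Assembly

variable {k N : ℕ} [NeZero N] {Λ : Type*} [Fintype Λ] [DecidableEq Λ] {M : Finset (Fin k → Λ)}

omit [Fintype Λ] in
theorem isSelfDual_label : IsSelfDual fun (a x : Labeling N M) => ∏ e, character (a e) (x e) :=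
  isSelfDual_character.pi

omit [Fintype Λ] in
theorem labelCoeff_zero {g : Labeling N M → ℝ} (hmean : ∑ ξ, g ξ = Fintype.card (Labeling N M)) :
    labelCoeff (fun ξ => (g ξ : ℂ)) 0 = 1 := by
  have h : ∀ x : Labeling N M, ∏ e, character ((0 : Labeling N M) e) (x e) = 1 := fun x =>
    isSelfDual_label.zero_left x
  simp only [labelCoeff, tableCoeff, expect, h, map_one, mul_one]
  rw [← Complex.ofReal_sum, hmean]
  simp

omit [Fintype Λ] in
theorem norm_labelCoeff_le_one {g : Labeling N M → ℝ} (hg : ∀ ξ, 0 ≤ g ξ)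
    (hmean : ∑ ξ, g ξ = Fintype.card (Labeling N M)) (γ : Labeling N M) :
    ‖labelCoeff (fun ξ => (g ξ : ℂ)) γ‖ ≤ 1 := by
  refine (isSelfDual_label.norm_tableCoeff_le _ γ).trans ?_
  simp only [Complex.norm_real, Real.norm_of_nonneg (hg _), hmean]
  exact div_self_le_one _

theorem sum_sq_div_card_le {X : Type*} [Fintype X] {g : X → ℝ} {T c : ℝ}
    (hg : ∀ x, 0 ≤ g x) (hmax : ∀ x, g x ≤ T) (hT : 0 ≤ T)
    (hmean : (∑ x, g x) / Fintype.card X ≤ c) :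
    (∑ x, ‖(g x : ℂ)‖ ^ 2) / Fintype.card X ≤ T * c := by
  refine le_trans ?_ (mul_le_mul_of_nonneg_left hmean hT)
  rw [← mul_div_assoc, Finset.mul_sum]
  gcongr with x
  rw [Complex.norm_real, Real.norm_of_nonneg (hg x), sq]
  exact mul_le_mul_of_nonneg_right (hmax x) (hg x)

omit [Fintype Λ] in
theorem sum_sq_labelCoeff_le {g : Labeling N M → ℝ} {T : ℝ} (hT : 0 ≤ T) (hg : ∀ ξ, 0 ≤ g ξ)
    (hmean : ∑ ξ, g ξ = Fintype.card (Labeling N M)) (hmax : ∀ ξ, g ξ ≤ T) :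
    ∑ γ, ‖labelCoeff (fun ξ => (g ξ : ℂ)) γ‖ ^ 2 ≤ T := by
  have h := isSelfDual_label.parseval (fun ξ : Labeling N M => (g ξ : ℂ))
  refine (le_of_eq h).trans ((sum_sq_div_card_le hg hmax hT ?_).trans (mul_one T).le)
  rw [hmean]
  exact div_self_le_one _

omit [Fintype Λ] in
open Classical in
/-- The level inequality for a density times the conjugate of the character `γ₁`, which shifts the
Fourier coefficients by `γ₁`. Nonzero blocks of `γ₂` have at least two nonzero entries, so weight
`d` means at most `d / 2` nonzero blocks. -/
theorem sum_norm_labelCoeff_add_le {g : Labeling N M → ℝ} {s : ℝ} (hs : 0 < s)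
    (hg : ∀ ξ, 0 ≤ g ξ) (hmean : ∑ ξ, g ξ = Fintype.card (Labeling N M))
    (hmax : ∀ ξ, g ξ ≤ (2 : ℝ) ^ s) {n : ℕ} (hn : M.card ≤ n) (γ₁ : Labeling N M) {d : ℕ}
    (hd : d ≤ n) :
    ∑ γ₂ : Labeling N M with NoSingleton γ₂ ∧ totalWeight γ₂ = d,
        ‖labelCoeff (fun ξ => (g ξ : ℂ)) (γ₁ + γ₂)‖
      ≤ growthBound (19 * (N : ℝ) ^ k) n d s := by
  have hχ := isSelfDual_character (N := N) (Λ := Fin k)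
  have hnorm : ∀ ξ : Labeling N M, ‖(g ξ : ℂ) *
      (starRingEnd ℂ) (∏ e, character (γ₁ e) (ξ e))‖ = g ξ := by
    intro ξ
    rw [norm_mul, RCLike.norm_conj, isSelfDual_label.norm_eq γ₁ ξ, mul_one, Complex.norm_real,
      Real.norm_of_nonneg (hg ξ)]
  have h := sum_norm_tableCoeff_le (ι := ↥M) hχ
    (fun ξ => (g ξ : ℂ) * (starRingEnd ℂ) (∏ e, character (γ₁ e) (ξ e))) hs
    (by simp_rw [hnorm]; exact hmean) (fun ξ => (hnorm ξ).le.trans (hmax ξ))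
    (by simpa using hn) hd
  have hcard : ((Fintype.card (Fin k → ZMod N) : ℕ) : ℝ) = (N : ℝ) ^ k := by
    simp [ZMod.card]
  rw [hcard] at h
  refine le_trans ?_ h
  have hmul : ∀ γ : Labeling N M, tableCoeff (fun a x : Labeling N M => ∏ e, character (a e) (x e))
      (fun ξ => (g ξ : ℂ) * (starRingEnd ℂ) (∏ e, character (γ₁ e) (ξ e))) γ
        = labelCoeff (fun ξ => (g ξ : ℂ)) (γ₁ + γ) := fun γ =>
    isSelfDual_label.tableCoeff_mul _ γ₁ γ
  simp_rw [hmul]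
  refine Finset.sum_le_sum_of_subset_of_nonneg (fun γ hγ => ?_) fun _ _ _ => norm_nonneg _
  obtain ⟨-, h1, h2⟩ := Finset.mem_filter.1 hγ
  exact Finset.mem_filter.2 ⟨Finset.mem_univ _, h2 ▸ two_mul_hammingNorm_le_totalWeight h1⟩

theorem uniformDensity_nonneg {X : Type*} [Fintype X] [DecidableEq X] (A : Finset X) (x : X) :
    0 ≤ uniformDensity A x := by
  unfold uniformDensity; split_ifs <;> positivity

theorem sum_uniformDensity {X : Type*} [Fintype X] [DecidableEq X] {A : Finset X}
    (hA : 0 < A.card) : ∑ x, uniformDensity A x = Fintype.card X := by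
  have : (A.card : ℝ) ≠ 0 := by positivity
  simp only [uniformDensity, ← Finset.sum_filter, Finset.sum_const, Finset.filter_univ_mem,
    nsmul_eq_mul]
  field_simp

theorem uniformDensity_le {X : Type*} [Fintype X] [DecidableEq X] {A : Finset X} {s : ℝ}
    (hA : (2 : ℝ) ^ (-s) * Fintype.card X ≤ A.card) (hA0 : 0 < A.card) (x : X) :
    uniformDensity A x ≤ (2 : ℝ) ^ s := by
  unfold uniformDensity
  split_ifs
  · rw [div_le_iff₀ (by exact_mod_cast hA0)]
    calc (Fintype.card X : ℝ) = (2 : ℝ) ^ s * ((2 : ℝ) ^ (-s) * Fintype.card X) := by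
          rw [← mul_assoc, ← Real.rpow_add two_pos]; simp
      _ ≤ _ := by gcongr
  · positivity

omit [NeZero N] in
/-- The contribution of small weights at level `d`, compared with half of the enlarged growth
bound. -/
theorem sum_convolution_le {C η s : ℝ} (hC : 1 ≤ C) (hη0 : 0 < η) (hη1 : η ≤ 1) (hs : 0 ≤ s)
    (hN : 1 ≤ N) {n d : ℕ} (hd : 1 ≤ d) {T : ℕ → ℝ}
    (hT : ∀ d₁ ≤ d, T d₁ ≤ η⁻¹ * 32 ^ d₁ * growthBound C n d₁ s) :
    ∑ d₁ ∈ Finset.range (d + 1), T d₁ * growthBound (19 * (N : ℝ) ^ k) n (d - d₁) s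
      ≤ 1 / 2 * growthBound ((2048 * η⁻¹ * (N : ℝ) ^ (4 * k)) ^ 2 * C) n d (2 * s) := by
  have hN' : (1 : ℝ) ≤ N := by exact_mod_cast hN
  have hK : (1 : ℝ) ≤ 19 * (N : ℝ) ^ k := by
    have : (1 : ℝ) ≤ (N : ℝ) ^ k := one_le_pow₀ hN'
    linarith
  set Q : ℝ := (N : ℝ) ^ (4 * k) with hQ
  have hQ1 : 1 ≤ Q := one_le_pow₀ hN'
  have hη : 1 ≤ η⁻¹ := (one_le_inv₀ hη0).2 hη1
  have h0 : 0 ≤ growthBase C n s d := Real.sqrt_nonneg _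
  have hbase : growthBase (19 * (N : ℝ) ^ k * C) n s d ≤ 5 * Q * growthBase C n s d := by
    rw [← growthBase_sq_mul (by positivity)]
    refine growthBase_mono_left ?_ _ _ _
    have h1 : (N : ℝ) ^ k ≤ Q := pow_le_pow_right₀ hN' (by omega)
    have h2 : Q ≤ Q ^ 2 := le_self_pow₀ hQ1 two_ne_zero
    refine mul_le_mul_of_nonneg_right ?_ (by linarith)
    nlinarith
  have hterm : ∀ d₁ ∈ Finset.range (d + 1),
      T d₁ * growthBound (19 * (N : ℝ) ^ k) n (d - d₁) s
        ≤ 32 ^ d₁ * (η⁻¹ * (20 * Q * growthBase C n s d) ^ d) := by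
    intro d₁ hd₁
    have hle : d₁ ≤ d := Nat.lt_succ_iff.1 (Finset.mem_range.1 hd₁)
    have h1 := growthBound_mul_le (n := n) (d₁ := d₁) (d₂ := d - d₁) (s := s) hC hK
    rw [Nat.add_sub_cancel' hle] at h1
    calc _ ≤ η⁻¹ * 32 ^ d₁ * growthBound C n d₁ s * growthBound (19 * (N : ℝ) ^ k) n (d - d₁) s :=
          mul_le_mul_of_nonneg_right (hT d₁ hle) (growthBound_nonneg (by linarith) _ _ _)
      _ = η⁻¹ * 32 ^ d₁ * (growthBound C n d₁ s * growthBound (19 * (N : ℝ) ^ k) n (d - d₁) s) := by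
          ring
      _ ≤ η⁻¹ * 32 ^ d₁ * (4 ^ d * (5 * Q * growthBase C n s d) ^ d) := by
          refine mul_le_mul_of_nonneg_left (h1.trans ?_) (by positivity)
          gcongr
          exact Real.sqrt_nonneg _
      _ = _ := by rw [← mul_pow]; ring
  refine (Finset.sum_le_sum hterm).trans ?_
  rw [← Finset.sum_mul, growthBound_eq_pow (by positivity), growthBase_sq_mul (by positivity)]
  have hsum := sum_pow_thirtyTwo_le d
  have hmono : growthBase C n s d ≤ growthBase C n (2 * s) d :=
    growthBase_mono_right (by linarith) _ (by linarith) _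
  have hpow : (2048 * η⁻¹ * Q * growthBase C n s d) ^ d
      ≤ (2048 * η⁻¹ * Q * growthBase C n (2 * s) d) ^ d := by gcongr
  refine le_trans ?_ (mul_le_mul_of_nonneg_left hpow (by norm_num))
  have hηd : η⁻¹ ≤ η⁻¹ ^ d := le_self_pow₀ hη (by omega)
  -- `2048 = 3.2 * 640`, and the surplus absorbs the factor `32 / 31` and the factor `1 / 2`.
  have h640 : (32 : ℝ) ^ (d + 1) * 20 ^ d ≤ 31 / 2 * 2048 ^ d := by
    have h1 : (2048 : ℝ) ^ d = 32 ^ d * 20 ^ d * (16 / 5) ^ d := by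
      rw [← mul_pow, ← mul_pow]; norm_num
    have h2 : (16 / 5 : ℝ) ≤ (16 / 5) ^ d := le_self_pow₀ (by norm_num) (by omega)
    rw [h1, pow_succ]
    have h3 : (0 : ℝ) < 32 ^ d * 20 ^ d := by positivity
    nlinarith
  have hX : 0 ≤ (Q * growthBase C n s d) ^ d := by positivity
  calc (∑ i ∈ Finset.range (d + 1), (32 : ℝ) ^ i) * (η⁻¹ * (20 * Q * growthBase C n s d) ^ d)
      ≤ (32 ^ (d + 1) / 31) * (η⁻¹ ^ d * (20 * Q * growthBase C n s d) ^ d) := by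
        gcongr
        linarith
    _ = (32 ^ (d + 1) * 20 ^ d / 31) * (η⁻¹ ^ d * (Q * growthBase C n s d) ^ d) := by
        rw [mul_assoc 20, mul_pow 20]; ring
    _ ≤ (31 / 2 * 2048 ^ d / 31) * (η⁻¹ ^ d * (Q * growthBase C n s d) ^ d) := by gcongr
    _ = 1 / 2 * (2048 * η⁻¹ * Q * growthBase C n s d) ^ d := by
        rw [mul_assoc (2048 * η⁻¹), mul_pow (2048 * η⁻¹), mul_pow 2048]; ring

omit [NeZero N] in
theorem inv_le_growthBound {C η s : ℝ} (hC : 1 ≤ C) (hη0 : 0 < η) (hη1 : η ≤ 1)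
    (hN : 1 ≤ N) {n d : ℕ} (hd : 1 ≤ d) (hdn : d ≤ n) :
    η⁻¹ ≤ growthBound ((2048 * η⁻¹ * (N : ℝ) ^ (4 * k)) ^ 2 * C) n d s := by
  have hN' : (1 : ℝ) ≤ N := by exact_mod_cast hN
  have hQ1 : (1 : ℝ) ≤ (N : ℝ) ^ (4 * k) := one_le_pow₀ hN'
  have hη : 1 ≤ η⁻¹ := (one_le_inv₀ hη0).2 hη1
  rw [growthBound_eq_pow (by positivity), growthBase_sq_mul (by positivity)]
  have h1 := one_le_growthBase (s := s) hC hd hdn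
  have h2 : η⁻¹ ≤ 2048 * η⁻¹ * (N : ℝ) ^ (4 * k) * growthBase C n s d := by
    have h3 : η⁻¹ ≤ 2048 * η⁻¹ * (N : ℝ) ^ (4 * k) := by nlinarith
    exact h3.trans (le_mul_of_one_le_right (by positivity) h1)
  exact h2.trans (le_self_pow₀ (hη.trans h2) (by omega))

end Assembly

end LabeledMatching

/-! ### Boundedness for a good matching -/

namespace LabeledMatching

noncomputable section GoodMatching

variable {k N : ℕ} [NeZero N] {Λ : Type*} [Fintype Λ] [DecidableEq Λ] {M : Finset (Fin k → Λ)}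

theorem sum_mul_sum_filter_split {I J : Type*} [Fintype J] (S : Finset I)
    (Φ : I → ℝ) (A : J → ℝ) (P : I → J → Prop) [∀ i, DecidablePred (P i)] (w : J → ℕ) (W : ℕ) :
    ∑ i ∈ S, Φ i * ∑ j with P i j, A j
      = ∑ i ∈ S, Φ i * ∑ j with P i j ∧ w j ≤ W, A j
        + ∑ i ∈ S, Φ i * ∑ j with P i j ∧ W < w j, A j := by
  rw [← Finset.sum_add_distrib]
  refine Finset.sum_congr rfl fun i _ => ?_
  rw [← mul_add]
  congr 1
  rw [← Finset.sum_filter_add_sum_filter_not (Finset.univ.filter (P i)) (fun j => w j ≤ W)]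
  simp only [Finset.filter_filter, not_le]

open Classical in
/-- A nonzero labeling cancels `b` only if `b` is nonzero and all labeled edges meet its support. -/
theorem sum_cancelling_le {U : KUniverse k Λ} {m : ℕ} (hM : M ∈ U.matchings m)
    {Φ : Labeling N M → ℝ} (hΦ : ∀ γ, Φ γ ≤ 1) {A : (Λ → ZMod N) → ℝ} (hA : ∀ b, 0 ≤ A b) (W : ℕ) :
    ∑ γ : Labeling N M with NoSingleton γ ∧ γ ≠ 0, Φ γ *
        ∑ b : Λ → ZMod N with hammingNorm (b + extendLabeling γ) = 0 ∧ hammingNorm b ≤ W, A b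
      ≤ touchedMass A W 0 M := by
  have hkey : ∀ (γ : Labeling N M) (b : Λ → ZMod N), hammingNorm (b + extendLabeling γ) = 0 →
      ∀ e : ↥M, restrictEdge b e.1 = - γ e := by
    intro γ b h e
    rw [hammingNorm_eq_zero, add_eq_zero_iff_eq_neg] at h
    rw [h, ← restrictEdge_extendLabeling hM γ e]
    rfl
  calc _ ≤ ∑ γ : Labeling N M with NoSingleton γ ∧ γ ≠ 0,
        ∑ b : Λ → ZMod N with hammingNorm (b + extendLabeling γ) = 0 ∧ hammingNorm b ≤ W, A b :=
        Finset.sum_le_sum fun γ _ => mul_le_of_le_one_left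
          (Finset.sum_nonneg fun b _ => hA b) (hΦ γ)
    _ = ∑ b : Λ → ZMod N with 1 ≤ hammingNorm b ∧ hammingNorm b ≤ W,
        ∑ γ : Labeling N M with NoSingleton γ ∧ γ ≠ 0 ∧ hammingNorm (b + extendLabeling γ) = 0,
          A b := by
        refine Finset.sum_comm' fun γ b => ?_
        simp only [Finset.mem_filter, Finset.mem_univ, true_and]
        constructor
        · rintro ⟨⟨h1, h2⟩, h3, h4⟩
          refine ⟨⟨h1, h2, h3⟩, Nat.one_le_iff_ne_zero.2 fun h0 => h2 ?_, h4⟩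
          rw [hammingNorm_eq_zero] at h0
          funext e
          have := hkey γ b h3 e
          rw [h0] at this
          change γ e = 0
          rw [← neg_eq_zero (a := γ e), ← this]
          rfl
        · rintro ⟨⟨h1, h2, h3⟩, -, h4⟩
          exact ⟨⟨h1, h2⟩, h3, h4⟩
    _ ≤ _ := by
        rw [touchedMass]
        refine Finset.sum_le_sum fun b _ => ?_
        rw [Finset.sum_const, nsmul_eq_mul, mul_comm]
        refine mul_le_mul_of_nonneg_left ?_ (hA b)
        rw [Nat.cast_le]
        refine Finset.card_le_card fun γ hγ => ?_
        obtain ⟨-, h1, h2, h3⟩ := Finset.mem_filter.1 hγ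
        refine mem_reweightings.2 ⟨h1, fun e he => ?_, h3⟩
        change restrictEdge b e.1 ≠ 0
        rw [hkey γ b h3 e]
        exact neg_ne_zero.2 he

/-- If labelings of `M` move little coefficient mass of `f` to low levels, then multiplying `f` by
the image of any density bounded by `2 ^ s` keeps it bounded. -/
theorem isBounded_mul_markovOp (hN : 1 ≤ N) {U : KUniverse k Λ} {m : ℕ} (hM : M ∈ U.matchings m)
    (hmn : m ≤ U.card) {f : (Λ → ZMod N) → ℝ} {C δ₀ δ η s : ℝ} (hC : 1 ≤ C) (hη0 : 0 < η)
    (hη1 : η ≤ 1 / 2) (hδ0 : 0 < δ) (hδ1 : δ ≤ 1 / 2) (hs : 0 < s) (hδ₀ : δ₀ ≤ 1 / 2)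
    (hf : IsBounded U.card C s δ₀ f) {W : ℕ}
    (hT0 : touchedMass (fun b => ‖charCoeff (fun x => (f x : ℂ)) b‖) W 0 M ≤ δ / (2 * η))
    (hT : ∀ d : ℕ, 1 ≤ d →
      (d : ℝ) ≤ (((2048 * η⁻¹ * (N : ℝ) ^ (4 * k)) ^ 2 * C) ^ 2)⁻¹ * U.card →
      touchedMass (fun b => ‖charCoeff (fun x => (f x : ℂ)) b‖) W d M
        ≤ η⁻¹ * 32 ^ d * growthBound C U.card d s)
    (hL : ∀ d : ℕ, (d : ℝ) ≤ (((2048 * η⁻¹ * (N : ℝ) ^ (4 * k)) ^ 2 * C) ^ 2)⁻¹ * U.card →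
      (2 : ℝ) ^ s * (Finset.univ.filter fun a : Λ → ZMod N => hammingNorm a = d).card *
        largeMass (fun b => ‖charCoeff (fun x => (f x : ℂ)) b‖) W d M ≤ (δ / (2 * η)) ^ 2)
    {g : Labeling N M → ℝ} (hg : ∀ ξ, 0 ≤ g ξ)
    (hmean : ∑ ξ, g ξ = Fintype.card (Labeling N M)) (hmax : ∀ ξ, g ξ ≤ (2 : ℝ) ^ s)
    {μ : PMF (Fin k → ZMod N)} (hμ : IsOneWiseIndependent μ) :
    IsBounded U.card ((2048 * η⁻¹ * (N : ℝ) ^ (4 * k)) ^ 2 * C) (2 * s) (δ₀ + η⁻¹ * δ)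
      (fun x => f x * markovOp M μ g x) := by
  classical
  set A : (Λ → ZMod N) → ℝ := fun b => ‖charCoeff (fun x => (f x : ℂ)) b‖ with hAdef
  set Φ : Labeling N M → ℝ := fun γ => ‖labelCoeff (fun ξ => (g ξ : ℂ)) γ‖ with hΦdef
  set C' : ℝ := (2048 * η⁻¹ * (N : ℝ) ^ (4 * k)) ^ 2 * C with hC'
  have hA : ∀ b, 0 ≤ A b := fun b => norm_nonneg _
  have hΦ : ∀ γ, 0 ≤ Φ γ := fun γ => norm_nonneg _
  have hN' : (1 : ℝ) ≤ N := by exact_mod_cast hN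
  have hη : 2 ≤ η⁻¹ := by
    rw [le_inv_comm₀ two_pos hη0]; linarith
  have hC'1 : 1 ≤ C' := by
    have hQ1 : (1 : ℝ) ≤ (N : ℝ) ^ (4 * k) := one_le_pow₀ hN'
    have h1 : 1 ≤ 2048 * η⁻¹ * (N : ℝ) ^ (4 * k) := by nlinarith
    exact one_le_mul_of_one_le_of_one_le (one_le_pow₀ h1) hC
  have hMcard : M.card ≤ U.card := (KUniverse.mem_matchings.1 hM).2.1.trans_le hmn
  have hmeanf : charCoeff (fun x => (f x : ℂ)) 0
      = (((∑ x, f x) / (Fintype.card (Λ → ZMod N) : ℝ) : ℝ) : ℂ) := charCoeff_zero f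
  have hA0 : A 0 ≤ 3 / 2 := by
    rw [hAdef]
    simp only [hmeanf, Complex.norm_real]
    rw [Real.norm_of_nonneg (div_nonneg (Finset.sum_nonneg fun x _ => hf.nonneg x)
      (Nat.cast_nonneg _))]
    linarith [hf.mean_le]
  have hhalf : δ / (2 * η) ≤ η⁻¹ / 4 := by
    rw [div_le_iff₀ (by positivity)]
    field_simp
    linarith
  have hlarge : ∀ d : ℕ, (d : ℝ) ≤ (C' ^ 2)⁻¹ * U.card →
      ∑ γ : Labeling N M with NoSingleton γ, Φ γ * ∑ b : Λ → ZMod N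
        with hammingNorm (b + extendLabeling γ) = d ∧ W < hammingNorm b, A b ≤ δ / (2 * η) := by
    intro d hd
    refine (sum_largeWeight_le Φ A d W).trans (Real.sqrt_le_iff.2 ⟨by positivity, ?_⟩)
    refine le_trans ?_ (hL d hd)
    have hl0 : 0 ≤ largeMass A W d M := Finset.sum_nonneg fun b _ => by positivity
    gcongr
    exact sum_sq_labelCoeff_le (by positivity) hg hmean hmax
  have hmeandiff : |(∑ x, f x * markovOp M μ g x) / (Fintype.card (Λ → ZMod N) : ℝ)
      - (∑ x, f x) / (Fintype.card (Λ → ZMod N) : ℝ)| ≤ η⁻¹ * δ := by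
    have h1 := norm_charCoeff_zero_sub_le hμ g f (labelCoeff_zero hmean)
    rw [charCoeff_zero, hmeanf, ← Complex.ofReal_sub,
      Complex.norm_real, Real.norm_eq_abs] at h1
    refine h1.trans ?_
    rw [sum_mul_sum_filter_split _ _ _ _ hammingNorm W]
    have h2 := sum_cancelling_le hM (Φ := Φ) (norm_labelCoeff_le_one hg hmean) hA W
    have h3 := hlarge 0 (by rw [Nat.cast_zero]; positivity)
    have h4 : ∑ γ : Labeling N M with NoSingleton γ ∧ γ ≠ 0, Φ γ * ∑ b : Λ → ZMod N
        with hammingNorm (b + extendLabeling γ) = 0 ∧ W < hammingNorm b, A b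
        ≤ δ / (2 * η) := by
      refine le_trans (Finset.sum_le_sum_of_subset_of_nonneg (fun γ hγ => ?_) fun γ _ _ => ?_) h3
      · exact Finset.mem_filter.2 ⟨Finset.mem_univ _, (Finset.mem_filter.1 hγ).2.1⟩
      · exact mul_nonneg (hΦ γ) (Finset.sum_nonneg fun b _ => hA b)
    have h5 : δ / (2 * η) + δ / (2 * η) = η⁻¹ * δ := by field_simp; norm_num
    linarith [h2.trans hT0]
  rw [abs_le] at hmeandiff
  refine ⟨fun x => mul_nonneg (hf.nonneg x) (markovOp_nonneg μ hg x), ?_, ?_, ?_, fun x => ?_⟩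
  · linarith [hf.le_mean]
  · linarith [hf.mean_le]
  · intro d hd1 hd
    have hdn : d ≤ U.card := by
      have h1 : (C' ^ 2)⁻¹ ≤ 1 := inv_le_one_of_one_le₀ (one_le_pow₀ hC'1)
      have h2 : (d : ℝ) ≤ U.card := hd.trans (mul_le_of_le_one_left (Nat.cast_nonneg _) h1)
      exact_mod_cast h2
    have hdiv : δ / (2 * η) ≤ 1 / 2 * η⁻¹ := by linarith
    rw [wienerNorm_levelPart]
    refine (sum_norm_charCoeff_mul_markovOp_le hμ g f d).trans ?_
    rw [sum_mul_sum_filter_split _ _ _ _ hammingNorm W]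
    have hsmall := sum_smallWeight_le hM hΦ hA
      (G := fun d => growthBound (19 * (N : ℝ) ^ k) U.card d s)
      (fun d => growthBound_nonneg (by positivity) _ _ _) (d := d) (W := W)
      (fun γ₁ d₂ hd₂ => sum_norm_labelCoeff_add_le hs hg hmean hmax hMcard γ₁ (hd₂.trans hdn))
    have hconv := sum_convolution_le (k := k) (n := U.card) (d := d) (s := s) hC hη0
      (hη1.trans (by norm_num)) hs.le hN hd1
      (T := fun d₁ => (if d₁ = 0 then A 0 else 0) + touchedMass A W d₁ M) (fun d₁ hd₁ => by
        rcases Nat.eq_zero_or_pos d₁ with rfl | h0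
        · simp only [if_true, pow_zero, mul_one, growthBound_zero]
          linarith
        · simp only [h0.ne', if_false, zero_add]
          refine hT d₁ h0 (le_trans ?_ hd)
          exact_mod_cast hd₁)
    have hbig := (hlarge d hd).trans (hdiv.trans (mul_le_mul_of_nonneg_left
      (inv_le_growthBound (k := k) (s := 2 * s) hC hη0 (hη1.trans (by norm_num)) hN hd1 hdn)
      (by norm_num : (0 : ℝ) ≤ 1 / 2)))
    linarith
  · rw [two_mul, Real.rpow_add two_pos]
    exact mul_le_mul (hf.le_max x) (markovOp_le μ hmax x) (markovOp_nonneg μ hg x) (by positivity)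

end GoodMatching

end LabeledMatching

/-! ### The probability of a good matching -/

namespace LabeledMatching

noncomputable section GoodProbability

variable {k N : ℕ} [NeZero N] {Λ : Type*} [Fintype Λ] [DecidableEq Λ]

omit [Fintype Λ] in
theorem card_labeling {U : KUniverse k Λ} {m : ℕ} (M : ↥(U.matchings m)) :
    Fintype.card (Labeling N M.1) = N ^ (k * m) := by
  simp [Labeling, ZMod.card, (KUniverse.mem_matchings.1 M.2).2.1, pow_mul]

/-- Weights above the level cutoff leave room for moving to any level of the enlarged range. -/
theorem room_above_cutoff {k N : ℕ} (hk : 1 ≤ k) (hN : 2 ≤ N) {n d ω : ℕ} {C K s : ℝ} (hC : 1 ≤ C)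
    (hK : 2048 * (N : ℝ) ^ (4 * k) ≤ K) (hs : 100 * (C ^ 2 * s) ≤ n)
    (hd : (d : ℝ) ≤ ((K ^ 2 * C) ^ 2)⁻¹ * n) (hω : (C ^ 2)⁻¹ * n ≤ ω) :
    4 * s + (4 + N) * d ≤ ω ∧ (2 * k + 1) * d ≤ ω := by
  have hN' : (1 : ℝ) ≤ N := by exact_mod_cast (by omega : 1 ≤ N)
  set r : ℝ := (C ^ 2)⁻¹ * n with hr
  set P : ℝ := (N : ℝ) ^ (4 * k) with hP
  have hC0 : 0 < C ^ 2 := by positivity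
  have hP1 : 1 ≤ P := one_le_pow₀ hN'
  have hkP : (k : ℝ) ≤ P := by
    have h1 : k < 2 ^ k := Nat.lt_two_pow_self
    have h2 : 2 ^ k ≤ N ^ (4 * k) := (Nat.pow_le_pow_left hN k).trans
      (Nat.pow_le_pow_right (by omega) (by omega))
    have h3 : k ≤ N ^ (4 * k) := by omega
    rw [hP]; exact_mod_cast h3
  have hNP : (N : ℝ) ≤ P := le_self_pow₀ hN' (by omega)
  have hsr : 100 * s ≤ r := by
    rw [hr, inv_mul_eq_div, le_div_iff₀ hC0]; linarith
  have hd0 : (0 : ℝ) ≤ d := Nat.cast_nonneg d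
  have hK0 : 0 < K := by linarith
  have hK1 : 2048 * P ≤ K ^ 4 := hK.trans (le_self_pow₀ (by linarith) (by norm_num))
  have hdr : 2048 * P * d ≤ r := by
    have h1 : K ^ 4 * d ≤ r := by
      have h2 : ((K ^ 2 * C) ^ 2)⁻¹ * (n : ℝ) = (K ^ 4)⁻¹ * r := by
        rw [hr, mul_pow, mul_inv]; ring
      rw [h2, inv_mul_eq_div, le_div_iff₀ (by positivity)] at hd
      linarith
    exact (mul_le_mul_of_nonneg_right hK1 hd0).trans h1
  have h1 : (N : ℝ) * d ≤ P * d := mul_le_mul_of_nonneg_right hNP hd0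
  have h2 : (k : ℝ) * d ≤ P * d := mul_le_mul_of_nonneg_right hkP hd0
  have h3 : (d : ℝ) ≤ P * d := le_mul_of_one_le_left hd0 hP1
  refine ⟨by linarith, ?_⟩
  have h4 : (2 * (k : ℝ) + 1) * d ≤ ω := by linarith
  exact_mod_cast h4

theorem touchedMass_nonneg {A : (Λ → ZMod N) → ℝ} (hA : ∀ b, 0 ≤ A b) (W d : ℕ)
    (M : Finset (Fin k → Λ)) : 0 ≤ touchedMass A W d M :=
  Finset.sum_nonneg fun b _ => mul_nonneg (hA b) (Nat.cast_nonneg _)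

theorem largeMass_nonneg (A : (Λ → ZMod N) → ℝ) (W d : ℕ) (M : Finset (Fin k → Λ)) :
    0 ≤ largeMass A W d M :=
  Finset.sum_nonneg fun b _ => by positivity

/-- Markov's inequality for three families of nonnegative quantities whose means are controlled
with geometric weights. -/
theorem one_sub_three_mul_le_prob {α : Type*} [Fintype α] (D : PMF α) {η : ℝ} (hη : 0 < η)
    {E : ℕ} {X : α → ℝ} {Y Z : ℕ → α → ℝ} {x : ℝ} {y z : ℕ → ℝ} (hX0 : ∀ M, 0 ≤ X M)
    (hY0 : ∀ d M, 0 ≤ Y d M) (hZ0 : ∀ d M, 0 ≤ Z d M) (hx : 0 < x)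
    (hy : ∀ d, 1 ≤ d → d ≤ E → 0 < y d) (hz : ∀ d ≤ E, 0 < z d) (hX : pmfMean D X ≤ η * x)
    (hY : ∀ d, 1 ≤ d → d ≤ E → pmfMean D (Y d) ≤ η * (1 / 2) ^ d * y d)
    (hZ : ∀ d ≤ E, pmfMean D (Z d) ≤ η * (1 / 2) ^ (d + 1) * z d) {G : Set α}
    (hG : ∀ M, X M ≤ x → (∀ d, 1 ≤ d → d ≤ E → Y d M ≤ y d) → (∀ d ≤ E, Z d M ≤ z d) → M ∈ G) :
    1 - 3 * η ≤ prob D G := by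
  set w : α → ℝ := fun M => x⁻¹ * X M + (∑ d ∈ Finset.Icc 1 E, (y d)⁻¹ * Y d M
    + ∑ d ∈ Finset.range (E + 1), (z d)⁻¹ * Z d M) with hw
  have hYt : ∀ M, ∀ d ∈ Finset.Icc 1 E, 0 ≤ (y d)⁻¹ * Y d M := fun M d hd =>
    mul_nonneg (inv_nonneg.2 (hy d (Finset.mem_Icc.1 hd).1 (Finset.mem_Icc.1 hd).2).le) (hY0 d M)
  have hZt : ∀ M, ∀ d ∈ Finset.range (E + 1), 0 ≤ (z d)⁻¹ * Z d M := fun M d hd =>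
    mul_nonneg (inv_nonneg.2 (hz d (Nat.lt_succ_iff.1 (Finset.mem_range.1 hd))).le) (hZ0 d M)
  have hXt : ∀ M, 0 ≤ x⁻¹ * X M := fun M => mul_nonneg (inv_nonneg.2 hx.le) (hX0 M)
  have hmean : pmfMean D w ≤ 3 * η := by
    rw [hw, pmfMean_add, pmfMean_add, pmfMean_sum, pmfMean_sum]
    simp_rw [pmfMean_const_mul]
    have h1 : x⁻¹ * pmfMean D X ≤ η := by
      rw [inv_mul_eq_div, div_le_iff₀ hx]; exact hX
    have h2 : ∑ d ∈ Finset.Icc 1 E, (y d)⁻¹ * pmfMean D (Y d) ≤ η := by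
      calc _ ≤ ∑ d ∈ Finset.Icc 1 E, η * (1 / 2 : ℝ) ^ d := by
            refine Finset.sum_le_sum fun d hd => ?_
            obtain ⟨hd1, hd2⟩ := Finset.mem_Icc.1 hd
            rw [inv_mul_eq_div, div_le_iff₀ (hy d hd1 hd2)]
            exact hY d hd1 hd2
        _ ≤ η := by
            rw [← Finset.mul_sum]
            exact mul_le_of_le_one_right hη.le (sum_Icc_half_pow_le E)
    have h3 : ∑ d ∈ Finset.range (E + 1), (z d)⁻¹ * pmfMean D (Z d) ≤ η := by
      calc _ ≤ ∑ d ∈ Finset.range (E + 1), η / 2 * (1 / 2 : ℝ) ^ d := by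
            refine Finset.sum_le_sum fun d hd => ?_
            have hd2 := Nat.lt_succ_iff.1 (Finset.mem_range.1 hd)
            rw [inv_mul_eq_div, div_le_iff₀ (hz d hd2)]
            exact (hZ d hd2).trans_eq (by ring)
        _ ≤ η := by
            rw [← Finset.mul_sum]
            nlinarith [sum_geometric_two_le (E + 1)]
    linarith
  refine le_trans (by linarith) (one_sub_pmfMean_le_prob (W := w) D (fun M => ?_) fun M hM => ?_)
  · exact add_nonneg (hXt M) (add_nonneg (Finset.sum_nonneg (hYt M)) (Finset.sum_nonneg (hZt M)))
  · by_contra hlt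
    rw [not_le] at hlt
    have hYs := Finset.sum_nonneg (hYt M)
    have hZs := Finset.sum_nonneg (hZt M)
    have hXs := hXt M
    simp only [hw] at hlt
    refine hM (hG M ?_ (fun d hd1 hd2 => ?_) fun d hd => ?_)
    · have h : x⁻¹ * X M ≤ 1 := by linarith
      rwa [inv_mul_eq_div, div_le_one hx] at h
    · have h1 := Finset.single_le_sum (hYt M) (Finset.mem_Icc.2 ⟨hd1, hd2⟩)
      have h : (y d)⁻¹ * Y d M ≤ 1 := by linarith
      rwa [inv_mul_eq_div, div_le_one (hy d hd1 hd2)] at h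
    · have h1 := Finset.single_le_sum (hZt M) (Finset.mem_range.2 (Nat.lt_succ_iff.2 hd))
      have h : (z d)⁻¹ * Z d M ≤ 1 := by linarith
      rwa [inv_mul_eq_div, div_le_one (hz d hd)] at h

theorem matching_size_bounds {k N n m L : ℕ} (hN : 2 ≤ N) (hnL : n ≤ L) (hm0 : 0 < m)
    (hm : (m : ℝ) ≤ (n : ℝ) ^ 3 / ((2 : ℝ) ^ 18 * (N : ℝ) ^ (10 * k) * (L : ℝ) ^ 2)) :
    0 < n ∧ 2 ^ 18 * N ^ (10 * k) * (m * L ^ 2) ≤ n ^ 3 ∧ 2 ^ 18 * N ^ (10 * k) * m ≤ n := by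
  have hn : 0 < n := by
    rcases Nat.eq_zero_or_pos n with rfl | h
    · have : (m : ℝ) ≤ 0 := by simpa using hm
      exact absurd (by exact_mod_cast this) (by omega : ¬ m ≤ 0)
    · exact h
  have hL : 0 < L := by omega
  have hN0 : (0 : ℝ) < N := by exact_mod_cast (by omega : 0 < N)
  have hL' : (0 : ℝ) < L := by exact_mod_cast hL
  rw [le_div_iff₀ (by positivity)] at hm
  have h1 : 2 ^ 18 * N ^ (10 * k) * (m * L ^ 2) ≤ n ^ 3 := by
    have : ((2 ^ 18 * N ^ (10 * k) * (m * L ^ 2) : ℕ) : ℝ) ≤ ((n ^ 3 : ℕ) : ℝ) := by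
      push_cast
      linarith
    exact_mod_cast this
  refine ⟨hn, h1, ?_⟩
  refine Nat.le_of_mul_le_mul_right ?_ (pow_pos hn 2)
  calc 2 ^ 18 * N ^ (10 * k) * m * n ^ 2 ≤ 2 ^ 18 * N ^ (10 * k) * m * L ^ 2 := by gcongr
    _ = 2 ^ 18 * N ^ (10 * k) * (m * L ^ 2) := by ring
    _ ≤ n ^ 3 := h1
    _ = n * n ^ 2 := by ring

/-- The Markov threshold for the large-weight mass at a level of `l` vectors, with `p = 2 ^ s`,
keeps its contribution below `δ / (2 * η)`. -/
theorem sq_cutoff_le {p η δ l X : ℝ} (hp : 0 < p) (hη0 : 0 < η) (hη1 : η ≤ 1) (hδ : p⁻¹ ≤ δ / 4)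
    (hl : 0 < l) (hX : X ≤ 3 * η⁻¹ * p / (p ^ 4 * l)) : p * l * X ≤ (δ / (2 * η)) ^ 2 := by
  have hη : 1 ≤ η⁻¹ := (one_le_inv₀ hη0).2 hη1
  calc p * l * X ≤ p * l * (3 * η⁻¹ * p / (p ^ 4 * l)) := by gcongr
    _ = 3 * η⁻¹ * p⁻¹ ^ 2 := by field_simp
    _ ≤ 3 * η⁻¹ * (δ / 4) ^ 2 := by gcongr
    _ ≤ (4 * η⁻¹ * η⁻¹) * (δ / 4) ^ 2 := by
        refine mul_le_mul_of_nonneg_right ?_ (by positivity)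
        nlinarith
    _ = (δ / (2 * η)) ^ 2 := by field_simp; ring

/-- With probability at least `1 - 3 * η`, labelings of the matching move little coefficient mass
of `f` to low levels: by Markov's inequality for the touched mass at level `0`, the touched masses
at positive levels, and the large-weight masses. -/
theorem one_sub_three_mul_le_prob_of_masses (hk : 1 ≤ k) (hN : 2 ≤ N) {U : KUniverse k Λ} {m : ℕ}
    (hm0 : 0 < m) (hn : 0 < U.card) (hnL : U.card ≤ Fintype.card Λ)
    (hm3 : 2 ^ 18 * N ^ (10 * k) * (m * Fintype.card Λ ^ 2) ≤ U.card ^ 3)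
    (hm1 : 2 ^ 18 * N ^ (10 * k) * m ≤ U.card) {C δ₀ δ η s K : ℝ} (hC : 1 ≤ C)
    (hδ₀ : δ₀ ≤ 1 / 2) (hδ0 : 0 < δ) (hδ1 : δ ≤ 1 / 2) (hη0 : 0 < η) (hη1 : η ≤ 1) (hs0 : 0 < s)
    (h2s : (2 : ℝ) ^ (-s) ≤ δ / 4) (hCs : 100 * (C ^ 2 * s) ≤ δ ^ 4 * U.card)
    (hK : 2048 * (N : ℝ) ^ (4 * k) ≤ K) {f : (Λ → ZMod N) → ℝ} (hf : IsBounded U.card C s δ₀ f)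
    {D : PMF ↥(U.matchings m)} (hD : U.IsPseudoUniform D) {G : Set ↥(U.matchings m)}
    (hG : ∀ M : ↥(U.matchings m),
      touchedMass (fun b => ‖charCoeff (fun x => (f x : ℂ)) b‖) ⌊(C ^ 2)⁻¹ * (U.card : ℝ)⌋₊ 0 M.1
        ≤ δ / (2 * η) →
      (∀ d : ℕ, 1 ≤ d → (d : ℝ) ≤ ((K ^ 2 * C) ^ 2)⁻¹ * U.card →
        touchedMass (fun b => ‖charCoeff (fun x => (f x : ℂ)) b‖) ⌊(C ^ 2)⁻¹ * (U.card : ℝ)⌋₊ d M.1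
          ≤ η⁻¹ * 32 ^ d * growthBound C U.card d s) →
      (∀ d : ℕ, (d : ℝ) ≤ ((K ^ 2 * C) ^ 2)⁻¹ * U.card →
        (2 : ℝ) ^ s * (Finset.univ.filter fun a : Λ → ZMod N => hammingNorm a = d).card *
          largeMass (fun b => ‖charCoeff (fun x => (f x : ℂ)) b‖) ⌊(C ^ 2)⁻¹ * (U.card : ℝ)⌋₊ d M.1
            ≤ (δ / (2 * η)) ^ 2) → M ∈ G) :
    1 - 3 * η ≤ prob D G := by
  have hn' : (0 : ℝ) < U.card := by exact_mod_cast hn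
  have hN1 : (1 : ℝ) ≤ N := by exact_mod_cast (by omega : 1 ≤ N)
  have hQ1 : (1 : ℝ) ≤ (N : ℝ) ^ (4 * k) := one_le_pow₀ hN1
  have hK1 : 1 ≤ K := by linarith
  have hδ4 : δ ^ 4 * (U.card : ℝ) ≤ U.card :=
    mul_le_of_le_one_left hn'.le (pow_le_one₀ hδ0.le (by linarith))
  have hC2s : 0 ≤ C ^ 2 * s := by positivity
  set A : (Λ → ZMod N) → ℝ := fun b => ‖charCoeff (fun x => (f x : ℂ)) b‖ with hAdef
  have hA : ∀ b, 0 ≤ A b := fun b => norm_nonneg _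
  set W : ℕ := ⌊(C ^ 2)⁻¹ * (U.card : ℝ)⌋₊ with hWdef
  set E : ℕ := ⌊((K ^ 2 * C) ^ 2)⁻¹ * (U.card : ℝ)⌋₊ with hEdef
  have hle_W : ∀ d : ℕ, d ≤ W ↔ (d : ℝ) ≤ (C ^ 2)⁻¹ * U.card := fun d =>
    Nat.le_floor_iff (by positivity)
  have hle_E : ∀ d : ℕ, d ≤ E ↔ (d : ℝ) ≤ ((K ^ 2 * C) ^ 2)⁻¹ * U.card := fun d =>
    Nat.le_floor_iff (by positivity)
  have hEW : E ≤ W := by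
    refine Nat.floor_le_floor (mul_le_mul_of_nonneg_right ?_ hn'.le)
    refine inv_anti₀ (by positivity) (pow_le_pow_left₀ (by linarith) ?_ 2)
    exact le_mul_of_one_le_left (by linarith) (one_le_pow₀ hK1)
  have hW : C ^ 2 * (W : ℝ) ≤ U.card := by
    have h := (hle_W W).1 le_rfl
    rw [inv_mul_eq_div, le_div_iff₀ (by positivity)] at h
    linarith
  have hWn : W ≤ U.card := by
    have h1 : (W : ℝ) ≤ U.card :=
      (le_mul_of_one_le_left (Nat.cast_nonneg _) (one_le_pow₀ hC)).trans hW
    exact_mod_cast h1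
  have hF : ∀ w, 1 ≤ w → w ≤ W → ∑ b : Λ → ZMod N with hammingNorm b = w, A b
      ≤ growthBound C U.card w s := by
    intro w hw1 hw2
    have h := hf.level_le w hw1 ((hle_W w).1 hw2)
    rwa [wienerNorm_levelPart] at h
  have hFpos : ∀ d, 1 ≤ d → d ≤ E → 0 < growthBound C U.card d s := by
    intro d hd1 hd2
    rw [growthBound_eq_pow (by linarith)]
    have := one_le_growthBase (s := s) hC hd1 ((hd2.trans hEW).trans hWn)
    positivity
  -- Parseval: `∑ |f̂| ^ 2 = E |f| ^ 2 ≤ max f * E f`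
  have hA2 : ∑ b, A b ^ 2 ≤ (2 : ℝ) ^ s * (3 / 2) := by
    have h := isSelfDual_character.parseval (fun x : Λ → ZMod N => (f x : ℂ))
    refine (le_of_eq h).trans
      (sum_sq_div_card_le hf.nonneg hf.le_max (by positivity) ?_)
    linarith [hf.mean_le, hδ₀]
  set lv : ℕ → ℝ := fun d =>
    ((Finset.univ.filter fun a : Λ → ZMod N => hammingNorm a = d).card : ℝ) with hlv
  have hlv0 : ∀ d ≤ E, 0 < lv d := by
    intro d hd
    have hdL : d ≤ (Finset.univ : Finset Λ).card :=
      ((hd.trans hEW).trans hWn).trans hnL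
    obtain ⟨S, -, hS⟩ := Finset.exists_subset_card_eq hdL
    have : Fact (1 < N) := ⟨hN⟩
    simp only [hlv, Nat.cast_pos, Finset.card_pos]
    refine ⟨fun v => if v ∈ S then 1 else 0, ?_⟩
    simp [hammingNorm, hS]
  -- each threshold is the bound on the corresponding mean, divided by `η` and, for the families
  -- indexed by the level, by the geometric weight of the level
  refine one_sub_three_mul_le_prob D hη0 (E := E)
    (X := fun M => touchedMass A W 0 M.1)
    (Y := fun d M => touchedMass A W d M.1)
    (Z := fun d M => largeMass A W d M.1)
    (x := δ / (2 * η)) (y := fun d => η⁻¹ * 32 ^ d * growthBound C U.card d s)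
    (z := fun d => 3 * η⁻¹ * (2 : ℝ) ^ s / ((2 : ℝ) ^ (4 * s) * lv d))
    (fun M => touchedMass_nonneg hA _ _ _)
    (fun d M => touchedMass_nonneg hA _ _ _)
    (fun d M => largeMass_nonneg _ _ _ _) (by positivity)
    (fun d hd1 hd2 => mul_pos (by positivity) (hFpos d hd1 hd2))
    (fun d hd => by have := hlv0 d hd; positivity) ?_ ?_ ?_ ?_
  · refine (pmfMean_touchedMass_zero_le hk hN hm1 hm0 hD hA hC hδ0 (by linarith)
      (by linarith) (by linarith) hW hF).trans (le_of_eq ?_)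
    field_simp
  · intro d hd1 hd2
    refine (pmfMean_touchedMass_le_growthBound hk hN hm1 hm0 hD hA hC
      (by linarith) hW hd1 (hd2.trans hEW) hF).trans (le_of_eq ?_)
    have h32 : (32 : ℝ) ^ d = 2 ^ d * 16 ^ d := by rw [← mul_pow]; norm_num
    rw [h32, one_div, inv_pow]
    field_simp
  · intro d hd
    have hl := hlv0 d hd
    have h := pmfMean_largeMass_mul_le (D := D) (A := A) (W := W) (d := d)
      (T := (2 : ℝ) ^ (4 * s) * 2 ^ d * lv d) (fun b hb => by
        have hω : (C ^ 2)⁻¹ * (U.card : ℝ) ≤ (min (hammingNorm b) U.card : ℕ) := by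
          rw [Nat.cast_min]
          refine le_min ((Nat.lt_of_floor_lt hb).le) ?_
          exact mul_le_of_le_one_left hn'.le (inv_le_one_of_one_le₀ (one_le_pow₀ hC))
        obtain ⟨h1, h2⟩ := room_above_cutoff hk hN (s := s) hC hK (by linarith)
          ((hle_E d).1 hd) hω
        exact pmfMean_card_reweightings_large_le hk hN hm3 hm0 hnL hD b d rfl
          (by omega) h1 h2)
    have h' := h.trans hA2
    rw [← le_div_iff₀ (by positivity)] at h'
    refine h'.trans (le_of_eq ?_)
    rw [one_div, inv_pow, pow_succ]
    field_simp
  · intro M hX hY hZ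
    refine hG M hX (fun d hd1 hd2 => hY d hd1 ((hle_E d).2 hd2)) fun d hd => ?_
    have hd' := (hle_E d).2 hd
    have hp : (2 : ℝ) ^ (4 * s) = ((2 : ℝ) ^ s) ^ 4 := by
      rw [← Real.rpow_natCast, ← Real.rpow_mul two_pos.le]
      congr 1
      push_cast
      ring
    have hz := hZ d hd'
    rw [hp] at hz
    exact sq_cutoff_le (by positivity) hη0 hη1 (by rwa [← Real.rpow_neg two_pos.le]) (hlv0 d hd') hz

end GoodProbability

end LabeledMatching

theorem mainTheorem12 {k N : ℕ} [NeZero N] (hk : 1 ≤ k) (hN : 2 ≤ N)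
    {Λ : Type*} [Fintype Λ] [DecidableEq Λ] (U : LabeledMatching.KUniverse k Λ)
    (C δ₀ δ : ℝ) (hC : 1 ≤ C) (hδ₀ : δ₀ ∈ Set.Icc (0 : ℝ) (1 / 2))
    (hδ : δ ∈ Set.Ioc (0 : ℝ) (1 / 2))
    (m : ℕ) (s : ℝ) (hm_pos : 0 < m)
    (hm_le : (m : ℝ) ≤ (U.card : ℝ) ^ 3 /
      ((2 : ℝ) ^ 18 * (N : ℝ) ^ (10 * k) * (Fintype.card Λ : ℝ) ^ 2))
    (hs_ge : Real.logb 2 (4 / δ) ≤ s)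
    (hs_le : s ≤ ((10 * C) ^ 2)⁻¹ * δ ^ 4 * (m : ℝ))
    (f : (Λ → ZMod N) → ℝ) (hf : LabeledMatching.IsBounded U.card C s δ₀ f)
    (D : PMF ↥(U.matchings m)) (hD : U.IsPseudoUniform D)
    (η : ℝ) (hη : η ∈ Set.Ioo (0 : ℝ) (1 / 2)) :
    1 - 3 * η ≤ LabeledMatching.prob D
      {M | ∀ A : Finset (LabeledMatching.Labeling N M.1),
        (2 : ℝ) ^ (-s) * (N : ℝ) ^ (k * m) ≤ (A.card : ℝ) →
        ∀ μ : PMF (Fin k → ZMod N), LabeledMatching.IsOneWiseIndependent μ →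
          LabeledMatching.IsBounded U.card
            ((2 : ℝ) ^ 22 * (η ^ 2)⁻¹ * (N : ℝ) ^ (8 * k) * C) (2 * s) (δ₀ + η⁻¹ * δ)
            (fun x => f x *
              LabeledMatching.markovOp M.1 μ (LabeledMatching.uniformDensity A) x)} := by
  obtain ⟨hδ0, hδ1⟩ := hδ
  obtain ⟨hη0, hη1⟩ := hη
  have hnL : U.card ≤ Fintype.card Λ := (U.card_parts ⟨0, hk⟩).symm.le.trans (Finset.card_le_univ _)
  obtain ⟨hn, hm3, hm1⟩ := LabeledMatching.matching_size_bounds hN hnL hm_pos hm_le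
  have hmn : m ≤ U.card := (Nat.le_mul_of_pos_left m
    (Nat.mul_pos (by norm_num) (pow_pos (by omega : 0 < N) _))).trans hm1
  have hmn' : (m : ℝ) ≤ U.card := by exact_mod_cast hmn
  have hN1 : (1 : ℝ) ≤ N := by exact_mod_cast (by omega : 1 ≤ N)
  have hQ1 : (1 : ℝ) ≤ (N : ℝ) ^ (4 * k) := one_le_pow₀ hN1
  have hηinv : 2 ≤ η⁻¹ := by rw [le_inv_comm₀ two_pos hη0]; linarith
  have h2s : 4 / δ ≤ (2 : ℝ) ^ s := (Real.logb_le_iff_le_rpow (by norm_num) (by positivity)).1 hs_ge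
  have h2s' : (2 : ℝ) ^ (-s) ≤ δ / 4 := by
    rw [Real.rpow_neg two_pos.le, show δ / 4 = (4 / δ)⁻¹ by rw [inv_div]]
    exact inv_anti₀ (by positivity) h2s
  have hs0 : 0 < s := by
    refine lt_of_lt_of_le (Real.logb_pos (by norm_num) ?_) hs_ge
    rw [lt_div_iff₀ hδ0]; linarith
  have hCs : 100 * (C ^ 2 * s) ≤ δ ^ 4 * U.card := by
    have h1 : 100 * (C ^ 2 * s) ≤ δ ^ 4 * m := by
      rw [mul_assoc, inv_mul_eq_div, le_div_iff₀ (by positivity)] at hs_le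
      nlinarith
    exact h1.trans (by gcongr)
  -- replacing `C` by `K ^ 2 * C` multiplies the base of the growth bound by `K`
  set K : ℝ := 2048 * η⁻¹ * (N : ℝ) ^ (4 * k) with hK
  have hC' : (2 : ℝ) ^ 22 * (η ^ 2)⁻¹ * (N : ℝ) ^ (8 * k) * C = K ^ 2 * C := by
    rw [hK, mul_pow, mul_pow, ← pow_mul, inv_pow, show 4 * k * 2 = 8 * k by ring]
    norm_num
  have hKge : 2048 * (N : ℝ) ^ (4 * k) ≤ K := by
    rw [hK]; nlinarith
  rw [hC']
  refine LabeledMatching.one_sub_three_mul_le_prob_of_masses hk hN hm_pos hn hnL hm3 hm1 hC hδ₀.2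
    hδ0 hδ1 hη0 (by linarith) hs0 h2s' hCs hKge hf hD fun M hX hY hZ B hB μ hμ => ?_
  have hBcard : (2 : ℝ) ^ (-s) * (Fintype.card (LabeledMatching.Labeling N M.1) : ℝ) ≤ B.card := by
    rw [LabeledMatching.card_labeling]
    exact_mod_cast hB
  have hB0 : 0 < B.card := by
    have h1 : (0 : ℝ) < B.card := lt_of_lt_of_le (by positivity) hB
    exact_mod_cast h1
  exact LabeledMatching.isBounded_mul_markovOp (by omega) M.2 hmn hC hη0 hη1.le hδ0 hδ1 hs0
    hδ₀.2 hf hX hY hZ (LabeledMatching.uniformDensity_nonneg B)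
    (LabeledMatching.sum_uniformDensity hB0) (LabeledMatching.uniformDensity_le hBcard hB0) hμ
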